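/- Let $f\in\mathbb{C}[x_0,\dots,x_4]$ be a homogeneous cubic polynomial whose partial derivatives have no common zero on $X=\{f=0\}\subset\mathbb{P}^4$, so that $X$ is a smooth cubic threefold. A codimension-one foliation of degree one on $X$ (respectively on $\mathbb{P}^4$) is given by a twisted $1$-form $\omega_0\in H^0(X,\Omega^1_X(3))$ (respectively $\omega\in H^0(\mathbb{P}^4,\Omega^1_{\mathbb{P}^4}(3))$), determined up to a nonzero scalar, that satisfies the Frobenius integrability condition $\omega_0\wedge d\omega_0=0$ (respectively $\omega\wedge d\omega=0$) and whose zero set has codimension at least two. Every codimension-one foliation of degree one on $X$ extends to a codimension-one foliation of degree one on $\mathbb{P}^4$. More precisely, if $\omega_0\in H^0(X,\Omega^1_X(3))$ defines a codimension-one foliation of degree one on $X$, then there is a unique $\omega\in H^0(\mathbb{P}^4,\Omega^1_{\mathbb{P}^4}(3))$ with $\omega|_X=\omega_0$, and this $\omega$ is integrable and has zero set of codimension at least two, so that it defines a codimension-one foliation of degree one on $\mathbb{P}^4$ whose restriction to $X$ is the given one. -/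

import Mathlib

open scoped Topology

/-- The differential `df_x : ℂ^(n+1) → ℂ` of a polynomial `f` at the point `x`. -/
noncomputable def polyDiff {n : ℕ} (f : MvPolynomial (Fin (n + 1)) ℂ) (x : Fin (n + 1) → ℂ) :
    (Fin (n + 1) → ℂ) →ₗ[ℂ] ℂ :=
  ∑ i, MvPolynomial.eval x (MvPolynomial.pderiv i f) • LinearMap.proj i

/-- The punctured affine cone `{x ≠ 0 : f x = 0 for all f ∈ I}` over the closed subset `V(I)` of
`ℙⁿ` (for a homogeneous ideal `I`). The points of `V(I)` are its `ℂˣ`-orbits. For `I = ⊥` the set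
`V(I)` is `ℙⁿ` and the punctured cone is `ℂ^(n+1) ∖ {0}`. -/
def puncturedCone {n : ℕ} (I : Ideal (MvPolynomial (Fin (n + 1)) ℂ)) : Set (Fin (n + 1) → ℂ) :=
  {x | x ≠ 0 ∧ ∀ f ∈ I, MvPolynomial.eval x f = 0}

/-- The tangent space at `x` of the affine cone defined by `I`. -/
noncomputable def coneTangent {n : ℕ} (I : Ideal (MvPolynomial (Fin (n + 1)) ℂ))
    (x : Fin (n + 1) → ℂ) : Submodule ℂ (Fin (n + 1) → ℂ) :=
  ⨅ f ∈ I, LinearMap.ker (polyDiff f x)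

theorem puncturedCone_anti {n : ℕ} {I J : Ideal (MvPolynomial (Fin (n + 1)) ℂ)} (h : I ≤ J) :
    puncturedCone J ⊆ puncturedCone I :=
  fun _ hx => ⟨hx.1, fun f hf => hx.2 f (h hf)⟩

theorem coneTangent_anti {n : ℕ} {I J : Ideal (MvPolynomial (Fin (n + 1)) ℂ)} (h : I ≤ J)
    (x : Fin (n + 1) → ℂ) : coneTangent J x ≤ coneTangent I x :=
  biInf_mono fun _ hf => h hf

/-- Global holomorphic 1-forms on `X = V(I) ⊆ ℙⁿ` with values in `𝒪_X(k)`, that is, elements of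
`H⁰(X, Ω¹_X(k))` (for `X` smooth with ideal `I`).

Write `L = ℂ x` for the line that a point `x` of the punctured cone spans and `T` for the tangent
space of the cone at `x`. Then `T_{[x]} X = Hom(L, T / L)` and the fibre of `𝒪_X(k)` at `[x]` is
`Hom(L^{⊗k}, ℂ)`. A linear map from the first to the second is the same as a linear form `α_x` on
`T` with `α_x (x) = 0` (evaluate at the homomorphism `x ↦ v`, and then at `x^{⊗k}`), where
`α_{c x} (c v) = c ^ k α_x (v)` when the generator `x` of `L` is replaced by `c x`. So twisted forms
on `X` are the holomorphic 1-forms on the punctured cone which annihilate the radial vector field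
and are homogeneous of degree `k`. Holomorphic means: locally the restriction of a holomorphic
1-form on an open subset of `ℂ^(n+1)`. -/
structure TwistedOneForm {n : ℕ} (I : Ideal (MvPolynomial (Fin (n + 1)) ℂ)) (k : ℕ) where
  /-- the linear form on the tangent space of the cone at a point of the punctured cone -/
  toFun : ∀ x : Fin (n + 1) → ℂ, x ∈ puncturedCone I → (coneTangent I x →ₗ[ℂ] ℂ)
  holomorphic : ∀ x ∈ puncturedCone I,
    ∃ A : (Fin (n + 1) → ℂ) → ((Fin (n + 1) → ℂ) →L[ℂ] ℂ), AnalyticAt ℂ A x ∧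
      ∀ᶠ y in 𝓝 x, ∀ (hy : y ∈ puncturedCone I) (v : Fin (n + 1) → ℂ) (hv : v ∈ coneTangent I y),
        A y v = toFun y hy ⟨v, hv⟩
  homogeneous : ∀ (c : ℂ), c ≠ 0 → ∀ (x : Fin (n + 1) → ℂ) (hx : x ∈ puncturedCone I)
    (hcx : c • x ∈ puncturedCone I) (v : Fin (n + 1) → ℂ) (hv : v ∈ coneTangent I x)
    (hcv : c • v ∈ coneTangent I (c • x)),
    toFun (c • x) hcx ⟨c • v, hcv⟩ = c ^ k * toFun x hx ⟨v, hv⟩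
  radial : ∀ (x : Fin (n + 1) → ℂ) (hx : x ∈ puncturedCone I) (hv : x ∈ coneTangent I x),
    toFun x hx ⟨x, hv⟩ = 0

/-- `A` is, near `x`, a holomorphic 1-form on `ℂ^(n+1)` whose restriction to the cone is `ω`. -/
def TwistedOneForm.IsLocalLift {n : ℕ} {I : Ideal (MvPolynomial (Fin (n + 1)) ℂ)} {k : ℕ}
    (ω : TwistedOneForm I k) (x : Fin (n + 1) → ℂ)
    (A : (Fin (n + 1) → ℂ) → ((Fin (n + 1) → ℂ) →L[ℂ] ℂ)) : Prop :=
  AnalyticAt ℂ A x ∧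
    ∀ᶠ y in 𝓝 x, ∀ (hy : y ∈ puncturedCone I) (v : Fin (n + 1) → ℂ) (hv : v ∈ coneTangent I y),
      A y v = ω.toFun y hy ⟨v, hv⟩

/-- The exterior derivative of a 1-form: `dA_x (u, v) = (D_u A)_x (v) - (D_v A)_x (u)`. -/
noncomputable def oneFormDeriv {n : ℕ} (A : (Fin (n + 1) → ℂ) → ((Fin (n + 1) → ℂ) →L[ℂ] ℂ))
    (x u v : Fin (n + 1) → ℂ) : ℂ :=
  fderiv ℂ A x u v - fderiv ℂ A x v u

/-- The value `(A ∧ dA)_x (u, v, w)`. -/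
noncomputable def wedgeDeriv {n : ℕ} (A : (Fin (n + 1) → ℂ) → ((Fin (n + 1) → ℂ) →L[ℂ] ℂ))
    (x u v w : Fin (n + 1) → ℂ) : ℂ :=
  A x u * oneFormDeriv A x v w - A x v * oneFormDeriv A x u w + A x w * oneFormDeriv A x u v

/-- Frobenius integrability `ω ∧ dω = 0`, as forms on `X`. As restriction commutes with `d` and
`∧`, `ω ∧ dω` is the restriction of `A ∧ dA` to the tangent spaces of the cone, for any lift `A`. -/
def TwistedOneForm.IsIntegrable {n : ℕ} {I : Ideal (MvPolynomial (Fin (n + 1)) ℂ)} {k : ℕ}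
    (ω : TwistedOneForm I k) : Prop :=
  ∀ x ∈ puncturedCone I, ∀ A, ω.IsLocalLift x A →
    ∀ u ∈ coneTangent I x, ∀ v ∈ coneTangent I x, ∀ w ∈ coneTangent I x, wedgeDeriv A x u v w = 0

/-- The (punctured cone over the) singular set of `ω`: the points where `ω` vanishes. -/
def TwistedOneForm.singularCone {n : ℕ} {I : Ideal (MvPolynomial (Fin (n + 1)) ℂ)} {k : ℕ}
    (ω : TwistedOneForm I k) : Set (Fin (n + 1) → ℂ) :=
  {x | ∃ hx : x ∈ puncturedCone I, ω.toFun x hx = 0}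

/-- The singular set of `ω` has codimension at least two in `X`. The singular set is a closed
algebraic subset of `X`; dimensions are those of the coordinate rings of the affine cones over
`sing(ω)` and over `X`, which are one more than those of `sing(ω)` (if it is not empty) and of `X`.
If `sing(ω)` is empty, the left side is `⊥`. -/
def TwistedOneForm.SingCodimGeTwo {n : ℕ} {I : Ideal (MvPolynomial (Fin (n + 1)) ℂ)} {k : ℕ}
    (ω : TwistedOneForm I k) : Prop :=
  ringKrullDim (MvPolynomial (Fin (n + 1)) ℂ ⧸ MvPolynomial.vanishingIdeal ℂ ω.singularCone) + 2
    ≤ ringKrullDim (MvPolynomial (Fin (n + 1)) ℂ ⧸ I)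

/-- The restriction `H⁰(Y, Ω¹_Y(k)) → H⁰(X, Ω¹_X(k))` for `X = V(J) ⊆ Y = V(I)`. -/
noncomputable def TwistedOneForm.restrict {n : ℕ} {I J : Ideal (MvPolynomial (Fin (n + 1)) ℂ)} {k : ℕ}
    (h : I ≤ J) (ω : TwistedOneForm I k) : TwistedOneForm J k where
  toFun x hx := (ω.toFun x (puncturedCone_anti h hx)).comp
    (Submodule.inclusion (coneTangent_anti h x))
  holomorphic x hx := by
    obtain ⟨A, hA, hA'⟩ := ω.holomorphic x (puncturedCone_anti h hx)
    refine ⟨A, hA, ?_⟩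
    filter_upwards [hA'] with y hy hyJ v hv
    exact hy (puncturedCone_anti h hyJ) v (coneTangent_anti h y hv)
  homogeneous c hc x hx hcx v hv hcv :=
    ω.homogeneous c hc x (puncturedCone_anti h hx) (puncturedCone_anti h hcx) v
      (coneTangent_anti h x hv) (coneTangent_anti h (c • x) hcv)
  radial x hx hv := ω.radial x (puncturedCone_anti h hx) (coneTangent_anti h x hv)

/-- A codimension-one (singular holomorphic) foliation of degree `d` on `X = V(I) ⊆ ℙⁿ`, presented
by a twisted 1-form defining it: an element of `H⁰(X, Ω¹_X(d + 2))` which is integrable and whose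
singular set has codimension at least two. -/
structure CodimOneFoliation {n : ℕ} (I : Ideal (MvPolynomial (Fin (n + 1)) ℂ)) (d : ℕ) where
  form : TwistedOneForm I (d + 2)
  integrable : form.IsIntegrable
  sing_codim : form.SingCodimGeTwo

/-- The projective hypersurface `{f = 0}` is smooth, with `f` as reduced equation. -/
def IsSmoothEquation {n : ℕ} (f : MvPolynomial (Fin (n + 1)) ℂ) : Prop :=
  ∀ x : Fin (n + 1) → ℂ, x ≠ 0 → MvPolynomial.eval x f = 0 →
    ∃ i, MvPolynomial.eval x (MvPolynomial.pderiv i f) ≠ 0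

/-! Write w = df. By Euler's relation and smoothness the partial derivatives of f vanish together
only at the origin, so some power of every variable lies in the ideal they generate, and the Koszul
complex of w is exact in the degrees needed (`exactMod_of_X_pow_mem`). This division property,
together with the fact that a polynomial vanishing on X is a multiple of f
(`dvd_of_eval_eq_zero_on_zeros`), drives the algebra.

Lifting. Evaluating ω₀ on the tangent fields ∂ᵢf ∂ⱼ − ∂ⱼf ∂ᵢ gives homogeneous holomorphic functions
on the punctured cone. These are restrictions of polynomials (`exists_mvPolynomial_eq_on_zeros`): in
coordinates where f becomes a monic polynomial F in one variable, a function is recovered from its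
values on the sheets of the projection by Lagrange interpolation, and the coefficients are traces ∑
ψ/F′. Traces are residue integrals, so they extend over the branch locus; being homogeneous, they
are polynomials. Two divisions by df turn the values on the tangent fields into polynomial
coefficients a. Subtracting a multiple of df makes a radial, and taking a homogeneous component
makes it homogeneous (`exists_homogeneous_form`). The lift is unique, since a form with coefficients
of degree deg f − 1 that vanishes on X is a constant multiple of df, which is radial only if it is
zero (`eq_zero_of_restrict_eq_zero`).

Integrability (`frobeniusCoeff_eq_zero`). Let Ψ = a ∧ da. As Ψ vanishes on X, f divides df ∧ Ψ, and
division gives df ∧ Ψ = f df ∧ β with β constant for degree reasons. Contraction with the Euler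
field R, which kills Ψ, gives 3Ψ = 3fβ − df ∧ i_R β. Differentiating, da ∧ da is a scalar multiple
of df ∧ β′ for a constant 3-form β′. In five variables (da)³ = 0; contracting this with ∂ₙ yields df
∧ θₙ ∧ β′ = 0, where θₙ is the n-th row of da. Now θₙ ∧ β′ is a multiple of df, but its coefficients
are linear and those of df quadratic, so θₙ ∧ β′ = 0. If β′ ≠ 0 this forces da to have rank at most
two; in either case da ∧ da = 0, and contraction with R gives a ∧ da = 0.

Singular set (`singCodimGeTwo_polyTwistedForm`). If the lift vanished in codimension one, a
polynomial p with p(0) = 0 would divide all its coefficients, and ω₀ would vanish on f = p = 0,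
which has codimension at most one in X. -/

/-! ### The Koszul complex on cochains that need not alternate -/

/-- `p`-cochains with values in `R` on the full simplex with vertex set `ι`. -/
def SimplexCochain (ι : Type) (R : Type*) : ℕ → Type _
  | 0 => R
  | p + 1 => ι → SimplexCochain ι R p

namespace SimplexCochain

variable {ι : Type} {R : Type*} [CommRing R]

instance instAddCommGroup : ∀ p, AddCommGroup (SimplexCochain ι R p)
  | 0 => inferInstanceAs (AddCommGroup R)
  | p + 1 => letI := instAddCommGroup p; inferInstanceAs (AddCommGroup (ι → SimplexCochain ι R p))

instance instModule : ∀ p, Module R (SimplexCochain ι R p)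
  | 0 => inferInstanceAs (Module R R)
  | p + 1 => letI := instModule p; inferInstanceAs (Module R (ι → SimplexCochain ι R p))

/-- Evaluation of a cochain at its first vertex. -/
def face (p : ℕ) (i : ι) : SimplexCochain ι R (p + 1) →ₗ[R] SimplexCochain ι R p where
  toFun P := P i
  map_add' _ _ := rfl
  map_smul' _ _ := rfl

/-- The cochain with given faces. -/
def glue {M : Type*} [AddCommGroup M] [Module R M] (p : ℕ)
    (g : ι → M →ₗ[R] SimplexCochain ι R p) : M →ₗ[R] SimplexCochain ι R (p + 1) where
  toFun P := fun i => g i P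
  map_add' x y := funext fun i => (g i).map_add x y
  map_smul' c x := funext fun i => (g i).map_smul c x

/-- The Koszul differential of the covector `w`. -/
def koszulD (w : ι → R) : ∀ p, SimplexCochain ι R p →ₗ[R] SimplexCochain ι R (p + 1)
  | 0 => glue 0 fun i => w i • LinearMap.id
  | p + 1 => glue (p + 1) fun i => w i • LinearMap.id - koszulD w p ∘ₗ face p i

theorem koszulD_succ_apply (w : ι → R) (p : ℕ) (P : SimplexCochain ι R (p + 1)) (i : ι) :
    face (p + 1) i (koszulD w (p + 1) P) = w i • P - koszulD w p (face p i P) := rfl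

theorem koszulD_zero_apply (w : ι → R) (P : SimplexCochain ι R 0) (i : ι) :
    face 0 i (koszulD w 0 P) = w i • P := rfl

theorem ext_face {p : ℕ} {P Q : SimplexCochain ι R (p + 1)} (h : ∀ i, face p i P = face p i Q) :
    P = Q := funext h

/-- The recursion in the first slot leaves w i • dP − d(w i • P) + d(dPᵢ), so the square vanishes by
induction and alternation is never needed. -/
theorem koszulD_koszulD (w : ι → R) : ∀ (p : ℕ) (P : SimplexCochain ι R p),
    koszulD w (p + 1) (koszulD w p P) = 0
  | 0, P => ext_face fun i => by
      rw [koszulD_succ_apply, koszulD_zero_apply, map_smul, sub_self, map_zero]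
  | p + 1, P => ext_face fun i => by
      rw [koszulD_succ_apply, koszulD_succ_apply, map_sub, koszulD_koszulD w p, map_smul,
        sub_zero, sub_self, map_zero]

/-- Contraction with the vector `c`. -/
def contract [Fintype ι] (c : ι → R) (p : ℕ) :
    SimplexCochain ι R (p + 1) →ₗ[R] SimplexCochain ι R p :=
  ∑ i, c i • face p i

theorem contract_koszulD_zero [Fintype ι] (c w : ι → R) (P : SimplexCochain ι R 0) :
    contract c 0 (koszulD w 0 P) = (∑ i, c i * w i) • P := by
  simp [contract, LinearMap.sum_apply, koszulD_zero_apply, smul_smul, Finset.sum_smul]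

/-- The homotopy formula: contraction of the first slot shows that multiplication by any element of
the ideal generated by `w` is homotopic to zero. -/
theorem contract_koszulD_succ [Fintype ι] (c w : ι → R) (p : ℕ)
    (P : SimplexCochain ι R (p + 1)) :
    contract c (p + 1) (koszulD w (p + 1) P) =
      (∑ i, c i * w i) • P - koszulD w p (contract c p P) := by
  simp [contract, LinearMap.sum_apply, koszulD_succ_apply, smul_smul, Finset.sum_smul, smul_sub,
    Finset.sum_sub_distrib]

/-- The cochains with values in the ideal `I`. -/
def valuedIn (I : Ideal R) : ∀ p, Submodule R (SimplexCochain ι R p)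
  | 0 => I
  | p + 1 => ⨅ i, (valuedIn I p).comap (face p i)

theorem mem_valuedIn_succ {I : Ideal R} {p : ℕ} {P : SimplexCochain ι R (p + 1)} :
    P ∈ valuedIn I (p + 1) ↔ ∀ i, face p i P ∈ valuedIn I p := by
  simp [valuedIn]

theorem valuedIn_mono {I J : Ideal R} (h : I ≤ J) : ∀ p,
    valuedIn (ι := ι) I p ≤ valuedIn J p
  | 0 => h
  | p + 1 => fun _ hP => mem_valuedIn_succ.2 fun i =>
      valuedIn_mono h p (mem_valuedIn_succ.1 hP i)

theorem koszulD_mem_valuedIn (w : ι → R) {I : Ideal R} : ∀ {p : ℕ} {P : SimplexCochain ι R p},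
    P ∈ valuedIn I p → koszulD w p P ∈ valuedIn I (p + 1)
  | 0, _, hP => mem_valuedIn_succ.2 fun i => by
      rw [koszulD_zero_apply]; exact Submodule.smul_mem _ _ hP
  | p + 1, P, hP => mem_valuedIn_succ.2 fun i => by
      rw [koszulD_succ_apply]
      exact Submodule.sub_mem _ (Submodule.smul_mem _ _ hP)
        (koszulD_mem_valuedIn w (mem_valuedIn_succ.1 hP i))

theorem contract_mem_valuedIn [Fintype ι] (c : ι → R) {I : Ideal R} {p : ℕ}
    {P : SimplexCochain ι R (p + 1)} (hP : P ∈ valuedIn I (p + 1)) :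
    contract c p P ∈ valuedIn I p := by
  rw [contract, LinearMap.sum_apply]
  exact Submodule.sum_mem _ fun i _ => Submodule.smul_mem _ _ (mem_valuedIn_succ.1 hP i)

theorem smul_mem_valuedIn {u : R} {I : Ideal R} (hu : u ∈ I) : ∀ {p : ℕ}
    (P : SimplexCochain ι R p), u • P ∈ valuedIn I p
  | 0, P => Ideal.mul_mem_right (show R from P) I hu
  | _ + 1, P => mem_valuedIn_succ.2 fun i => by
      rw [map_smul]; exact smul_mem_valuedIn hu (face _ i P)

theorem mem_valuedIn_of_smul_mem {u : R} {I : Ideal R} (hu : ∀ r, u * r ∈ I → r ∈ I) :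
    ∀ {p : ℕ} {P : SimplexCochain ι R p}, u • P ∈ valuedIn I p → P ∈ valuedIn I p
  | 0, P, h => hu P h
  | _ + 1, _, h => mem_valuedIn_succ.2 fun i =>
      mem_valuedIn_of_smul_mem hu (by rw [← map_smul]; exact mem_valuedIn_succ.1 h i)

theorem exists_of_mem_valuedIn_sup {u : R} {I : Ideal R} : ∀ {p : ℕ}
    {P : SimplexCochain ι R p}, P ∈ valuedIn (I ⊔ Ideal.span {u}) p →
      ∃ Q, P - u • Q ∈ valuedIn I p
  | 0, P, h => by
      obtain ⟨a, ha, b, hb, hab⟩ := Submodule.mem_sup.1 (show (show R from P) ∈ _ from h)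
      obtain ⟨q, hq⟩ := Ideal.mem_span_singleton'.1 hb
      refine ⟨show R from q, ?_⟩
      have : (show R from P) - u * q = a := by rw [← hab, ← hq]; ring
      exact (this ▸ ha : (show R from P) - u * q ∈ I)
  | p + 1, P, h => by
      choose Q hQ using fun i => exists_of_mem_valuedIn_sup (mem_valuedIn_succ.1 h i)
      exact ⟨Q, mem_valuedIn_succ.2 hQ⟩

theorem mem_valuedIn_of_koszulD_zero [Fintype ι] {w c : ι → R} {u : R} {I : Ideal R}
    (huc : ∑ i, c i * w i = u) (hu : ∀ r, u * r ∈ I → r ∈ I) {P : SimplexCochain ι R 0}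
    (hP : koszulD w 0 P ∈ valuedIn I 1) : P ∈ valuedIn I 0 := by
  apply mem_valuedIn_of_smul_mem hu
  rw [← huc, ← contract_koszulD_zero]
  exact contract_mem_valuedIn c hP

/-- The cocycles of degree `p + 1` modulo `I` are coboundaries modulo `I`. -/
def ExactMod (w : ι → R) (I : Ideal R) (p : ℕ) : Prop :=
  ∀ P : SimplexCochain ι R (p + 1), koszulD w (p + 1) P ∈ valuedIn I (p + 2) →
    ∃ Q, P - koszulD w p Q ∈ valuedIn I (p + 1)

/-- If dP ≡ 0 mod I, the homotopy formula gives uP ≡ d(cP) mod I, where cP is the contraction. So cP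
is a cocycle modulo I + (u), where by hypothesis it agrees with a true cocycle Q. Writing cP ≡ Q +
uG mod I gives u(P − dG) ≡ dQ = 0, and u cancels modulo I. -/
theorem exactMod_of_contract [Fintype ι] {w c : ι → R} {u : R} {I : Ideal R}
    (huc : ∑ i, c i * w i = u) (hu : ∀ r, u * r ∈ I → r ∈ I) {p : ℕ}
    (h : ∀ P : SimplexCochain ι R p, koszulD w p P ∈ valuedIn (I ⊔ Ideal.span {u}) (p + 1) →
      ∃ Q, koszulD w p Q = 0 ∧ P - Q ∈ valuedIn (I ⊔ Ideal.span {u}) p) :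
    ExactMod w I p := by
  intro P hP
  have hG : u • P - koszulD w p (contract c p P) ∈ valuedIn I (p + 1) := by
    rw [← huc, ← contract_koszulD_succ]
    exact contract_mem_valuedIn c hP
  obtain ⟨Q, hQ, hQ'⟩ := h (contract c p P) (by
    have h1 := valuedIn_mono (le_sup_left : I ≤ I ⊔ Ideal.span {u}) _ hG
    have h2 : u • P ∈ valuedIn (I ⊔ Ideal.span {u}) (p + 1) :=
      smul_mem_valuedIn (Ideal.mem_sup_right (Ideal.mem_span_singleton_self u)) P
    simpa using Submodule.sub_mem _ h2 h1)
  obtain ⟨G, hG'⟩ := exists_of_mem_valuedIn_sup hQ'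
  refine ⟨G, mem_valuedIn_of_smul_mem hu ?_⟩
  have h3 := Submodule.add_mem _ hG (koszulD_mem_valuedIn w hG')
  have h4 : u • (P - koszulD w p G) = u • P - koszulD w p (contract c p P) +
      koszulD w p (contract c p P - Q - u • G) := by
    rw [map_sub, map_sub, hQ, map_smul, smul_sub]
    abel
  rw [h4]
  exact h3

/-- The Koszul complex of `w` is exact in low degrees if the ideal generated by `w` contains
a regular sequence. -/
theorem exactMod_of_regular [Fintype ι] {w : ι → R} {u : ℕ → R} {J : ℕ → Ideal R} {n : ℕ}
    (hJ : ∀ k, J (k + 1) = J k ⊔ Ideal.span {u k})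
    (hw : ∀ k < n, ∃ c : ι → R, ∑ i, c i * w i = u k)
    (hu : ∀ k < n, ∀ r, u k * r ∈ J k → r ∈ J k) (p k : ℕ) (hpk : k + p + 1 < n) :
    ExactMod w (J k) p := by
  induction p generalizing k with
  | zero =>
    obtain ⟨c, hc⟩ := hw k (by omega)
    -- In lowest degree the contraction is a 0-cochain; it must vanish modulo the next ideal, and
    -- this uses up the second regular element `u (k + 1)`.
    refine exactMod_of_contract hc (hu k (by omega)) fun P hP => ⟨0, map_zero _, ?_⟩
    rw [← hJ] at hP ⊢
    obtain ⟨c', hc'⟩ := hw (k + 1) (by omega)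
    rw [sub_zero]
    exact mem_valuedIn_of_koszulD_zero hc' (hu (k + 1) (by omega)) hP
  | succ p ih =>
    obtain ⟨c, hc⟩ := hw k (by omega)
    refine exactMod_of_contract hc (hu k (by omega)) fun P hP => ?_
    rw [← hJ] at hP ⊢
    obtain ⟨Q, hQ⟩ := ih (k + 1) (by omega) P hP
    exact ⟨koszulD w p Q, koszulD_koszulD w p Q, hQ⟩

theorem valuedIn_bot : ∀ {p : ℕ} {P : SimplexCochain ι R p}, P ∈ valuedIn ⊥ p → P = 0
  | 0, _, h => (Submodule.mem_bot R).1 h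
  | _ + 1, _, h => ext_face fun i => by
      rw [valuedIn_bot (mem_valuedIn_succ.1 h i), map_zero]

end SimplexCochain

/-! ### Koszul exactness when the covector vanishes only at the origin -/

namespace MvPolynomial

/-- Membership in a monomial ideal can be tested on the support, and multiplying by a power of one
variable does not change the exponents of the others. -/
theorem mem_span_X_pow_of_X_pow_mul_mem {n : ℕ} {N k : ℕ} (hk : k < n)
    (r : MvPolynomial (Fin n) ℂ)
    (h : X ⟨k, hk⟩ ^ N * r ∈
      Ideal.span {p : MvPolynomial (Fin n) ℂ | ∃ j : Fin n, (j : ℕ) < k ∧ p = X j ^ N}) :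
    r ∈ Ideal.span {p : MvPolynomial (Fin n) ℂ | ∃ j : Fin n, (j : ℕ) < k ∧ p = X j ^ N} := by
  have hset : {p : MvPolynomial (Fin n) ℂ | ∃ j : Fin n, (j : ℕ) < k ∧ p = X j ^ N} =
      (fun s => monomial s (1 : ℂ)) ''
        {s | ∃ j : Fin n, (j : ℕ) < k ∧ s = Finsupp.single j N} := by
    ext p
    constructor
    · rintro ⟨j, hj, rfl⟩
      exact ⟨_, ⟨j, hj, rfl⟩, (X_pow_eq_monomial).symm⟩
    · rintro ⟨_, ⟨j, hj, rfl⟩, rfl⟩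
      exact ⟨j, hj, (X_pow_eq_monomial).symm⟩
  rw [hset, mem_ideal_span_monomial_image] at h ⊢
  intro m hm
  obtain ⟨_, ⟨j, hj, rfl⟩, hle⟩ := h (Finsupp.single ⟨k, hk⟩ N + m) (by
    rw [mem_support_iff, X_pow_eq_monomial, coeff_monomial_mul, one_mul]
    exact mem_support_iff.1 hm)
  refine ⟨_, ⟨j, hj, rfl⟩, ?_⟩
  rw [Finsupp.single_le_iff] at hle ⊢
  have hne : (⟨k, hk⟩ : Fin n) ≠ j := fun h => by subst h; simp at hj
  simpa [Finsupp.single_apply, hne] using hle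

/-- The ideal of `w` contains a common power of all the variables, and these powers form a regular
sequence of length `n`. -/
theorem exactMod_of_X_pow_mem {n : ℕ} {w : Fin n → MvPolynomial (Fin n) ℂ}
    (hw : ∀ i, X i ∈ (Ideal.span (Set.range w)).radical) {p : ℕ} (hp : p + 1 < n) :
    SimplexCochain.ExactMod w ⊥ p := by
  choose N hN using hw
  have hN' : ∀ i, X i ^ (∑ j, N j) ∈ Ideal.span (Set.range w) := fun i =>
    Ideal.mem_of_dvd _ (pow_dvd_pow _ (Finset.single_le_sum (fun _ _ => Nat.zero_le _)
      (Finset.mem_univ i))) (hN i)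
  set M := ∑ j, N j
  let J : ℕ → Ideal (MvPolynomial (Fin n) ℂ) := fun k =>
    Ideal.span {p : MvPolynomial (Fin n) ℂ | ∃ j : Fin n, (j : ℕ) < k ∧ p = X j ^ M}
  -- The value 0 past the last variable keeps the recursion for `J` valid for every index, where `J`
  -- has become stationary.
  let u : ℕ → MvPolynomial (Fin n) ℂ := fun k => if h : k < n then X ⟨k, h⟩ ^ M else 0
  have hJ0 : J 0 = ⊥ := by
    have : {p : MvPolynomial (Fin n) ℂ | ∃ j : Fin n, (j : ℕ) < 0 ∧ p = X j ^ M} = ∅ := by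
      ext; simp
    simp only [J, this, Ideal.span_empty]
  rw [← hJ0]
  refine SimplexCochain.exactMod_of_regular (u := u) (J := J) (n := n) ?_ ?_ ?_ p 0 (by omega)
  · intro k
    by_cases hk : k < n
    · simp only [J, u, dif_pos hk, ← Ideal.span_union]
      congr 1
      ext p
      constructor
      · rintro ⟨j, hj, rfl⟩
        rcases Nat.lt_succ_iff_lt_or_eq.1 hj with h | h
        · exact Or.inl ⟨j, h, rfl⟩
        · right
          subst h
          rfl
      · rintro (⟨j, hj, rfl⟩ | rfl)
        · exact ⟨j, Nat.lt_succ_of_lt hj, rfl⟩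
        · exact ⟨⟨k, hk⟩, Nat.lt_succ_self k, rfl⟩
    · simp only [J, u, dif_neg hk]
      rw [Ideal.span_singleton_eq_bot.2 rfl, sup_bot_eq]
      congr 1
      ext p
      exact exists_congr fun j => by
        have := j.2
        simp only [show (j : ℕ) < k + 1 by omega, show (j : ℕ) < k by omega]
  · intro k hk
    simp only [u, dif_pos hk]
    exact (Ideal.mem_span_range_iff_exists_fun).1 (hN' ⟨k, hk⟩)
  · intro k hk r hr
    simp only [u, dif_pos hk] at hr
    exact mem_span_X_pow_of_X_pow_mul_mem hk r hr

/-! ### Division by a covector in the first degrees -/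

section Exactness

variable {n : ℕ} {w : Fin n → MvPolynomial (Fin n) ℂ}
  (hw : ∀ i, X i ∈ (Ideal.span (Set.range w)).radical)

include hw

theorem exists_eq_smul_of_wedge_eq_zero (hn : 1 < n) {g : Fin n → MvPolynomial (Fin n) ℂ}
    (hg : ∀ i j, w i * g j - w j * g i = 0) : ∃ h, ∀ i, g i = w i * h := by
  obtain ⟨h, hh⟩ := exactMod_of_X_pow_mem hw (p := 0) hn g (by
    refine SimplexCochain.mem_valuedIn_succ.2 fun i => SimplexCochain.mem_valuedIn_succ.2 fun j => ?_
    exact hg i j)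
  refine ⟨h, fun i => ?_⟩
  exact sub_eq_zero.1 (congrFun (SimplexCochain.valuedIn_bot hh) i)

theorem exists_eq_wedge_of_wedge_eq_zero (hn : 2 < n)
    {P : Fin n → Fin n → MvPolynomial (Fin n) ℂ}
    (hP : ∀ i j k, w i * P j k - (w j * P i k - w k * P i j) = 0) :
    ∃ a : Fin n → MvPolynomial (Fin n) ℂ, ∀ i j, P i j = w i * a j - w j * a i := by
  obtain ⟨a, ha⟩ := exactMod_of_X_pow_mem hw (p := 1) hn P (by
    iterate 3 refine SimplexCochain.mem_valuedIn_succ.2 fun _ => ?_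
    exact hP _ _ _)
  refine ⟨a, fun i j => ?_⟩
  exact sub_eq_zero.1 (congrFun (congrFun (SimplexCochain.valuedIn_bot ha) i) j)

theorem exists_eq_wedge_of_wedge_eq_zero₃ (hn : 3 < n)
    {P : Fin n → Fin n → Fin n → MvPolynomial (Fin n) ℂ}
    (hP : ∀ i j k l, w i * P j k l - (w j * P i k l - (w k * P i j l - w l * P i j k)) = 0) :
    ∃ a : Fin n → Fin n → MvPolynomial (Fin n) ℂ,
      ∀ i j k, P i j k = w i * a j k - (w j * a i k - w k * a i j) := by
  obtain ⟨a, ha⟩ := exactMod_of_X_pow_mem hw (p := 2) hn P (by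
    iterate 4 refine SimplexCochain.mem_valuedIn_succ.2 fun _ => ?_
    exact hP _ _ _ _)
  refine ⟨a, fun i j k => ?_⟩
  exact sub_eq_zero.1
    (congrFun (congrFun (congrFun (SimplexCochain.valuedIn_bot ha) i) j) k)

theorem exists_eq_wedge_of_wedge_eq_zero₄ (hn : 4 < n)
    {P : Fin n → Fin n → Fin n → Fin n → MvPolynomial (Fin n) ℂ}
    (hP : ∀ i j k l m, w i * P j k l m -
      (w j * P i k l m - (w k * P i j l m - (w l * P i j k m - w m * P i j k l))) = 0) :
    ∃ a : Fin n → Fin n → Fin n → MvPolynomial (Fin n) ℂ,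
      ∀ i j k l, P i j k l =
        w i * a j k l - (w j * a i k l - (w k * a i j l - w l * a i j k)) := by
  obtain ⟨a, ha⟩ := exactMod_of_X_pow_mem hw (p := 3) hn P (by
    iterate 5 refine SimplexCochain.mem_valuedIn_succ.2 fun _ => ?_
    exact hP _ _ _ _ _)
  refine ⟨a, fun i j k l => ?_⟩
  exact sub_eq_zero.1
    (congrFun (congrFun (congrFun (congrFun (SimplexCochain.valuedIn_bot ha) i) j) k) l)

end Exactness

end MvPolynomial

/-- Euler's relation for the equation of a smooth hypersurface: the partial derivatives have
no common zero. -/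
theorem X_mem_radical_span_pderiv {n d : ℕ} (hd : d ≠ 0) {f : MvPolynomial (Fin (n + 1)) ℂ}
    (hf : f.IsHomogeneous d) (hs : IsSmoothEquation f) (i : Fin (n + 1)) :
    MvPolynomial.X i ∈
      (Ideal.span (Set.range fun i => MvPolynomial.pderiv i f)).radical := by
  rw [← MvPolynomial.vanishingIdeal_zeroLocus_eq_radical (K := ℂ)]
  intro x hx
  have hx' : ∀ i, MvPolynomial.eval x (MvPolynomial.pderiv i f) = 0 := fun i => by
    have := hx (MvPolynomial.pderiv i f) (Ideal.subset_span ⟨i, rfl⟩)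
    simpa [MvPolynomial.aeval_eq_eval] using this
  -- By Euler's relation a common zero of the partial derivatives lies on the hypersurface, so
  -- smoothness leaves only the origin.
  have hx0 : x = 0 := by
    by_contra h0
    obtain ⟨j, hj⟩ := hs x h0 (by
      have := congrArg (MvPolynomial.eval x) hf.sum_X_mul_pderiv
      simp only [map_sum, map_mul, hx', mul_zero, Finset.sum_const_zero, map_nsmul] at this
      simpa [hd] using this.symm)
    exact hj (hx' j)
  simp [hx0]

/-! ### Polynomial growth and extension across the origin -/

/-- An entire function of polynomial growth is a polynomial. -/
theorem exists_polynomial_of_growth (N : ℕ) {g : ℂ → ℂ} (hg : Differentiable ℂ g) {C : ℝ}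
    (hC : ∀ t, ‖g t‖ ≤ C * (1 + ‖t‖) ^ N) :
    ∃ p : Polynomial ℂ, p.degree < (N + 1 : ℕ) ∧ ∀ t, g t = p.eval t := by
  induction N generalizing g C with
  | zero =>
    refine ⟨Polynomial.C (g 0), Polynomial.degree_C_le.trans_lt (by simp), fun t => ?_⟩
    rw [Polynomial.eval_C]
    refine hg.apply_eq_apply_of_bounded ?_ t 0
    rw [isBounded_iff_forall_norm_le]
    exact ⟨C, by rintro _ ⟨t, rfl⟩; simpa using hC t⟩
  | succ N ih =>
    have hq : Differentiable ℂ (dslope g 0) := by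
      rw [← differentiableOn_univ] at hg ⊢
      exact (Complex.differentiableOn_dslope Filter.univ_mem).2 hg
    obtain ⟨B, hB⟩ := (isCompact_closedBall (0 : ℂ) 1).exists_bound_of_continuousOn
      hq.continuous.continuousOn
    have hC0 : 0 ≤ C := by simpa using (norm_nonneg _).trans (hC 0)
    have hB0 : 0 ≤ B := (norm_nonneg _).trans (hB 0 (by simp))
    -- The divided difference at 0 grows one degree more slowly. The term B covers the unit disc,
    -- where dividing by t gives no control; the factor 2 comes from 1 + ‖t‖ ≤ 2‖t‖ outside it.
    obtain ⟨p, hp, hgp⟩ := ih hq (C := 2 * (C + ‖g 0‖) + B) (fun t => by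
      have h1 : (1 : ℝ) ≤ (1 + ‖t‖) ^ N := one_le_pow₀ (by linarith [norm_nonneg t])
      rcases le_or_gt ‖t‖ 1 with ht | ht
      · have h2 := hB t (by simpa using ht)
        nlinarith [norm_nonneg (g 0)]
      · have ht0 : t ≠ 0 := by rintro rfl; simp at ht; linarith
        rw [dslope_of_ne _ ht0, slope_def_field, norm_div, sub_zero, div_le_iff₀ (by linarith)]
        have h3 : ‖g t - g 0‖ ≤ (C + ‖g 0‖) * (1 + ‖t‖) ^ (N + 1) := by
          have h4 : (1 : ℝ) ≤ (1 + ‖t‖) ^ (N + 1) := one_le_pow₀ (by linarith [norm_nonneg t])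
          have h5 := norm_sub_le (g t) (g 0)
          have h6 := hC t
          nlinarith [norm_nonneg (g 0)]
        refine h3.trans ?_
        rw [pow_succ]
        have h5 : 0 ≤ (C + ‖g 0‖) * (1 + ‖t‖) ^ N := by positivity
        have h6 : 0 ≤ B * (1 + ‖t‖) ^ N * ‖t‖ := by positivity
        nlinarith)
    refine ⟨Polynomial.C (g 0) + p * Polynomial.X, ?_, fun t => ?_⟩
    · refine (Polynomial.degree_add_le _ _).trans_lt (max_lt ?_ ?_)
      · exact Polynomial.degree_C_le.trans_lt (by exact_mod_cast Nat.succ_pos _)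
      · by_cases h0 : p = 0
        · simp [h0]
        rw [Polynomial.degree_mul, Polynomial.degree_X]
        rw [Polynomial.degree_eq_natDegree h0] at hp ⊢
        exact_mod_cast Nat.succ_lt_succ (by exact_mod_cast hp)
    · have := sub_smul_dslope g 0 t
      simp only [sub_zero, smul_eq_mul] at this
      simp only [Polynomial.eval_add, Polynomial.eval_C, Polynomial.eval_mul, Polynomial.eval_X,
        ← hgp t]
      linear_combination -this

/-- The Lagrange basis polynomials at the nodes `1, …, N + 1`. -/
noncomputable def posNodeBasis (N : ℕ) (j : ℕ) : Polynomial ℂ :=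
  Lagrange.basis (Finset.range (N + 1)) (fun j : ℕ => (j + 1 : ℂ)) j

/-- The nodes are positive so that slices at a node miss the origin; this lets the same
interpolation serve functions defined only on the punctured space. -/
theorem eq_sum_posNodeBasis_of_growth {N : ℕ} {g : ℂ → ℂ} (hg : Differentiable ℂ g) {C : ℝ}
    (hC : ∀ t, ‖g t‖ ≤ C * (1 + ‖t‖) ^ N) (t : ℂ) :
    g t = ∑ j ∈ Finset.range (N + 1), g (j + 1) * (posNodeBasis N j).eval t := by
  obtain ⟨p, hp, hgp⟩ := exists_polynomial_of_growth N hg hC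
  have hinj : Set.InjOn (fun j : ℕ => (j + 1 : ℂ)) (Finset.range (N + 1)) := fun a _ b _ h => by
    simpa using h
  have := Lagrange.eq_interpolate (f := p) hinj (by simpa using hp)
  rw [hgp t]
  conv_lhs => rw [this]
  simp [Lagrange.interpolate_apply, Polynomial.eval_finsetSum, posNodeBasis, hgp]

theorem differentiable_finCons_prod {n : ℕ} : Differentiable ℂ
    fun p : ℂ × (Fin n → ℂ) => (Fin.cons p.1 p.2 : Fin (n + 1) → ℂ) := by
  rw [differentiable_pi]
  intro i
  refine Fin.cases ?_ (fun j => ?_) i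
  · simp only [Fin.cons_zero]
    fun_prop
  · simp only [Fin.cons_succ]
    fun_prop

theorem norm_finCons_le {n : ℕ} (t : ℂ) (y : Fin n → ℂ) :
    ‖(Fin.cons t y : Fin (n + 1) → ℂ)‖ ≤ ‖t‖ + ‖y‖ := by
  rw [pi_norm_le_iff_of_nonneg (by positivity)]
  refine Fin.cases ?_ fun j => ?_
  · simp
  · simpa using (norm_le_pi_norm y j).trans (by linarith [norm_nonneg t])

theorem le_norm_finCons {n : ℕ} (t : ℂ) (y : Fin n → ℂ) :
    ‖t‖ ≤ ‖(Fin.cons t y : Fin (n + 1) → ℂ)‖ := by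
  simpa using norm_le_pi_norm (Fin.cons t y : Fin (n + 1) → ℂ) 0

theorem finCons_ne_zero_of_left {n : ℕ} {t : ℂ} (ht : t ≠ 0) (y : Fin n → ℂ) :
    (Fin.cons t y : Fin (n + 1) → ℂ) ≠ 0 := fun h => ht (by simpa using congrFun h 0)

theorem finCons_ne_zero_of_right {n : ℕ} (t : ℂ) {y : Fin n → ℂ} (hy : y ≠ 0) :
    (Fin.cons t y : Fin (n + 1) → ℂ) ≠ 0 :=
  fun h => hy (funext fun j => by simpa using congrFun h j.succ)

theorem exists_eval_eq_sum_posNodeBasis {n N : ℕ} {g : (Fin (n + 1) → ℂ) → ℂ}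
    (h : ∀ j : ℕ, ∃ P : MvPolynomial (Fin n) ℂ,
      ∀ y, g (Fin.cons (j + 1 : ℂ) y) = MvPolynomial.eval y P) :
    ∃ P : MvPolynomial (Fin (n + 1)) ℂ, ∀ t y,
      MvPolynomial.eval (Fin.cons t y) P =
        ∑ j ∈ Finset.range (N + 1), g (Fin.cons (j + 1 : ℂ) y) * (posNodeBasis N j).eval t := by
  choose P hP using h
  refine ⟨∑ j ∈ Finset.range (N + 1), MvPolynomial.rename Fin.succ (P j) *
    Polynomial.aeval (MvPolynomial.X 0) (posNodeBasis N j), fun t y => ?_⟩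
  rw [map_sum]
  refine Finset.sum_congr rfl fun j _ => ?_
  rw [map_mul, hP, MvPolynomial.eval_rename]
  congr 1
  have := Polynomial.hom_eval₂ (posNodeBasis N j) (algebraMap ℂ (MvPolynomial (Fin (n + 1)) ℂ))
    (MvPolynomial.eval (Fin.cons t y)) (MvPolynomial.X 0)
  rw [Polynomial.aeval_def, this, MvPolynomial.eval_X, Fin.cons_zero, Polynomial.eval,
    MvPolynomial.algebraMap_eq]
  congr 1
  ext z
  simp

/-- An entire function of several variables of polynomial growth is a polynomial. -/
theorem exists_mvPolynomial_of_growth {n : ℕ} (N : ℕ) {g : (Fin n → ℂ) → ℂ}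
    (hg : Differentiable ℂ g) {C : ℝ} (hC : ∀ x, ‖g x‖ ≤ C * (1 + ‖x‖) ^ N) :
    ∃ P : MvPolynomial (Fin n) ℂ, ∀ x, g x = MvPolynomial.eval x P := by
  induction n generalizing C with
  | zero =>
    exact ⟨MvPolynomial.C (g 0), fun x => by
      rw [MvPolynomial.eval_C, Subsingleton.elim x 0]⟩
  | succ n ih =>
    have hC0 : 0 ≤ C := by simpa using (norm_nonneg _).trans (hC 0)
    have hcons : ∀ (t : ℂ) (y : Fin n → ℂ),
        1 + ‖(Fin.cons t y : Fin (n + 1) → ℂ)‖ ≤ (1 + ‖t‖) * (1 + ‖y‖) := fun t y => by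
      nlinarith [norm_finCons_le t y, norm_nonneg t, norm_nonneg y]
    have hbound : ∀ (t : ℂ) (y : Fin n → ℂ),
        ‖g (Fin.cons t y)‖ ≤ C * ((1 + ‖t‖) ^ N * (1 + ‖y‖) ^ N) := fun t y => by
      refine (hC _).trans (mul_le_mul_of_nonneg_left ?_ hC0)
      rw [← mul_pow]
      exact pow_le_pow_left₀ (by positivity) (hcons t y) N
    obtain ⟨P, hP⟩ := exists_eval_eq_sum_posNodeBasis (N := N) (g := g) fun j =>
      ih (g := fun y => g (Fin.cons (j + 1 : ℂ) y)) (C := C * (1 + ‖(j + 1 : ℂ)‖) ^ N)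
        (hg.comp (differentiable_finCons_prod.comp
          ((differentiable_const _).prodMk differentiable_id)))
        (fun y => (hbound _ _).trans_eq (by ring))
    refine ⟨P, fun x => ?_⟩
    rw [← Fin.cons_self_tail x, hP]
    exact eq_sum_posNodeBasis_of_growth (g := fun t => g (Fin.cons t (Fin.tail x)))
      (C := C * (1 + ‖Fin.tail x‖) ^ N)
      (hg.comp (differentiable_finCons_prod.comp (differentiable_id.prodMk (differentiable_const _))))
      (fun t => (hbound _ _).trans_eq (by ring)) (x 0)

/-- A holomorphic function of polynomial growth on the complement of the origin in at least two
variables is a polynomial. -/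
theorem exists_mvPolynomial_of_growth_punctured {n : ℕ} (N : ℕ) {g : (Fin (n + 2) → ℂ) → ℂ}
    (hg : ∀ x, x ≠ 0 → DifferentiableAt ℂ g x) {C : ℝ}
    (hC : ∀ x, 1 ≤ ‖x‖ → ‖g x‖ ≤ C * ‖x‖ ^ N) :
    ∃ P : MvPolynomial (Fin (n + 2)) ℂ, ∀ x, x ≠ 0 → g x = MvPolynomial.eval x P := by
  have hC0 : 0 ≤ C := by
    have := (norm_nonneg _).trans (hC 1 (by simp))
    simpa using this
  have hcons : ∀ (t : ℂ) (y : Fin (n + 1) → ℂ),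
      ‖(Fin.cons t y : Fin (n + 2) → ℂ)‖ ≤ (1 + ‖t‖) * (1 + ‖y‖) := fun t y => by
    nlinarith [norm_finCons_le t y, norm_nonneg t, norm_nonneg y]
  have hbound : ∀ (t : ℂ) (y : Fin (n + 1) → ℂ), 1 ≤ ‖t‖ →
      ‖g (Fin.cons t y)‖ ≤ C * ((1 + ‖t‖) ^ N * (1 + ‖y‖) ^ N) := fun t y ht => by
    refine (hC _ (ht.trans (le_norm_finCons t y))).trans (mul_le_mul_of_nonneg_left ?_ hC0)
    rw [← mul_pow]
    exact pow_le_pow_left₀ (by positivity) (hcons t y) N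
  have hdt : ∀ t : ℂ, t ≠ 0 → Differentiable ℂ fun y : Fin (n + 1) → ℂ => g (Fin.cons t y) :=
    fun t ht y => (hg _ (finCons_ne_zero_of_left ht y)).comp y
      ((differentiable_finCons_prod.comp ((differentiable_const t).prodMk differentiable_id)) y)
  have hdy : ∀ y : Fin (n + 1) → ℂ, y ≠ 0 → Differentiable ℂ fun t : ℂ => g (Fin.cons t y) :=
    fun y hy t => (hg _ (finCons_ne_zero_of_right t hy)).comp t
      ((differentiable_finCons_prod.comp (differentiable_id.prodMk (differentiable_const y))) t)
  have hj : ∀ j : ℕ, (j + 1 : ℂ) ≠ 0 := fun j => by exact_mod_cast Nat.succ_ne_zero j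
  have hj' : ∀ j : ℕ, 1 ≤ ‖(j + 1 : ℂ)‖ := fun j => by
    have : ‖((j + 1 : ℕ) : ℂ)‖ = ((j + 1 : ℕ) : ℝ) := Complex.norm_natCast _
    push_cast at this
    rw [this]
    linarith [(Nat.cast_nonneg j : (0 : ℝ) ≤ j)]
  obtain ⟨P, hP⟩ := exists_eval_eq_sum_posNodeBasis (N := N) (g := g) fun j =>
    exists_mvPolynomial_of_growth N (hdt _ (hj j)) (C := C * (1 + ‖(j + 1 : ℂ)‖) ^ N)
      (fun y => (hbound _ _ (hj' j)).trans_eq (by ring))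
  have key : ∀ (t : ℂ) (y : Fin (n + 1) → ℂ), y ≠ 0 →
      g (Fin.cons t y) = MvPolynomial.eval (Fin.cons t y) P := fun t y hy => by
    obtain ⟨B, hB⟩ := (isCompact_closedBall (0 : ℂ) 1).exists_bound_of_continuousOn
      (hdy y hy).continuous.continuousOn
    have hB0 : 0 ≤ B := (norm_nonneg _).trans (hB 0 (by simp))
    rw [hP]
    -- The constant may depend on `y`: growth in `t` only justifies the interpolation formula, whose
    -- nodes and degree bound are the same for all `y`.
    refine eq_sum_posNodeBasis_of_growth (hdy y hy) (C := C * (1 + ‖y‖) ^ N + B) (fun t => ?_) t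
    have h1 : (1 : ℝ) ≤ (1 + ‖t‖) ^ N := one_le_pow₀ (by linarith [norm_nonneg t])
    have h2 : 0 ≤ C * (1 + ‖y‖) ^ N := by positivity
    rcases le_or_gt ‖t‖ 1 with ht | ht
    · have h2 := hB t (by simpa using ht)
      nlinarith
    · have h3 := hbound t y ht.le
      nlinarith
  refine ⟨P, fun x hx => ?_⟩
  rw [← Fin.cons_self_tail x]
  by_cases hy : Fin.tail x = 0
  · have ht : x 0 ≠ 0 := fun h => hx (by
      rw [← Fin.cons_self_tail x, hy, h]
      exact funext fun i => by refine Fin.cases ?_ (fun j => ?_) i <;> simp)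
    -- On the axis `y = 0` the identity follows by continuity, since the remaining `y` are dense in
    -- the slice.
    have hclosed : IsClosed {y : Fin (n + 1) → ℂ |
        g (Fin.cons (x 0) y) = MvPolynomial.eval (Fin.cons (x 0) y) P} :=
      isClosed_eq (hdt _ ht).continuous ((MvPolynomial.continuous_eval P).comp
        (differentiable_finCons_prod.comp ((differentiable_const (x 0)).prodMk
          differentiable_id)).continuous)
    have hdense : Dense ({0}ᶜ : Set (Fin (n + 1) → ℂ)) := dense_compl_singleton 0
    exact closure_minimal (s := {0}ᶜ) (fun y hy => key (x 0) y hy) hclosed (hdense _)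
  · exact key _ _ hy

/-- A homogeneous holomorphic function on the complement of the origin in at least two variables
is a polynomial. -/
theorem exists_mvPolynomial_of_homogeneous {n : ℕ} (e : ℕ) {g : (Fin (n + 2) → ℂ) → ℂ}
    (hg : ∀ x, x ≠ 0 → DifferentiableAt ℂ g x)
    (hhom : ∀ c : ℂ, c ≠ 0 → ∀ x, x ≠ 0 → g (c • x) = c ^ e * g x) :
    ∃ P : MvPolynomial (Fin (n + 2)) ℂ, ∀ x, x ≠ 0 → g x = MvPolynomial.eval x P := by
  obtain ⟨C, hC⟩ := (isCompact_sphere (0 : Fin (n + 2) → ℂ) 1).exists_bound_of_continuousOn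
    (f := g) fun x hx => (hg x (fun h => by simp [h] at hx)).continuousAt.continuousWithinAt
  refine exists_mvPolynomial_of_growth_punctured e hg (C := C) fun x hx => ?_
  have hx0 : (‖x‖ : ℂ) ≠ 0 := by
    exact_mod_cast (by linarith : ‖x‖ ≠ 0)
  have hx1 : x = (‖x‖ : ℂ) • ((‖x‖ : ℂ)⁻¹ • x) := by rw [smul_smul, mul_inv_cancel₀ hx0, one_smul]
  have hn : ‖((‖x‖ : ℂ)⁻¹ • x)‖ = 1 := by
    rw [norm_smul, norm_inv, Complex.norm_real, norm_norm, inv_mul_cancel₀ (by linarith)]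
  have h1 := hC ((‖x‖ : ℂ)⁻¹ • x) (by simpa using hn)
  conv_lhs => rw [hx1]
  rw [hhom _ hx0 _ (fun h => by simp [h] at hn), norm_mul, norm_pow, Complex.norm_real, norm_norm,
    mul_comm]
  gcongr

/-! ### Separable polynomials and generic specialization -/

namespace Polynomial

theorem eq_nodal_roots_of_separable {p : ℂ[X]} (hp : p.Monic) (hs : p.Separable) :
    p = Lagrange.nodal p.roots.toFinset id := by
  have h1 := prod_multiset_X_sub_C_of_monic_of_roots_card_eq hp
    (splits_iff_card_roots.1 (IsAlgClosed.splits p))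
  rw [Lagrange.nodal_eq, Finset.prod_eq_multiset_prod, Multiset.toFinset_val,
    (nodup_roots hs).dedup]
  exact h1.symm

/-- Partial fractions, read off from the barycentric form of the interpolation of the constant 1:
the nodal weights are the inverse derivatives at the roots. -/
theorem inv_eval_eq_sum_of_separable {p : ℂ[X]} (hp : p.Monic) (hs : p.Separable)
    (hd : p.roots.toFinset.Nonempty) {z : ℂ} (hz : p.eval z ≠ 0) :
    (p.eval z)⁻¹ = ∑ t ∈ p.roots.toFinset, (p.derivative.eval t)⁻¹ * (z - t)⁻¹ := by
  have hzt : ∀ t ∈ p.roots.toFinset, z ≠ id t := fun t ht h => hz (by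
    rw [Multiset.mem_toFinset, mem_roots hp.ne_zero] at ht
    rw [h]; exact ht)
  have h1 := Lagrange.eval_interpolate_not_at_node (s := p.roots.toFinset) (v := id)
    (1 : ℂ → ℂ) hzt
  rw [Lagrange.interpolate_one Function.injective_id.injOn hd, eval_one,
    ← eq_nodal_roots_of_separable hp hs] at h1
  refine inv_eq_of_mul_eq_one_right (h1.symm ▸ ?_)
  congr 1
  refine Finset.sum_congr rfl fun t ht => ?_
  rw [Lagrange.nodalWeight_eq_eval_derivative_nodal ht, ← eq_nodal_roots_of_separable hp hs]
  simp

theorem mem_roots_toFinset_of_monic {p : ℂ[X]} (hp : p.Monic) {t : ℂ} :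
    t ∈ p.roots.toFinset ↔ p.eval t = 0 := by
  rw [Multiset.mem_toFinset, mem_roots hp.ne_zero, IsRoot.def]

/-- A squarefree monic polynomial over an integrally closed domain of characteristic zero stays
separable under a generic specialization. -/
theorem exists_ne_zero_separable_map {A : Type*} [CommRing A] [IsDomain A] [IsIntegrallyClosed A]
    [CharZero A] {p : A[X]} (hp : p.Monic) (hs : ∀ q : A[X], q.Monic → q * q ∣ p → q.natDegree = 0) :
    ∃ D : A, D ≠ 0 ∧ ∀ {B : Type} [Field B] (φ : A →+* B), φ D ≠ 0 → (p.map φ).Separable := by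
  let K := FractionRing A
  have : CharZero K := charZero_of_injective_algebraMap (IsFractionRing.injective A K)
  have hpK : (p.map (algebraMap A K)).Monic := hp.map _
  have hsq : Squarefree (p.map (algebraMap A K)) := by
    intro g hg
    by_contra hu
    have hg0 : g ≠ 0 := fun h => hpK.ne_zero (by simpa [h] using hg)
    -- Gauss's lemma: over an integrally closed domain a factor of a monic polynomial over the
    -- fraction field is, up to a scalar, defined over the domain.
    obtain ⟨q, hq⟩ := IsIntegrallyClosed.eq_map_mul_C_of_dvd K hp
      ((dvd_mul_right g g).trans hg)
    have hl : g.leadingCoeff ≠ 0 := leadingCoeff_ne_zero.2 hg0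
    have hinj := IsFractionRing.injective A K
    have h1 : q.map (algebraMap A K) = g * C g.leadingCoeff⁻¹ := by
      conv_rhs => rw [← hq, mul_assoc]
      rw [hq, ← C_mul, mul_inv_cancel₀ hl, C_1, mul_one]
    have hqm : q.Monic := by
      rw [hinj.monic_map_iff, h1]
      exact monic_mul_leadingCoeff_inv hg0
    have hqq : q * q ∣ p := by
      rw [← map_dvd_map _ hinj (hqm.mul hqm), Polynomial.map_mul]
      refine (mul_dvd_mul ?_ ?_).trans hg <;> exact ⟨_, hq.symm⟩
    have h0 := hs q hqm hqq
    apply hu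
    rw [← hq, hqm.natDegree_eq_zero.1 h0]
    simpa using hl
  obtain ⟨a, b, hab⟩ := PerfectField.separable_iff_squarefree.2 hsq
  obtain ⟨d, hd, ha⟩ := IsLocalization.integerNormalization_spec (nonZeroDivisors A) a
  obtain ⟨e, he, hb⟩ := IsLocalization.integerNormalization_spec (nonZeroDivisors A) b
  set a' := IsLocalization.integerNormalization (nonZeroDivisors A) a
  set b' := IsLocalization.integerNormalization (nonZeroDivisors A) b
  refine ⟨d * e, mul_ne_zero (nonZeroDivisors.ne_zero hd) (nonZeroDivisors.ne_zero he), ?_⟩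
  intro B _ φ hφ
  -- The Bézout identity for p and p′ with denominators cleared; it survives any specialization that
  -- does not kill `d * e`.
  have key : C e * a' * p + C d * b' * derivative p = C (d * e) := by
    apply map_injective _ (IsFractionRing.injective A K)
    rw [derivative_map] at hab
    simp only [Polynomial.map_add, Polynomial.map_mul, map_C, ha, hb, Algebra.smul_def d a, Algebra.smul_def e b]
    simp only [map_mul]
    linear_combination C ((algebraMap A K) d) * C ((algebraMap A K) e) * hab
  have key2 := congrArg (Polynomial.map φ) key
  simp only [Polynomial.map_add, Polynomial.map_mul, map_C] at key2
  refine ⟨C (φ (d * e))⁻¹ * (C (φ e) * a'.map φ), C (φ (d * e))⁻¹ * (C (φ d) * b'.map φ), ?_⟩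
  rw [derivative_map]
  have h3 : (C (φ (d * e))⁻¹ : B[X]) * C (φ (d * e)) = 1 := by
    rw [← C_mul, inv_mul_cancel₀ hφ, C_1]
  linear_combination C (φ (d * e))⁻¹ * key2 + h3

end Polynomial

/-! ### Holomorphic dependence on parameters and continuity of roots -/

/-- A circle integral depends holomorphically on parameters. -/
theorem differentiableAt_circleIntegral {E : Type*} [NormedAddCommGroup E] [NormedSpace ℂ E]
    {G : E × ℂ → ℂ} {y₀ : E} {c : ℂ} {r : ℝ} (hr : 0 ≤ r)
    (hG : ∀ t ∈ Metric.sphere c r, AnalyticAt ℂ G (y₀, t)) :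
    DifferentiableAt ℂ (fun y => ∮ t in C(c, r), G (y, t)) y₀ := by
  have hcd : ∀ {y : E}, (∀ t ∈ Metric.sphere c r, AnalyticAt ℂ G (y, t)) →
      Continuous fun θ : ℝ => G (y, circleMap c r θ) := fun {y} h =>
    continuous_iff_continuousAt.2 fun θ =>
      ContinuousAt.comp (f := fun θ : ℝ => (y, circleMap c r θ))
        (h _ (circleMap_mem_sphere c hr θ)).continuousAt
        (continuousAt_const.prodMk (continuous_circleMap c r).continuousAt)
  have hfd : ∀ {y : E}, (∀ t ∈ Metric.sphere c r, AnalyticAt ℂ G (y, t)) →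
      Continuous fun θ : ℝ => fderiv ℂ G (y, circleMap c r θ) := fun {y} h =>
    continuous_iff_continuousAt.2 fun θ =>
      ContinuousAt.comp (f := fun θ : ℝ => (y, circleMap c r θ))
        (h _ (circleMap_mem_sphere c hr θ)).fderiv.continuousAt
        (continuousAt_const.prodMk (continuous_circleMap c r).continuousAt)
  obtain ⟨B, hB⟩ : ∃ B, ∀ t ∈ Metric.sphere c r, ‖fderiv ℂ G (y₀, t)‖ ≤ B :=
    (isCompact_sphere c r).exists_bound_of_continuousOn fun t ht =>
      (ContinuousAt.comp (f := fun t : ℂ => (y₀, t)) (hG t ht).fderiv.continuousAt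
        (continuousAt_const.prodMk continuousAt_id)).continuousWithinAt
  -- Compactness of the circle gives one neighbourhood of `y₀` that works for all its points; the
  -- slack of 1 makes the bound on the derivative an open condition.
  have hev : ∀ᶠ y in 𝓝 y₀, ∀ t ∈ Metric.sphere c r,
      AnalyticAt ℂ G (y, t) ∧ ‖fderiv ℂ G (y, t)‖ < B + 1 := by
    refine (isCompact_sphere c r).eventually_forall_of_forall_eventually fun t ht => ?_
    exact (hG t ht).eventually_analyticAt.and
      ((hG t ht).fderiv.continuousAt.norm.eventually_lt_const
        ((hB t ht).trans_lt (lt_add_one B)))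
  have hdm : ∀ θ : ℝ, ‖deriv (circleMap c r) θ‖ = r := fun θ => by
    simp [deriv_circleMap, abs_of_nonneg hr]
  have hdc : Continuous (deriv (circleMap c r)) := by
    simp only [funext (deriv_circleMap c r)]
    exact ((continuous_circleMap 0 r).mul continuous_const)
  have h := intervalIntegral.hasFDerivAt_integral_of_dominated_of_fderiv_le
    (μ := MeasureTheory.volume) (a := 0) (b := 2 * Real.pi) (𝕜 := ℂ) (x₀ := y₀) (s := {y | ∀ t ∈ Metric.sphere c r,
      AnalyticAt ℂ G (y, t) ∧ ‖fderiv ℂ G (y, t)‖ < B + 1})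
    (F := fun y θ => deriv (circleMap c r) θ • G (y, circleMap c r θ))
    (F' := fun y θ => deriv (circleMap c r) θ •
      (fderiv ℂ G (y, circleMap c r θ)).comp (ContinuousLinearMap.inl ℂ E ℂ))
    (bound := fun _ => r * ((B + 1) * ‖ContinuousLinearMap.inl ℂ E ℂ‖))
    hev
    (hev.mono fun y hy => (hdc.smul (hcd fun t ht => (hy t ht).1)).aestronglyMeasurable)
    ((hdc.smul (hcd hG)).intervalIntegrable _ _)
    ((hdc.smul ((hfd hG).clm_comp continuous_const)).aestronglyMeasurable)
    (Filter.Eventually.of_forall fun θ _ y hy => by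
      rw [norm_smul, hdm]
      refine mul_le_mul_of_nonneg_left ((ContinuousLinearMap.opNorm_comp_le _ _).trans ?_) hr
      exact mul_le_mul_of_nonneg_right (hy _ (circleMap_mem_sphere c hr θ)).2.le (norm_nonneg _))
    intervalIntegrable_const
    (Filter.Eventually.of_forall fun θ _ y hy => by
      have h1 := (hy _ (circleMap_mem_sphere c hr θ)).1.differentiableAt.hasFDerivAt
      have h2 : HasFDerivAt (fun y : E => (y, circleMap c r θ)) (ContinuousLinearMap.inl ℂ E ℂ) y :=
        hasFDerivAt_prodMk_left y _
      exact (h1.comp y h2).const_smul (deriv (circleMap c r) θ))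
  exact h.differentiableAt

section Roots

variable {n : ℕ} {F : Polynomial (MvPolynomial (Fin n) ℂ)}

theorem continuous_eval_map_eval (F : Polynomial (MvPolynomial (Fin n) ℂ)) :
    Continuous fun p : (Fin n → ℂ) × ℂ => (F.map (MvPolynomial.eval p.1)).eval p.2 := by
  simp only [Polynomial.eval_map, Polynomial.eval₂_eq_sum_range]
  refine continuous_finsetSum _ fun i _ => ?_
  exact ((MvPolynomial.continuous_eval _).comp continuous_fst).mul (continuous_snd.pow i)

/-- Cauchy's bound depends only on the coefficients, and because the polynomial is monic no root
escapes to infinity. -/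
theorem eventually_norm_root_le (hF : F.Monic) (y₀ : Fin n → ℂ) :
    ∃ B : ℝ, ∀ᶠ y in 𝓝 y₀, ∀ t, (F.map (MvPolynomial.eval y)).eval t = 0 → ‖t‖ ≤ B := by
  let b : NNReal := (Finset.range F.natDegree).sup
    fun i => ‖MvPolynomial.eval y₀ (F.coeff i)‖₊ + 1
  refine ⟨b + 1, ?_⟩
  have hev : ∀ᶠ y in 𝓝 y₀, ∀ i ∈ Finset.range F.natDegree,
      ‖MvPolynomial.eval y (F.coeff i)‖₊ < ‖MvPolynomial.eval y₀ (F.coeff i)‖₊ + 1 := by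
    rw [Filter.eventually_all_finset]
    intro i _
    exact (MvPolynomial.continuous_eval _).continuousAt.nnnorm.eventually_lt_const
      (lt_add_one _)
  filter_upwards [hev] with y hy t ht
  have h1 := Polynomial.IsRoot.norm_lt_cauchyBound (hF.map (MvPolynomial.eval y)).ne_zero ht
  have h2 : Polynomial.cauchyBound (F.map (MvPolynomial.eval y)) ≤ b + 1 := by
    rw [Polynomial.cauchyBound, (hF.map _).leadingCoeff, hF.natDegree_map]
    simp only [nnnorm_one, div_one]
    gcongr
    refine Finset.sup_le fun i hi => ?_
    rw [Polynomial.coeff_map]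
    exact (hy i hi).le.trans (Finset.le_sup (f := fun i =>
      ‖MvPolynomial.eval y₀ (F.coeff i)‖₊ + 1) hi)
  exact_mod_cast (h1.le.trans h2)

/-- Roots stay in a fixed disc; on the compact part of it outside the balls the central polynomial
has no zero, hence neither do its neighbours. -/
theorem eventually_exists_root_mem_ball (hF : F.Monic) (y₀ : Fin n → ℂ) {r : ℝ} (hr : 0 < r) :
    ∀ᶠ y in 𝓝 y₀, ∀ t, (F.map (MvPolynomial.eval y)).eval t = 0 →
      ∃ t₀, (F.map (MvPolynomial.eval y₀)).eval t₀ = 0 ∧ t ∈ Metric.ball t₀ r := by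
  obtain ⟨B, hB⟩ := eventually_norm_root_le hF y₀
  have hK : IsCompact (Metric.closedBall (0 : ℂ) B ∩
      (⋃ t₀ ∈ {t₀ | (F.map (MvPolynomial.eval y₀)).eval t₀ = 0}, Metric.ball t₀ r)ᶜ) :=
    (isCompact_closedBall 0 B).inter_right
      (isOpen_biUnion fun _ _ => Metric.isOpen_ball).isClosed_compl
  have hev := hK.eventually_forall_of_forall_eventually (x₀ := y₀)
    (P := fun y t => (F.map (MvPolynomial.eval y)).eval t ≠ 0) fun t ht => by
      refine (continuous_eval_map_eval F).continuousAt.eventually_ne fun h => ht.2 ?_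
      simp only [Set.mem_iUnion]
      exact ⟨t, h, Metric.mem_ball_self hr⟩
  filter_upwards [hB, hev] with y hy hy' t ht
  by_contra hcon
  refine hy' t ⟨by simpa using hy t ht, fun h => hcon ?_⟩ ht
  simpa only [Set.mem_iUnion, exists_prop] using h

theorem eventually_eval_ne_zero_of_mem_sphere {y₀ : Fin n → ℂ} {t₀ : ℂ} {r : ℝ}
    (h : ∀ t ∈ Metric.sphere t₀ r, (F.map (MvPolynomial.eval y₀)).eval t ≠ 0) :
    ∀ᶠ y in 𝓝 y₀, ∀ t ∈ Metric.sphere t₀ r, (F.map (MvPolynomial.eval y)).eval t ≠ 0 :=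
  (isCompact_sphere t₀ r).eventually_forall_of_forall_eventually fun t ht =>
    (continuous_eval_map_eval F).continuousAt.eventually_ne (h t ht)

end Roots

/-! ### Traces over the sheets of a branched covering -/

/-- The trace `∑ ψ(t, y) / F_y'(t)` over the roots `t` of the specialization `F_y` of `F`. -/
noncomputable def rootTrace {n : ℕ} (F : Polynomial (MvPolynomial (Fin n) ℂ))
    (ψ : (Fin (n + 1) → ℂ) → ℂ) (y : Fin n → ℂ) : ℂ :=
  ∑ t ∈ (F.map (MvPolynomial.eval y)).roots.toFinset,
    ψ (Fin.cons t y) * ((F.map (MvPolynomial.eval y)).derivative.eval t)⁻¹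

theorem analyticAt_finCons {n : ℕ} (y : Fin n → ℂ) (t : ℂ) :
    AnalyticAt ℂ (fun p : (Fin n → ℂ) × ℂ => (Fin.cons p.2 p.1 : Fin (n + 1) → ℂ)) (y, t) := by
  rw [analyticAt_pi_iff]
  refine Fin.cases ?_ fun j => ?_
  · simpa using analyticAt_snd
  · simp only [Fin.cons_succ]
    exact (ContinuousLinearMap.proj (R := ℂ) (φ := fun _ : Fin n => ℂ) j).analyticAt _ |>.comp
      analyticAt_fst

theorem analyticAt_mvPolynomial_eval {n : ℕ} (P : MvPolynomial (Fin n) ℂ) (x : Fin n → ℂ) :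
    AnalyticAt ℂ (fun x => MvPolynomial.eval x P) x := by
  simpa [MvPolynomial.aeval_eq_eval] using AnalyticAt.aeval_mvPolynomial
    (f := fun x i => x i) (z := x) (fun i =>
      (ContinuousLinearMap.proj (R := ℂ) (φ := fun _ : Fin n => ℂ) i).analyticAt x) P

theorem eval_map_eval_eq {n : ℕ} (F : Polynomial (MvPolynomial (Fin n) ℂ)) (y : Fin n → ℂ) (t : ℂ) :
    (F.map (MvPolynomial.eval y)).eval t =
      MvPolynomial.eval (Fin.cons t y) ((MvPolynomial.finSuccEquiv ℂ n).symm F) := by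
  rw [MvPolynomial.eval_eq_eval_mv_eval', AlgEquiv.apply_symm_apply]

theorem norm_finCons_sub_lt {n : ℕ} {t t' : ℂ} {y y' : Fin n → ℂ} {ρ : ℝ} (ht : dist t t' < ρ)
    (hy : dist y y' < ρ) :
    dist (Fin.cons t y : Fin (n + 1) → ℂ) (Fin.cons t' y') < ρ := by
  have hρ : 0 < ρ := dist_nonneg.trans_lt ht
  rw [dist_pi_lt_iff hρ]
  refine Fin.cases (by simpa using ht) fun j => ?_
  simpa using (dist_le_pi_dist y y' j).trans_lt hy

-- The residue theorem for simple poles: partial fractions reduce it to Cauchy's formula for roots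
-- inside the circle and Cauchy's theorem for those outside.
open Classical in
theorem circleIntegral_div_eq_sum {p : Polynomial ℂ} (hp : p.Monic) (hs : p.Separable)
    (hd : p.roots.toFinset.Nonempty) {c : ℂ} {r : ℝ} (hr : 0 < r)
    (hsphere : ∀ z ∈ Metric.sphere c r, p.eval z ≠ 0) {g : ℂ → ℂ}
    (hg : ∀ z ∈ Metric.closedBall c r, DifferentiableAt ℂ g z) :
    (2 * Real.pi * Complex.I : ℂ)⁻¹ * (∮ z in C(c, r), g z * (p.eval z)⁻¹) =
      ∑ t ∈ p.roots.toFinset, if t ∈ Metric.ball c r then g t * (p.derivative.eval t)⁻¹ else 0 := by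
  have hdiff : DifferentiableOn ℂ g (Metric.closedBall c r) :=
    fun z hz => (hg z hz).differentiableWithinAt
  have hne : ∀ t ∈ p.roots.toFinset, ∀ z ∈ Metric.sphere c r, z - t ≠ 0 := fun t ht z hz h => by
    rw [Polynomial.mem_roots_toFinset_of_monic hp] at ht
    exact hsphere z hz (by rw [sub_eq_zero.1 h, ht])
  have h1 : (∮ z in C(c, r), g z * (p.eval z)⁻¹) = ∮ z in C(c, r),
      ∑ t ∈ p.roots.toFinset, (p.derivative.eval t)⁻¹ * ((z - t)⁻¹ * g z) := by
    refine circleIntegral.integral_congr hr.le fun z hz => ?_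
    simp only [Polynomial.inv_eval_eq_sum_of_separable hp hs hd (hsphere z hz), Finset.mul_sum]
    exact Finset.sum_congr rfl fun t _ => by ring
  have hci : ∀ t ∈ p.roots.toFinset,
      CircleIntegrable (fun z => (p.derivative.eval t)⁻¹ * ((z - t)⁻¹ * g z)) c r := fun t ht =>
    ContinuousOn.circleIntegrable hr.le (continuousOn_const.mul
      (((continuousOn_id.sub continuousOn_const).inv₀ (hne t ht)).mul
        (hdiff.continuousOn.mono Metric.sphere_subset_closedBall)))
  rw [h1, circleIntegral.integral_fun_sum hci, Finset.mul_sum]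
  refine Finset.sum_congr rfl fun t ht => ?_
  rw [circleIntegral.integral_const_mul]
  have hpi : (2 * Real.pi * Complex.I : ℂ) ≠ 0 := Complex.two_pi_I_ne_zero
  split_ifs with hb
  · have := hdiff.circleIntegral_sub_inv_smul hb
    simp only [smul_eq_mul] at this
    rw [this]
    field_simp
  · have hnot : t ∉ Metric.closedBall c r := fun h => by
      rcases (Metric.mem_closedBall.1 h).lt_or_eq with h | h
      · exact hb h
      · exact hne t ht t h (sub_self t)
    have : (∮ z in C(c, r), (z - t)⁻¹ * g z) = 0 := by
      refine DiffContOnCl.circleIntegral_eq_zero hr.le (DifferentiableOn.diffContOnCl ?_)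
      refine fun z hz => ?_
      have hz' := Metric.closure_ball_subset_closedBall hz
      exact (((differentiableAt_id.sub_const t).inv
        (sub_ne_zero.2 fun h => hnot (h ▸ hz'))).mul (hg z hz')).differentiableWithinAt
    rw [this, mul_zero, mul_zero]

/-- The trace of a function that is locally holomorphic on a hypersurface extends
holomorphically over the branch locus. -/
theorem exists_local_extension_rootTrace {n : ℕ} {F : Polynomial (MvPolynomial (Fin n) ℂ)}
    (hF : F.Monic) (hdeg : F.natDegree ≠ 0) {ψ : (Fin (n + 1) → ℂ) → ℂ} (y₀ : Fin n → ℂ)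
    (hψ : ∀ t, (F.map (MvPolynomial.eval y₀)).eval t = 0 →
      ∃ Φ : (Fin (n + 1) → ℂ) → ℂ, AnalyticAt ℂ Φ (Fin.cons t y₀) ∧
        ∀ᶠ x in 𝓝 (Fin.cons t y₀ : Fin (n + 1) → ℂ),
          MvPolynomial.eval x ((MvPolynomial.finSuccEquiv ℂ n).symm F) = 0 → Φ x = ψ x) :
    ∃ h : (Fin n → ℂ) → ℂ, ∀ᶠ y in 𝓝 y₀, DifferentiableAt ℂ h y ∧
      ((F.map (MvPolynomial.eval y)).Separable → h y = rootTrace F ψ y) := by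
  classical
  have hroot : ∀ {y : Fin n → ℂ} {t : ℂ}, t ∈ (F.map (MvPolynomial.eval y)).roots.toFinset ↔
      (F.map (MvPolynomial.eval y)).eval t = 0 :=
    fun {y t} => Polynomial.mem_roots_toFinset_of_monic (hF.map _)
  set Z := (F.map (MvPolynomial.eval y₀)).roots.toFinset with hZ
  have hψ' : ∀ t : ℂ, ∃ Φ : (Fin (n + 1) → ℂ) → ℂ, ∃ ρ > 0, t ∈ Z →
      ∀ x ∈ Metric.ball (Fin.cons t y₀ : Fin (n + 1) → ℂ) ρ, AnalyticAt ℂ Φ x ∧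
        (MvPolynomial.eval x ((MvPolynomial.finSuccEquiv ℂ n).symm F) = 0 → Φ x = ψ x) := by
    intro t
    by_cases ht : t ∈ Z
    · obtain ⟨Φ, hΦ, hΦψ⟩ := hψ t (hroot.1 ht)
      obtain ⟨ρ, hρ, h⟩ := Metric.eventually_nhds_iff_ball.1 (hΦ.eventually_analyticAt.and hΦψ)
      exact ⟨Φ, ρ, hρ, fun _ => h⟩
    · exact ⟨0, 1, one_pos, fun h => absurd h ht⟩
  choose Φ ρ hρ hΦ using hψ'
  -- The radius is small enough for the local extensions to live on the discs and, by `2 * r < dist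
  -- t t'`, for discs around distinct roots to be disjoint.
  obtain ⟨r, ⟨hr1, hr2⟩, hr⟩ : ∃ r : ℝ, ((∀ t ∈ Z, r < ρ t) ∧
      ∀ t ∈ Z, ∀ t' ∈ Z, t ≠ t' → 2 * r < dist t t') ∧ 0 < r := by
    have hlt : ∀ s : ℝ, 0 < s → ∀ᶠ r : ℝ in 𝓝[>] 0, r < s := fun s hs =>
      nhdsWithin_le_nhds (eventually_lt_nhds hs)
    have h1 : ∀ᶠ r : ℝ in 𝓝[>] 0, ∀ t ∈ Z, r < ρ t := by
      rw [Filter.eventually_all_finset]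
      exact fun t _ => hlt _ (hρ t)
    have h2 : ∀ᶠ r : ℝ in 𝓝[>] 0, ∀ t ∈ Z, ∀ t' ∈ Z, t ≠ t' → 2 * r < dist t t' := by
      rw [Filter.eventually_all_finset]
      intro t _
      rw [Filter.eventually_all_finset]
      intro t' _
      by_cases h : t = t'
      · exact Filter.Eventually.of_forall fun r hne => absurd h hne
      · exact (hlt (dist t t' / 2) (half_pos (dist_pos.2 h))).mono fun r hr _ => by linarith
    exact ((h1.and h2).and self_mem_nhdsWithin).exists
  have hsph : ∀ t ∈ Z, ∀ᶠ y in 𝓝 y₀, ∀ z ∈ Metric.sphere t r,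
      (F.map (MvPolynomial.eval y)).eval z ≠ 0 := fun t ht =>
    eventually_eval_ne_zero_of_mem_sphere fun z hz h => by
      have hzt : dist t z = r := by rw [dist_comm]; exact hz
      have h3 := hr2 t ht z (hroot.2 h) (fun h => by subst h; simp at hzt; linarith)
      linarith
  have hball : ∀ᶠ y in 𝓝 y₀, dist y y₀ < r := Metric.ball_mem_nhds y₀ hr
  have hev := hball.and
    (((Filter.eventually_all_finset Z).2 hsph).and (eventually_exists_root_mem_ball hF y₀ hr))
  -- The integrals run over fixed circles around the roots at `y₀`. They make sense even where roots
  -- collide, and at separable `y` they pick up the residues.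
  refine ⟨fun y => ∑ t ∈ Z, (2 * Real.pi * Complex.I : ℂ)⁻¹ * ∮ z in C(t, r),
    Φ t (Fin.cons z y) * ((F.map (MvPolynomial.eval y)).eval z)⁻¹, ?_⟩
  filter_upwards [hev] with y ⟨hy1, hy2, hy3⟩
  have han : ∀ t ∈ Z, ∀ z ∈ Metric.closedBall t r, AnalyticAt ℂ (Φ t) (Fin.cons z y) :=
    fun t ht z hz => (hΦ t ht _ (norm_finCons_sub_lt (lt_of_le_of_lt hz (hr1 t ht))
      (hy1.trans (hr1 t ht)))).1
  have hanp : ∀ z : ℂ, AnalyticAt ℂ (fun p : (Fin n → ℂ) × ℂ =>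
      (F.map (MvPolynomial.eval p.1)).eval p.2) (y, z) := fun z => by
    simp only [eval_map_eval_eq]
    exact AnalyticAt.comp (f := fun p : (Fin n → ℂ) × ℂ => (Fin.cons p.2 p.1 : Fin (n + 1) → ℂ))
      (analyticAt_mvPolynomial_eval _ _) (analyticAt_finCons y z)
  constructor
  · refine DifferentiableAt.fun_sum fun t ht => DifferentiableAt.const_mul ?_ _
    refine differentiableAt_circleIntegral (G := fun p : (Fin n → ℂ) × ℂ =>
      Φ t (Fin.cons p.2 p.1) * ((F.map (MvPolynomial.eval p.1)).eval p.2)⁻¹) hr.le fun z hz => ?_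
    refine AnalyticAt.mul ?_ ((hanp z).inv (hy2 t ht z hz))
    exact AnalyticAt.comp (f := fun p : (Fin n → ℂ) × ℂ => (Fin.cons p.2 p.1 : Fin (n + 1) → ℂ))
      (han t ht z (Metric.sphere_subset_closedBall hz)) (analyticAt_finCons y z)
  · intro hsep
    have hmon := hF.map (MvPolynomial.eval y)
    have hne : (F.map (MvPolynomial.eval y)).roots.toFinset.Nonempty := by
      obtain ⟨t, ht⟩ := IsAlgClosed.exists_root (F.map (MvPolynomial.eval y)) (fun h => hdeg (by
        rw [← hF.natDegree_map (MvPolynomial.eval y)]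
        exact Polynomial.natDegree_eq_zero_iff_degree_le_zero.2 h.le))
      exact ⟨t, hroot.2 ht⟩
    have h1 : ∀ t ∈ Z, (2 * Real.pi * Complex.I : ℂ)⁻¹ * (∮ z in C(t, r),
        Φ t (Fin.cons z y) * ((F.map (MvPolynomial.eval y)).eval z)⁻¹) =
        ∑ z ∈ (F.map (MvPolynomial.eval y)).roots.toFinset, if z ∈ Metric.ball t r then
          ψ (Fin.cons z y) * ((F.map (MvPolynomial.eval y)).derivative.eval z)⁻¹ else 0 := by
      intro t ht
      rw [circleIntegral_div_eq_sum hmon hsep hne hr (hy2 t ht)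
        (g := fun z => Φ t (Fin.cons z y)) fun z hz =>
        (han t ht z hz).differentiableAt.comp z ((differentiable_finCons_prod.comp
          (differentiable_id.prodMk (differentiable_const y))) z)]
      refine Finset.sum_congr rfl fun z hz => ?_
      split_ifs with hb
      · rw [(hΦ t ht (Fin.cons z y) (norm_finCons_sub_lt (lt_trans hb (hr1 t ht))
          (hy1.trans (hr1 t ht)))).2 (by rw [← eval_map_eval_eq]; exact hroot.1 hz)]
      · rfl
    -- After exchanging the sums, each root of the specialization at `y` is counted once: it lies in
    -- exactly one of the disjoint discs.
    rw [Finset.sum_congr rfl h1, Finset.sum_comm, rootTrace]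
    refine Finset.sum_congr rfl fun z hz => ?_
    obtain ⟨t, ht, hzt⟩ := hy3 z (hroot.1 hz)
    rw [Finset.sum_eq_single_of_mem t (hroot.2 ht), if_pos hzt]
    intro t' ht' hne'
    rw [if_neg fun h => ?_]
    have h4 := hr2 t' ht' t (hroot.2 ht) hne'
    have h5 := dist_triangle_left t' t z
    rw [Metric.mem_ball] at h hzt
    linarith

namespace MvPolynomial

theorem IsHomogeneous.eval_smul_eq {n d : ℕ} {f : MvPolynomial (Fin n) ℂ} (hf : f.IsHomogeneous d)
    (c : ℂ) (x : Fin n → ℂ) : eval (c • x) f = c ^ d * eval x f := by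
  rw [eval_eq, eval_eq, Finset.mul_sum]
  refine Finset.sum_congr rfl fun s hs => ?_
  have h1 : ∑ i ∈ s.support, s i = d := (hf.degree_eq_sum_deg_support hs).symm
  simp only [Pi.smul_apply, smul_eq_mul, mul_pow, Finset.prod_mul_distrib,
    Finset.prod_pow_eq_pow_sum, h1]
  ring

theorem eq_zero_of_eventually_eval_eq_zero {n : ℕ} {D : MvPolynomial (Fin n) ℂ}
    {y : Fin n → ℂ} (h : ∀ᶠ z in 𝓝 y, eval z D = 0) : D = 0 := by
  have h1 : (fun z => eval z D) = fun _ => (0 : ℂ) :=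
    AnalyticOnNhd.eq_of_eventuallyEq (𝕜 := ℂ) (z₀ := y)
      (fun z _ => analyticAt_mvPolynomial_eval D z) (fun z _ => analyticAt_const) h
  exact MvPolynomial.funext fun z => by simpa using congrFun h1 z

theorem dense_eval_ne_zero {n : ℕ} {D : MvPolynomial (Fin n) ℂ} (hD : D ≠ 0) :
    Dense {y : Fin n → ℂ | eval y D ≠ 0} := fun y => by
  rw [mem_closure_iff_frequently]
  exact fun h => hD (eq_zero_of_eventually_eval_eq_zero (h.mono fun z hz => not_not.1 hz))

theorem isOpen_eval_ne_zero {n : ℕ} (D : MvPolynomial (Fin n) ℂ) :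
    IsOpen {y : Fin n → ℂ | eval y D ≠ 0} :=
  isOpen_ne_fun (continuous_eval D) continuous_const

end MvPolynomial

/-! ### Homogeneity and polynomiality of traces -/

/-- `φ` is, locally along the punctured affine hypersurface `f = 0`, the restriction of a holomorphic
function of the ambient space. -/
def IsHolomorphicOnZeros {n : ℕ} (f : MvPolynomial (Fin n) ℂ) (φ : (Fin n → ℂ) → ℂ) : Prop :=
  ∀ x, x ≠ 0 → MvPolynomial.eval x f = 0 →
    ∃ Φ : (Fin n → ℂ) → ℂ, AnalyticAt ℂ Φ x ∧
      ∀ᶠ y in 𝓝 x, MvPolynomial.eval y f = 0 → Φ y = φ y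

section Branched

variable {n : ℕ} {F : Polynomial (MvPolynomial (Fin n) ℂ)}

theorem map_eval_smul_comp {m : ℕ}
    (hom : ((MvPolynomial.finSuccEquiv ℂ n).symm F).IsHomogeneous m) (c : ℂ) (y : Fin n → ℂ) :
    (F.map (MvPolynomial.eval (c • y))).comp (Polynomial.C c * Polynomial.X) =
      Polynomial.C (c ^ m) * F.map (MvPolynomial.eval y) := by
  refine Polynomial.funext fun t => ?_
  have h : c • (Fin.cons t y : Fin (n + 1) → ℂ) = Fin.cons (c * t) (c • y) := by
    ext i
    refine Fin.cases ?_ (fun j => ?_) i <;> simp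
  simp only [Polynomial.eval_comp, Polynomial.eval_mul, Polynomial.eval_C, Polynomial.eval_X,
    eval_map_eval_eq, ← h, hom.eval_smul_eq]

theorem eval_map_eval_smul {m : ℕ}
    (hom : ((MvPolynomial.finSuccEquiv ℂ n).symm F).IsHomogeneous m) (c t : ℂ) (y : Fin n → ℂ) :
    (F.map (MvPolynomial.eval (c • y))).eval (c * t) =
      c ^ m * (F.map (MvPolynomial.eval y)).eval t := by
  simpa using congrArg (Polynomial.eval t) (map_eval_smul_comp hom c y)

theorem derivative_eval_map_eval_smul {m : ℕ}
    (hom : ((MvPolynomial.finSuccEquiv ℂ n).symm F).IsHomogeneous (m + 1)) {c : ℂ} (hc : c ≠ 0)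
    (t : ℂ) (y : Fin n → ℂ) :
    (F.map (MvPolynomial.eval (c • y))).derivative.eval (c * t) =
      c ^ m * (F.map (MvPolynomial.eval y)).derivative.eval t := by
  have h := congrArg (fun p => p.derivative.eval t) (map_eval_smul_comp hom c y)
  simp only [Polynomial.derivative_comp, Polynomial.derivative_C_mul, Polynomial.derivative_X,
    Polynomial.eval_mul, Polynomial.eval_comp, Polynomial.eval_C, Polynomial.eval_X, mul_one] at h
  apply mul_left_cancel₀ hc
  rw [h]
  ring

/-- Scaling `y` by `c` scales the roots by `c`. The derivative at a root is homogeneous of degree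
`m`, which is why the weight drops from `e + m` to `e`. -/
theorem rootTrace_smul {m e : ℕ} (hF : F.Monic)
    (hom : ((MvPolynomial.finSuccEquiv ℂ n).symm F).IsHomogeneous (m + 1))
    {ψ : (Fin (n + 1) → ℂ) → ℂ} (hψ : ∀ c : ℂ, c ≠ 0 → ∀ x, x ≠ 0 →
      MvPolynomial.eval x ((MvPolynomial.finSuccEquiv ℂ n).symm F) = 0 →
        ψ (c • x) = c ^ (e + m) * ψ x) {c : ℂ} (hc : c ≠ 0) {y : Fin n → ℂ} (hy : y ≠ 0) :
    rootTrace F ψ (c • y) = c ^ e * rootTrace F ψ y := by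
  rw [rootTrace, rootTrace, Finset.mul_sum]
  symm
  refine Finset.sum_nbij' (fun t => c * t) (fun t => c⁻¹ * t) ?_ ?_ ?_ ?_ ?_
  · intro t ht
    rw [Polynomial.mem_roots_toFinset_of_monic (hF.map _)] at ht ⊢
    rw [eval_map_eval_smul hom, ht, mul_zero]
  · intro t ht
    rw [Polynomial.mem_roots_toFinset_of_monic (hF.map _)] at ht ⊢
    have := eval_map_eval_smul hom c (c⁻¹ * t) y
    rw [mul_inv_cancel_left₀ hc, ht, eq_comm, mul_eq_zero] at this
    exact this.resolve_left (pow_ne_zero _ hc)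
  · intro t _
    exact inv_mul_cancel_left₀ hc t
  · intro t _
    exact mul_inv_cancel_left₀ hc t
  · intro t ht
    rw [Polynomial.mem_roots_toFinset_of_monic (hF.map _), eval_map_eval_eq] at ht
    have h : (Fin.cons (c * t) (c • y) : Fin (n + 1) → ℂ) = c • Fin.cons t y := by
      ext i
      refine Fin.cases ?_ (fun j => ?_) i <;> simp
    rw [h, hψ c hc _ (finCons_ne_zero_of_right t hy) ht, derivative_eval_map_eval_smul hom hc,
      pow_add, mul_inv]
    field_simp

/-- The centre of the projection is not on the hypersurface: a nonzero root over `y = 0` would by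
homogeneity make the monic polynomial over 0 vanish identically. -/
theorem ne_zero_of_eval_map_eval_zero {m : ℕ} (hF : F.Monic)
    (hom : ((MvPolynomial.finSuccEquiv ℂ n).symm F).IsHomogeneous m) {t : ℂ} {y : Fin n → ℂ}
    (hx : (Fin.cons t y : Fin (n + 1) → ℂ) ≠ 0)
    (h : (F.map (MvPolynomial.eval y)).eval t = 0) : y ≠ 0 := by
  rintro rfl
  have ht : t ≠ 0 := fun h => hx (by
    ext i
    refine Fin.cases ?_ (fun j => ?_) i <;> simp [h])
  refine (hF.map (MvPolynomial.eval (0 : Fin n → ℂ))).ne_zero (Polynomial.funext fun s => ?_)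
  have := eval_map_eval_smul hom (s / t) t 0
  rw [smul_zero, div_mul_cancel₀ s ht, h, mul_zero] at this
  simpa using this

/-- The circle integrals extend the trace holomorphically over the discriminant, away from the
origin; the extension is homogeneous and hence polynomial. -/
theorem exists_mvPolynomial_rootTrace {n m e : ℕ}
    {F : Polynomial (MvPolynomial (Fin (n + 2)) ℂ)} (hF : F.Monic) (hdeg : F.natDegree ≠ 0)
    (hom : ((MvPolynomial.finSuccEquiv ℂ (n + 2)).symm F).IsHomogeneous (m + 1))
    {D : MvPolynomial (Fin (n + 2)) ℂ} (hD : D ≠ 0)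
    (hsep : ∀ y, MvPolynomial.eval y D ≠ 0 → (F.map (MvPolynomial.eval y)).Separable)
    {ψ : (Fin (n + 3) → ℂ) → ℂ}
    (hψ : IsHolomorphicOnZeros ((MvPolynomial.finSuccEquiv ℂ (n + 2)).symm F) ψ)
    (hψh : ∀ c : ℂ, c ≠ 0 → ∀ x, x ≠ 0 →
      MvPolynomial.eval x ((MvPolynomial.finSuccEquiv ℂ (n + 2)).symm F) = 0 →
        ψ (c • x) = c ^ (e + m) * ψ x) :
    ∃ P : MvPolynomial (Fin (n + 2)) ℂ, ∀ y, y ≠ 0 → MvPolynomial.eval y D ≠ 0 →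
      rootTrace F ψ y = MvPolynomial.eval y P := by
  set A := {y : Fin (n + 2) → ℂ | MvPolynomial.eval y D ≠ 0} with hA
  have hAd : Dense A := MvPolynomial.dense_eval_ne_zero hD
  have hAo : IsOpen A := MvPolynomial.isOpen_eval_ne_zero D
  set r := extendFrom A (rootTrace F ψ) with hr
  have hloc : ∀ y₀ : Fin (n + 2) → ℂ, y₀ ≠ 0 → ∃ h : (Fin (n + 2) → ℂ) → ℂ, ∀ᶠ y in 𝓝 y₀,
      DifferentiableAt ℂ h y ∧ (y ∈ A → h y = rootTrace F ψ y) ∧ r y = h y := by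
    intro y₀ hy₀
    obtain ⟨h, hh⟩ := exists_local_extension_rootTrace hF hdeg y₀ fun t ht =>
      hψ _ (finCons_ne_zero_of_right t hy₀) (by rw [← eval_map_eval_eq, ht])
    refine ⟨h, ?_⟩
    filter_upwards [hh.eventually_nhds] with y hy
    have hy0 := hy.self_of_nhds
    refine ⟨hy0.1, fun hyA => hy0.2 (hsep y hyA), ?_⟩
    refine extendFrom_eq (hAd y) ?_
    refine (hy0.1.continuousAt.tendsto.mono_left nhdsWithin_le_nhds).congr' ?_
    filter_upwards [nhdsWithin_le_nhds hy, self_mem_nhdsWithin] with z hz hzA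
    exact hz.2 (hsep z hzA)
  have hrA : ∀ y, y ≠ 0 → y ∈ A → r y = rootTrace F ψ y := fun y hy hyA => by
    obtain ⟨h, hh⟩ := hloc y hy
    exact hh.self_of_nhds.2.2.trans (hh.self_of_nhds.2.1 hyA)
  have hrd : ∀ y, y ≠ 0 → DifferentiableAt ℂ r y := fun y hy => by
    obtain ⟨h, hh⟩ := hloc y hy
    exact hh.self_of_nhds.1.congr_of_eventuallyEq (hh.mono fun z hz => hz.2.2)
  obtain ⟨P, hP⟩ := exists_mvPolynomial_of_homogeneous e hrd (fun c hc y hy => by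
    -- Homogeneity of the trace is used only where both `y` and `c • y` avoid the discriminant;
    -- these points are dense, and continuity does the rest.
    have hd2 : Dense (A ∩ (fun y => c • y) ⁻¹' A) := by
      refine hAd.inter_of_isOpen_left ?_ hAo
      exact hAd.preimage (isOpenMap_smul₀ hc)
    have hfreq : ∃ᶠ z in 𝓝 y, z ∈ A ∩ (fun y => c • y) ⁻¹' A :=
      mem_closure_iff_frequently.1 (hd2 y)
    have hc1 : ContinuousAt (fun z => r (c • z) - c ^ e * r z) y :=
      (ContinuousAt.comp (g := r) (hrd _ (smul_ne_zero hc hy)).continuousAt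
        (continuous_const_smul c).continuousAt).sub
        (continuousAt_const.mul (hrd y hy).continuousAt)
    by_contra hne
    have h1 := hc1.eventually_ne (sub_ne_zero.2 hne)
    obtain ⟨z, ⟨hzA, hzc⟩, hz1, hz0⟩ :=
      (hfreq.and_eventually (h1.and (isOpen_ne.mem_nhds hy))).exists
    apply hz1
    rw [hrA _ (smul_ne_zero hc hz0) hzc, hrA z hz0 hzA, rootTrace_smul hF hom hψh hc hz0, sub_self])
  exact ⟨P, fun y hy hyA => (hrA y hy hyA).symm.trans (hP y hy)⟩

/-- The sum is the divided difference (p(t) − p(s))/(t − s). At two roots it is 0 off the diagonal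
and p′ on it. -/
theorem sum_coeff_mul_geom_sum₂ {p : Polynomial ℂ} (t s : ℂ) (ht : p.eval t = 0)
    (hs : p.eval s = 0) :
    ∑ l ∈ Finset.range (p.natDegree + 1), p.coeff l *
      ∑ i ∈ Finset.range l, t ^ i * s ^ (l - 1 - i) =
      if t = s then p.derivative.eval t else 0 := by
  split_ifs with h
  · subst h
    rw [Polynomial.derivative_eval, Polynomial.sum_over_range p (by simp)]
    refine Finset.sum_congr rfl fun l _ => ?_
    rw [geom_sum₂_self]
    ring
  · apply mul_right_cancel₀ (sub_ne_zero.2 h)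
    rw [Finset.sum_mul, zero_mul, ← sub_eq_zero.2 (ht.trans hs.symm), Polynomial.eval_eq_sum_range,
      Polynomial.eval_eq_sum_range, ← Finset.sum_sub_distrib]
    refine Finset.sum_congr rfl fun l _ => ?_
    rw [mul_assoc, geom_sum₂_mul, mul_sub]

/-- Lagrange interpolation of a function on the roots of a separable polynomial. -/
theorem eq_sum_traces {p : Polynomial ℂ} (hp : p.Monic) (hs : p.Separable) (φ : ℂ → ℂ) {t : ℂ}
    (ht : p.eval t = 0) :
    φ t = ∑ l ∈ Finset.range (p.natDegree + 1), ∑ i ∈ Finset.range l, p.coeff l * t ^ i *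
      ∑ s ∈ p.roots.toFinset, (φ s * s ^ (l - 1 - i)) * (p.derivative.eval s)⁻¹ := by
  have h1 : ∀ s ∈ p.roots.toFinset, φ s * (p.derivative.eval s)⁻¹ *
      (∑ l ∈ Finset.range (p.natDegree + 1), p.coeff l *
        ∑ i ∈ Finset.range l, t ^ i * s ^ (l - 1 - i)) = if t = s then φ s else 0 := by
    intro s hs'
    rw [Polynomial.mem_roots_toFinset_of_monic hp] at hs'
    rw [sum_coeff_mul_geom_sum₂ t s ht hs']
    split_ifs with h
    · subst h
      have : p.derivative.eval t ≠ 0 := hs.eval₂_derivative_ne_zero (RingHom.id ℂ) ht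
      rw [mul_assoc, inv_mul_cancel₀ this, mul_one]
    · rw [mul_zero]
  have h2 := Finset.sum_congr rfl h1
  rw [Finset.sum_ite_eq, if_pos ((Polynomial.mem_roots_toFinset_of_monic hp).2 ht)] at h2
  rw [← h2]
  simp only [Finset.mul_sum]
  rw [Finset.sum_comm]
  refine Finset.sum_congr rfl fun l _ => ?_
  rw [Finset.sum_comm]
  exact Finset.sum_congr rfl fun i _ => Finset.sum_congr rfl fun s _ => by ring

end Branched

/-! ### Functions on a hypersurface given by a monic equation -/

section MonicCoordinates

variable {n : ℕ} {F : Polynomial (MvPolynomial (Fin n) ℂ)}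

/-- The product of the distances from `t₀` to the roots is |F_y(t₀)|, which tends to 0; once it is
below ρ to the degree, some distance is below ρ. -/
theorem eventually_exists_root_near (hF : F.Monic) {t₀ : ℂ} {y₀ : Fin n → ℂ}
    (h₀ : (F.map (MvPolynomial.eval y₀)).eval t₀ = 0) {ρ : ℝ} (hρ : 0 < ρ) :
    ∀ᶠ y in 𝓝 y₀, (F.map (MvPolynomial.eval y)).Separable →
      ∃ t, (F.map (MvPolynomial.eval y)).eval t = 0 ∧ dist t t₀ < ρ := by
  have hc : Continuous fun y : Fin n → ℂ => (F.map (MvPolynomial.eval y)).eval t₀ :=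
    (continuous_eval_map_eval F).comp (continuous_id.prodMk continuous_const)
  have hlt : ∀ᶠ y in 𝓝 y₀, ‖(F.map (MvPolynomial.eval y)).eval t₀‖ < ρ ^ F.natDegree :=
    hc.continuousAt.norm.eventually_lt_const (by simp only [h₀, norm_zero]; positivity)
  filter_upwards [hlt] with y hy hsep
  by_contra! hcon
  have hm := hF.map (MvPolynomial.eval y)
  refine hy.not_ge ?_
  rw [Polynomial.eq_nodal_roots_of_separable hm hsep, Lagrange.eval_nodal, norm_prod]
  have hcard : (F.map (MvPolynomial.eval y)).roots.toFinset.card = F.natDegree := by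
    rw [← hF.natDegree_map (MvPolynomial.eval y)]
    conv_rhs => rw [Polynomial.eq_nodal_roots_of_separable hm hsep]
    rw [Lagrange.natDegree_nodal]
  rw [← hcard, ← Finset.prod_const]
  refine Finset.prod_le_prod (fun _ _ => hρ.le) fun t ht => ?_
  rw [← dist_eq_norm, dist_comm]
  exact hcon t ((Polynomial.mem_roots_toFinset_of_monic hm).1 ht)

/-- Over separable fibres, interpolation expresses φ through the coefficients of `F`, powers of the
fibre coordinate and the traces of φ · x₀ᵏ, all polynomial. Other points are limits of points in
separable fibres, by continuity of roots. -/
theorem exists_mvPolynomial_eq_on_zeros_of_monic {n m e : ℕ}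
    {F : Polynomial (MvPolynomial (Fin (n + 2)) ℂ)} (hF : F.Monic) (hdeg : F.natDegree ≠ 0)
    (hom : ((MvPolynomial.finSuccEquiv ℂ (n + 2)).symm F).IsHomogeneous (m + 1))
    {D : MvPolynomial (Fin (n + 2)) ℂ} (hD : D ≠ 0)
    (hsep : ∀ y, MvPolynomial.eval y D ≠ 0 → (F.map (MvPolynomial.eval y)).Separable)
    {φ : (Fin (n + 3) → ℂ) → ℂ}
    (hφ : IsHolomorphicOnZeros ((MvPolynomial.finSuccEquiv ℂ (n + 2)).symm F) φ)
    (hφh : ∀ c : ℂ, c ≠ 0 → ∀ x, x ≠ 0 →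
      MvPolynomial.eval x ((MvPolynomial.finSuccEquiv ℂ (n + 2)).symm F) = 0 →
        φ (c • x) = c ^ (e + m) * φ x) :
    ∃ P : MvPolynomial (Fin (n + 3)) ℂ, ∀ x, x ≠ 0 →
      MvPolynomial.eval x ((MvPolynomial.finSuccEquiv ℂ (n + 2)).symm F) = 0 →
        φ x = MvPolynomial.eval x P := by
  have htr : ∀ k : ℕ, ∃ R : MvPolynomial (Fin (n + 2)) ℂ, ∀ y, y ≠ 0 → MvPolynomial.eval y D ≠ 0 →
      rootTrace F (fun x => φ x * x 0 ^ k) y = MvPolynomial.eval y R := fun k => by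
    refine exists_mvPolynomial_rootTrace (e := e + k) hF hdeg hom hD hsep ?_ ?_
    · intro x hx hxF
      obtain ⟨Φ, hΦ, hΦφ⟩ := hφ x hx hxF
      refine ⟨fun x => Φ x * x 0 ^ k, hΦ.mul
        (((ContinuousLinearMap.proj (R := ℂ) (φ := fun _ : Fin (n + 3) => ℂ) 0).analyticAt x).pow k), ?_⟩
      filter_upwards [hΦφ] with z hz hzF
      rw [hz hzF]
    · intro c hc x hx hxF
      rw [hφh c hc x hx hxF, Pi.smul_apply, smul_eq_mul, mul_pow]
      ring
  choose R hR using htr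
  set P : MvPolynomial (Fin (n + 3)) ℂ := ∑ l ∈ Finset.range (F.natDegree + 1),
    ∑ i ∈ Finset.range l, MvPolynomial.rename Fin.succ (F.coeff l) * MvPolynomial.X 0 ^ i *
      MvPolynomial.rename Fin.succ (R (l - 1 - i)) with hP
  have hgen : ∀ (t : ℂ) (y : Fin (n + 2) → ℂ), y ≠ 0 → MvPolynomial.eval y D ≠ 0 →
      (F.map (MvPolynomial.eval y)).eval t = 0 →
        φ (Fin.cons t y) = MvPolynomial.eval (Fin.cons t y) P := by
    intro t y hy hyD ht
    rw [eq_sum_traces (hF.map _) (hsep y hyD) (fun t => φ (Fin.cons t y)) ht, hF.natDegree_map]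
    simp only [hP, map_sum, map_mul, map_pow, MvPolynomial.eval_X, Fin.cons_zero,
      MvPolynomial.eval_rename, Polynomial.coeff_map]
    refine Finset.sum_congr rfl fun l _ => Finset.sum_congr rfl fun i _ => ?_
    have hcs : (Fin.cons t y : Fin (n + 3) → ℂ) ∘ Fin.succ = y := by
      ext j; simp
    rw [hcs, ← hR _ y hy hyD, rootTrace]
    simp only [Fin.cons_zero]
  refine ⟨P, fun x hx hxF => ?_⟩
  obtain ⟨Φ, hΦ, hΦφ⟩ := hφ x hx hxF
  rw [← hΦφ.self_of_nhds hxF]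
  by_contra hne
  have hcont : ContinuousAt (fun z => Φ z - MvPolynomial.eval z P) x :=
    hΦ.continuousAt.sub (MvPolynomial.continuous_eval P).continuousAt
  obtain ⟨ρ, hρ, hball⟩ := Metric.eventually_nhds_iff_ball.1
    (hΦφ.and (hcont.eventually_ne (sub_ne_zero.2 hne)))
  have hx' : (Fin.cons (x 0) (Fin.tail x) : Fin (n + 3) → ℂ) = x := Fin.cons_self_tail x
  have h0 : (F.map (MvPolynomial.eval (Fin.tail x))).eval (x 0) = 0 := by
    rw [eval_map_eval_eq, hx', hxF]
  have hy0 : Fin.tail x ≠ 0 := ne_zero_of_eval_map_eval_zero hF hom (hx'.symm ▸ hx) h0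
  have hev1 : ∀ᶠ y in 𝓝 (Fin.tail x), y ≠ 0 := isOpen_ne.mem_nhds hy0
  have hev2 : ∀ᶠ y in 𝓝 (Fin.tail x), dist y (Fin.tail x) < ρ := Metric.ball_mem_nhds _ hρ
  obtain ⟨y, hyD, hy1, hy2, hy3⟩ := ((mem_closure_iff_frequently.1
    (MvPolynomial.dense_eval_ne_zero hD (Fin.tail x))).and_eventually
    ((eventually_exists_root_near hF h0 hρ).and (hev1.and hev2))).exists
  obtain ⟨t, ht, htρ⟩ := hy1 (hsep y hyD)
  have hmem : dist (Fin.cons t y : Fin (n + 3) → ℂ) x < ρ := by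
    rw [← hx']
    exact norm_finCons_sub_lt htρ hy3
  obtain ⟨h1, h2⟩ := hball _ hmem
  apply h2
  rw [h1 (by rw [← eval_map_eval_eq, ht]), hgen t y hy2 hyD ht, sub_self]

/-- The remainder of `Q` modulo `F` vanishes at all roots over a generic `y`, and there are more of
these than its degree allows. -/
theorem dvd_of_eval_eq_zero_on_zeros_of_monic {n : ℕ}
    {F : Polynomial (MvPolynomial (Fin (n + 1)) ℂ)} (hF : F.Monic)
    {D : MvPolynomial (Fin (n + 1)) ℂ} (hD : D ≠ 0)
    (hsep : ∀ y, MvPolynomial.eval y D ≠ 0 → (F.map (MvPolynomial.eval y)).Separable)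
    {Q : MvPolynomial (Fin (n + 2)) ℂ}
    (hQ : ∀ x, x ≠ 0 → MvPolynomial.eval x ((MvPolynomial.finSuccEquiv ℂ (n + 1)).symm F) = 0 →
      MvPolynomial.eval x Q = 0) :
    (MvPolynomial.finSuccEquiv ℂ (n + 1)).symm F ∣ Q := by
  by_cases hF1 : F = 1
  · rw [hF1, map_one]
    exact one_dvd Q
  set R := (MvPolynomial.finSuccEquiv ℂ (n + 1) Q) %ₘ F with hR
  have hRdeg : R.natDegree < F.natDegree := Polynomial.natDegree_modByMonic_lt _ hF hF1
  have hR0 : ∀ y, y ≠ 0 → MvPolynomial.eval y D ≠ 0 → R.map (MvPolynomial.eval y) = 0 := by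
    intro y hy hyD
    have hm := hF.map (MvPolynomial.eval y)
    have hcard : (F.map (MvPolynomial.eval y)).roots.toFinset.card = F.natDegree := by
      rw [← hF.natDegree_map (MvPolynomial.eval y)]
      conv_rhs => rw [Polynomial.eq_nodal_roots_of_separable hm (hsep y hyD)]
      rw [Lagrange.natDegree_nodal]
    refine Polynomial.eq_zero_of_natDegree_lt_card_of_eval_eq_zero' _
      (F.map (MvPolynomial.eval y)).roots.toFinset (fun t ht => ?_) ?_
    · rw [Polynomial.mem_roots_toFinset_of_monic hm] at ht
      have h1 := congrArg (fun p => (p.map (MvPolynomial.eval y)).eval t)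
        (Polynomial.modByMonic_add_div (MvPolynomial.finSuccEquiv ℂ (n + 1) Q) F)
      simp only [Polynomial.map_add, Polynomial.map_mul, Polynomial.eval_add, Polynomial.eval_mul,
        ht, zero_mul, add_zero] at h1
      rw [hR, h1, ← MvPolynomial.eval_eq_eval_mv_eval']
      exact hQ _ (finCons_ne_zero_of_right t hy) (by rw [← eval_map_eval_eq, ht])
    · rw [hcard]
      exact Polynomial.natDegree_map_le.trans_lt hRdeg
  have hRz : R = 0 := by
    ext1 i
    rw [Polynomial.coeff_zero]
    have hX : (MvPolynomial.X 0 : MvPolynomial (Fin (n + 1)) ℂ) ≠ 0 := MvPolynomial.X_ne_zero 0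
    -- The factors `D` and `X 0` absorb the excluded points, the discriminant locus and `y = 0`.
    have : R.coeff i * (D * MvPolynomial.X 0) = 0 := MvPolynomial.funext fun y => by
      rw [map_mul, map_mul, MvPolynomial.eval_X, map_zero]
      by_cases hy : y = 0
      · simp [hy]
      by_cases hyD : MvPolynomial.eval y D = 0
      · simp [hyD]
      have := congrArg (fun p => p.coeff i) (hR0 y hy hyD)
      simp only [Polynomial.coeff_map, Polynomial.coeff_zero] at this
      rw [this, zero_mul]
    exact (mul_eq_zero.1 this).resolve_right (mul_ne_zero hD hX)
  have := (Polynomial.modByMonic_eq_zero_iff_dvd hF).1 hRz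
  simpa using map_dvd (MvPolynomial.finSuccEquiv ℂ (n + 1)).symm this

end MonicCoordinates

/-! ### Linear changes of coordinates -/

section LinearChange

namespace MvPolynomial

/-- Substitution of a linear map into a polynomial. -/
noncomputable def linSubst {n : ℕ} (L : (Fin n → ℂ) →ₗ[ℂ] (Fin n → ℂ)) :
    MvPolynomial (Fin n) ℂ →ₐ[ℂ] MvPolynomial (Fin n) ℂ :=
  aeval fun i => ∑ j, C (L (Pi.single j 1) i) * X j

theorem eval_linSubst {n : ℕ} (L : (Fin n → ℂ) →ₗ[ℂ] (Fin n → ℂ)) (x : Fin n → ℂ)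
    (f : MvPolynomial (Fin n) ℂ) : eval x (linSubst L f) = eval (L x) f := by
  induction f using MvPolynomial.induction_on with
  | C a => simp [linSubst]
  | add p q hp hq => simp [hp, hq]
  | mul_X p i hp =>
    rw [map_mul, map_mul, hp, map_mul, eval_X]
    congr 1
    conv_rhs => rw [LinearMap.pi_apply_eq_sum_univ L x]
    have hs : ∀ k : Fin n, (fun j => if k = j then (1 : ℂ) else 0) = Pi.single k 1 := fun k => by
      ext j; simp [Pi.single_apply, eq_comm]
    simp [linSubst, Finset.sum_apply, mul_comm, hs]

theorem IsHomogeneous.linSubst {n d : ℕ} {f : MvPolynomial (Fin n) ℂ} (hf : f.IsHomogeneous d)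
    (L : (Fin n → ℂ) →ₗ[ℂ] (Fin n → ℂ)) : (linSubst L f).IsHomogeneous d := by
  have := IsHomogeneous.aeval hf (fun i => ∑ j, C (L (Pi.single j 1) i) * X j) (n := 1) fun i =>
    IsHomogeneous.sum _ _ _ fun j _ => isHomogeneous_C_mul_X _ _
  simpa [MvPolynomial.linSubst] using this

theorem linSubst_linSubst_symm {n : ℕ} (L : (Fin n → ℂ) ≃ₗ[ℂ] (Fin n → ℂ))
    (f : MvPolynomial (Fin n) ℂ) :
    MvPolynomial.linSubst (L.symm : (Fin n → ℂ) →ₗ[ℂ] (Fin n → ℂ))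
      (MvPolynomial.linSubst (L : (Fin n → ℂ) →ₗ[ℂ] (Fin n → ℂ)) f) = f :=
  MvPolynomial.funext fun x => by simp [eval_linSubst]

/-- By homogeneity the coefficients of the lower powers of the first variable have positive degree
and vanish at 0, so f(1, 0, …, 0) is the coefficient of its `d`-th power. -/
theorem monic_finSuccEquiv {n d : ℕ} {f : MvPolynomial (Fin (n + 1)) ℂ} (hf : f.IsHomogeneous d)
    (h : eval (Fin.cons 1 0) f = 1) :
    (finSuccEquiv ℂ n f).Monic ∧ (finSuccEquiv ℂ n f).natDegree = d := by
  have hle : (finSuccEquiv ℂ n f).natDegree ≤ d := by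
    rw [natDegree_finSuccEquiv]
    exact (degreeOf_le_totalDegree f 0).trans hf.totalDegree_le
  have hcoeff : ∀ i j, i + j = d → ((finSuccEquiv ℂ n f).coeff i).IsHomogeneous j :=
    fun i j hij => hf.finSuccEquiv_coeff_isHomogeneous i j hij
  have hd : (finSuccEquiv ℂ n f).coeff d = 1 := by
    have h1 := hcoeff d 0 (add_zero d)
    rw [← totalDegree_zero_iff_isHomogeneous, totalDegree_eq_zero_iff_eq_C] at h1
    rw [h1, ← C_1]
    congr 1
    rw [eval_eq_eval_mv_eval', Polynomial.eval_map, Polynomial.eval₂_eq_sum_range' _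
      (Nat.lt_succ_of_le hle), Finset.sum_range_succ, Finset.sum_eq_zero, zero_add] at h
    · rw [h1] at h
      simpa using h
    · intro i hi
      rw [Finset.mem_range] at hi
      have h2 := (hcoeff i (d - i) (by omega)).eval_smul_eq 0 0
      rw [smul_zero, zero_pow (by omega), zero_mul] at h2
      rw [h2, zero_mul]
  have hm := Polynomial.monic_of_natDegree_le_of_coeff_eq_one d hle hd
  refine ⟨hm, hle.antisymm ?_⟩
  exact Polynomial.le_natDegree_of_ne_zero (by rw [hd]; exact one_ne_zero)

end MvPolynomial

end LinearChange

theorem IsSmoothEquation.eval_ne_zero_of_mul_self_dvd {n : ℕ} {f g : MvPolynomial (Fin (n + 1)) ℂ}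
    (hs : IsSmoothEquation f) (hg : g * g ∣ f) {x : Fin (n + 1) → ℂ} (hx : x ≠ 0) :
    MvPolynomial.eval x g ≠ 0 := by
  intro h0
  obtain ⟨h, rfl⟩ := hg
  obtain ⟨i, hi⟩ := hs x hx (by simp [h0])
  exact hi (by simp [h0])

theorem exists_linearEquiv_eval_eq_one {n d : ℕ} {f : MvPolynomial (Fin (n + 1)) ℂ}
    (hf : f.IsHomogeneous (d + 1)) (hs : IsSmoothEquation f) :
    ∃ L : (Fin (n + 1) → ℂ) ≃L[ℂ] (Fin (n + 1) → ℂ), MvPolynomial.eval (L (Fin.cons 1 0)) f = 1 := by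
  have hf0 : f ≠ 0 := by
    rintro rfl
    obtain ⟨i, hi⟩ := hs 1 one_ne_zero (map_zero _)
    exact hi (by simp)
  obtain ⟨p, hp⟩ : ∃ p, MvPolynomial.eval p f ≠ 0 := by
    by_contra! h
    exact hf0 (MvPolynomial.funext fun x => by simpa using h x)
  obtain ⟨c, hc⟩ := IsAlgClosed.exists_pow_nat_eq (MvPolynomial.eval p f)⁻¹ (Nat.succ_pos d)
  have hcp : MvPolynomial.eval (c • p) f = 1 := by
    rw [hf.eval_smul_eq, hc, inv_mul_cancel₀ hp]
  have hcp0 : c • p ≠ 0 := fun h => by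
    have := hf.eval_smul_eq 0 (c • p)
    rw [h, smul_zero, ← h, hcp, zero_pow (Nat.succ_ne_zero d), zero_mul] at this
    exact one_ne_zero this
  obtain ⟨L, hL⟩ := SeparatingDual.exists_continuousLinearEquiv_apply_eq (R := ℂ)
    (finCons_ne_zero_of_left (one_ne_zero (α := ℂ)) (0 : Fin n → ℂ)) hcp0
  exact ⟨L, by rw [hL, hcp]⟩

/-- Coordinates in which the equation of a smooth hypersurface is monic and generically
separable in the first variable. -/
theorem exists_separating_coordinates {n d : ℕ} {f : MvPolynomial (Fin (n + 2)) ℂ}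
    (hf : f.IsHomogeneous (d + 1)) (hs : IsSmoothEquation f) :
    ∃ (L : (Fin (n + 2) → ℂ) ≃L[ℂ] (Fin (n + 2) → ℂ))
      (F : Polynomial (MvPolynomial (Fin (n + 1)) ℂ)) (D : MvPolynomial (Fin (n + 1)) ℂ),
      (MvPolynomial.finSuccEquiv ℂ (n + 1)).symm F =
        MvPolynomial.linSubst ((L : (Fin (n + 2) → ℂ) ≃ₗ[ℂ] (Fin (n + 2) → ℂ)) :
          (Fin (n + 2) → ℂ) →ₗ[ℂ] (Fin (n + 2) → ℂ)) f ∧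
      F.Monic ∧ F.natDegree = d + 1 ∧ D ≠ 0 ∧
      ∀ y, MvPolynomial.eval y D ≠ 0 → (F.map (MvPolynomial.eval y)).Separable := by
  obtain ⟨L, hL⟩ := exists_linearEquiv_eval_eq_one hf hs
  set L' : (Fin (n + 2) → ℂ) ≃ₗ[ℂ] (Fin (n + 2) → ℂ) := L.toLinearEquiv with hL'
  set f' := MvPolynomial.linSubst (L' : (Fin (n + 2) → ℂ) →ₗ[ℂ] (Fin (n + 2) → ℂ)) f with hf'
  obtain ⟨hmon, hdeg⟩ := MvPolynomial.monic_finSuccEquiv (hf.linSubst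
    (L' : (Fin (n + 2) → ℂ) →ₗ[ℂ] (Fin (n + 2) → ℂ))) (by
      rw [MvPolynomial.eval_linSubst]; exact hL)
  -- A monic repeated factor of positive degree has a root over `y = 1`, giving a nonzero point
  -- where the square of a factor of f vanishes; this contradicts smoothness.
  obtain ⟨D, hD, hsep⟩ := Polynomial.exists_ne_zero_separable_map hmon fun q hq hqq => by
    by_contra hq0
    have hdeg' : (q.map (MvPolynomial.eval (1 : Fin (n + 1) → ℂ))).degree ≠ 0 := fun h => hq0 (by
      rw [← hq.natDegree_map (MvPolynomial.eval (1 : Fin (n + 1) → ℂ))]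
      exact Polynomial.natDegree_eq_zero_iff_degree_le_zero.2 h.le)
    obtain ⟨t, ht⟩ := IsAlgClosed.exists_root _ hdeg'
    rw [Polynomial.IsRoot.def, eval_map_eval_eq] at ht
    have hx : (Fin.cons t 1 : Fin (n + 2) → ℂ) ≠ 0 := finCons_ne_zero_of_right t one_ne_zero
    have h1 := map_dvd (MvPolynomial.finSuccEquiv ℂ (n + 1)).symm hqq
    rw [AlgEquiv.symm_apply_apply, map_mul] at h1
    have h2 := map_dvd (MvPolynomial.linSubst
      (L'.symm : (Fin (n + 2) → ℂ) →ₗ[ℂ] (Fin (n + 2) → ℂ))) h1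
    rw [MvPolynomial.linSubst_linSubst_symm, map_mul] at h2
    refine hs.eval_ne_zero_of_mul_self_dvd h2 (x := L' (Fin.cons t 1)) ?_ ?_
    · exact (LinearEquiv.map_ne_zero_iff L').2 hx
    · rw [MvPolynomial.eval_linSubst]
      simpa using ht
  exact ⟨L, _, D, AlgEquiv.symm_apply_apply _ _, hmon, hdeg, hD, fun y hy => hsep _ hy⟩

/-- A homogeneous function that is locally holomorphic along the punctured cone over a smooth
hypersurface is the restriction of a polynomial. -/
theorem exists_mvPolynomial_eq_on_zeros {n m e : ℕ} {f : MvPolynomial (Fin (n + 3)) ℂ}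
    (hf : f.IsHomogeneous (m + 1)) (hs : IsSmoothEquation f)
    {φ : (Fin (n + 3) → ℂ) → ℂ} (hφ : IsHolomorphicOnZeros f φ)
    (hφh : ∀ c : ℂ, c ≠ 0 → ∀ x, x ≠ 0 → MvPolynomial.eval x f = 0 →
        φ (c • x) = c ^ (e + m) * φ x) :
    ∃ P : MvPolynomial (Fin (n + 3)) ℂ, ∀ x, x ≠ 0 → MvPolynomial.eval x f = 0 →
        φ x = MvPolynomial.eval x P := by
  obtain ⟨L, F, D, hFf, hF, hdeg, hD, hsep⟩ := exists_separating_coordinates hf hs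
  have hev : ∀ x, MvPolynomial.eval x ((MvPolynomial.finSuccEquiv ℂ (n + 2)).symm F) =
      MvPolynomial.eval (L x) f := fun x => by
    rw [hFf, MvPolynomial.eval_linSubst]; rfl
  obtain ⟨P, hP⟩ := exists_mvPolynomial_eq_on_zeros_of_monic (φ := fun x => φ (L x)) (e := e) hF
    (by omega) (by rw [hFf]; exact hf.linSubst _) hD hsep
    (fun x hx hxF => by
      rw [hev] at hxF
      obtain ⟨Φ, hΦ, hΦφ⟩ := hφ (L x) ((map_ne_zero_iff L L.injective).2 hx) hxF
      refine ⟨fun x => Φ (L x), AnalyticAt.comp (f := L) hΦ ((L : (Fin (n + 3) → ℂ) →L[ℂ] (Fin (n + 3) → ℂ)).analyticAt x), ?_⟩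
      filter_upwards [L.continuous.continuousAt.eventually hΦφ] with z hz hzF
      exact hz (by rwa [← hev]))
    (fun c hc x hx hxF => by
      rw [hev] at hxF
      rw [map_smul, hφh c hc _ ((map_ne_zero_iff L L.injective).2 hx) hxF])
  refine ⟨MvPolynomial.linSubst ((L.symm : (Fin (n + 3) → ℂ) ≃ₗ[ℂ] (Fin (n + 3) → ℂ)) :
    (Fin (n + 3) → ℂ) →ₗ[ℂ] (Fin (n + 3) → ℂ)) P, fun x hx hxf => ?_⟩
  have := hP (L.symm x) ((map_ne_zero_iff L.symm L.symm.injective).2 hx) (by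
    rw [hev, L.apply_symm_apply, hxf])
  rw [L.apply_symm_apply] at this
  rw [this, MvPolynomial.eval_linSubst]
  rfl

/-- A polynomial vanishing on a smooth hypersurface is a multiple of its equation. -/
theorem dvd_of_eval_eq_zero_on_zeros {n d : ℕ} {f : MvPolynomial (Fin (n + 2)) ℂ}
    (hf : f.IsHomogeneous (d + 1)) (hs : IsSmoothEquation f) {Q : MvPolynomial (Fin (n + 2)) ℂ}
    (hQ : ∀ x, x ≠ 0 → MvPolynomial.eval x f = 0 → MvPolynomial.eval x Q = 0) : f ∣ Q := by
  obtain ⟨L, F, D, hFf, hF, hdeg, hD, hsep⟩ := exists_separating_coordinates hf hs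
  have hev : ∀ x, MvPolynomial.eval x ((MvPolynomial.finSuccEquiv ℂ (n + 1)).symm F) =
      MvPolynomial.eval (L x) f := fun x => by
    rw [hFf, MvPolynomial.eval_linSubst]; rfl
  have h1 := dvd_of_eval_eq_zero_on_zeros_of_monic hF hD hsep
    (Q := MvPolynomial.linSubst ((L : (Fin (n + 2) → ℂ) ≃ₗ[ℂ] (Fin (n + 2) → ℂ)) :
      (Fin (n + 2) → ℂ) →ₗ[ℂ] (Fin (n + 2) → ℂ)) Q) fun x hx hxF => by
    rw [MvPolynomial.eval_linSubst]
    rw [hev] at hxF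
    exact hQ _ ((map_ne_zero_iff L L.injective).2 hx) hxF
  rw [hFf] at h1
  have h2 := map_dvd (MvPolynomial.linSubst
    ((L : (Fin (n + 2) → ℂ) ≃ₗ[ℂ] (Fin (n + 2) → ℂ)).symm :
      (Fin (n + 2) → ℂ) →ₗ[ℂ] (Fin (n + 2) → ℂ))) h1
  rwa [MvPolynomial.linSubst_linSubst_symm, MvPolynomial.linSubst_linSubst_symm] at h2

/-! ### Homogeneous components -/

namespace MvPolynomial

theorem homogeneousComponent_mul_of_isHomogeneous {σ R : Type*} [CommSemiring R] {m : ℕ}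
    {g : MvPolynomial σ R} (hg : g.IsHomogeneous m) (n : ℕ) (p : MvPolynomial σ R) :
    homogeneousComponent (m + n) (g * p) = g * homogeneousComponent n p := by
  conv_lhs => rw [← sum_homogeneousComponent p, Finset.mul_sum, map_sum]
  have h : ∀ i, homogeneousComponent (m + n) (g * homogeneousComponent i p) =
      if i = n then g * homogeneousComponent n p else 0 := fun i => by
    rw [homogeneousComponent_of_mem (hg.mul (homogeneousComponent_isHomogeneous i p))]
    simp only [add_right_inj]
    split_ifs with h1 h2 h2 <;> first | rfl | (subst h1; rfl) | (exact absurd h1.symm h2) |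
      exact absurd h2.symm h1
  simp only [h, Finset.sum_ite_eq', Finset.mem_range]
  split_ifs with hn
  · rfl
  · rw [homogeneousComponent_eq_zero _ _ (by omega), mul_zero]

/-- Both sides of the hypothesis are polynomials in `c` that agree for all nonzero `c`; compare the
coefficients of `c ^ e`. -/
theorem eval_homogeneousComponent_of_eval_smul {n e : ℕ} (p : MvPolynomial (Fin n) ℂ)
    (x : Fin n → ℂ) (z : ℂ) (h : ∀ c : ℂ, c ≠ 0 → eval (c • x) p = c ^ e * z) :
    eval x (homogeneousComponent e p) = z := by
  have hs : ∀ c : ℂ, eval (c • x) p = ∑ j ∈ Finset.range (p.totalDegree + 1),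
      c ^ j * eval x (homogeneousComponent j p) := fun c => by
    conv_lhs => rw [← sum_homogeneousComponent p, map_sum]
    exact Finset.sum_congr rfl fun j _ =>
      (homogeneousComponent_isHomogeneous j p).eval_smul_eq c x
  set P : Polynomial ℂ := (∑ j ∈ Finset.range (p.totalDegree + 1),
    Polynomial.C (eval x (homogeneousComponent j p)) * Polynomial.X ^ j) -
      Polynomial.C z * Polynomial.X ^ e with hP
  have hP0 : Polynomial.X * P = 0 := Polynomial.funext fun c => by
    by_cases hc : c = 0
    · simp [hc]
    · rw [hP, Polynomial.eval_mul, Polynomial.eval_sub, Polynomial.eval_finsetSum]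
      simp only [Polynomial.eval_mul, Polynomial.eval_C, Polynomial.eval_pow, Polynomial.eval_X,
        Polynomial.eval_zero]
      have h1 := (hs c).symm.trans (h c hc)
      rw [Finset.sum_congr rfl fun j _ => mul_comm (eval x (homogeneousComponent j p)) (c ^ j), h1]
      ring
  have h1 := congrArg (fun P => P.coeff e)
    ((mul_eq_zero.1 hP0).resolve_left Polynomial.X_ne_zero)
  simp only [hP, Polynomial.coeff_sub, Polynomial.finsetSum_coeff, Polynomial.coeff_C_mul,
    Polynomial.coeff_X_pow, Polynomial.coeff_zero, mul_ite, mul_one, mul_zero,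
    Finset.sum_ite_eq, Finset.mem_range, if_true] at h1
  split_ifs at h1 with h2
  · exact sub_eq_zero.1 h1
  · rw [homogeneousComponent_eq_zero _ _ (by omega), map_zero]
    simpa [eq_comm] using h1

end MvPolynomial

/-! ### Tangent vectors of the cone and Koszul fields -/

section Cone

variable {n : ℕ} {f : MvPolynomial (Fin (n + 1)) ℂ}

theorem polyDiff_apply (f : MvPolynomial (Fin (n + 1)) ℂ) (x v : Fin (n + 1) → ℂ) :
    polyDiff f x v = ∑ i, MvPolynomial.eval x (MvPolynomial.pderiv i f) * v i := by
  simp [polyDiff, LinearMap.sum_apply]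

theorem mem_puncturedCone_span {x : Fin (n + 1) → ℂ} :
    x ∈ puncturedCone (Ideal.span {f}) ↔ x ≠ 0 ∧ MvPolynomial.eval x f = 0 := by
  refine and_congr_right fun _ => ⟨fun h => h f (Ideal.mem_span_singleton_self f), ?_⟩
  rintro h g hg
  obtain ⟨q, rfl⟩ := Ideal.mem_span_singleton.1 hg
  rw [map_mul, h, zero_mul]

theorem mem_coneTangent_span {x : Fin (n + 1) → ℂ} (hx : MvPolynomial.eval x f = 0)
    {v : Fin (n + 1) → ℂ} : v ∈ coneTangent (Ideal.span {f}) x ↔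
      ∑ i, MvPolynomial.eval x (MvPolynomial.pderiv i f) * v i = 0 := by
  simp only [coneTangent, Submodule.mem_iInf, LinearMap.mem_ker, polyDiff_apply]
  refine ⟨fun h => h f (Ideal.mem_span_singleton_self f), ?_⟩
  rintro h g hg
  obtain ⟨q, rfl⟩ := Ideal.mem_span_singleton.1 hg
  simp only [Derivation.leibniz, smul_eq_mul, map_add, map_mul, hx, zero_mul, zero_add]
  simp only [mul_assoc, ← Finset.mul_sum, h, mul_zero]

theorem mem_puncturedCone_bot {x : Fin (n + 1) → ℂ} :
    x ∈ puncturedCone (⊥ : Ideal (MvPolynomial (Fin (n + 1)) ℂ)) ↔ x ≠ 0 :=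
  and_iff_left fun g hg => by rw [Ideal.mem_bot.1 hg, map_zero]

theorem mem_coneTangent_bot (x v : Fin (n + 1) → ℂ) :
    v ∈ coneTangent (⊥ : Ideal (MvPolynomial (Fin (n + 1)) ℂ)) x := by
  simp only [coneTangent, Submodule.mem_iInf, LinearMap.mem_ker, polyDiff_apply]
  intro g hg
  simp [Ideal.mem_bot.1 hg]

/-- Euler's relation at a point. -/
theorem sum_eval_pderiv_mul_self {d : ℕ} (hf : f.IsHomogeneous d) (x : Fin (n + 1) → ℂ) :
    ∑ i, MvPolynomial.eval x (MvPolynomial.pderiv i f) * x i = d * MvPolynomial.eval x f := by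
  have := congrArg (MvPolynomial.eval x) hf.sum_X_mul_pderiv
  simp only [map_sum, map_mul, MvPolynomial.eval_X, nsmul_eq_mul, map_natCast] at this
  rw [← this]
  exact Finset.sum_congr rfl fun i _ => mul_comm _ _

/-- The value of a twisted form on a tangent vector of the cone, and `0` on other vectors. -/
noncomputable def TwistedOneForm.valueAt {I : Ideal (MvPolynomial (Fin (n + 1)) ℂ)} {k : ℕ}
    (ω : TwistedOneForm I k) (x v : Fin (n + 1) → ℂ) : ℂ :=
  open Classical in
  if h : x ∈ puncturedCone I ∧ v ∈ coneTangent I x then ω.toFun x h.1 ⟨v, h.2⟩ else 0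

namespace TwistedOneForm

variable {I : Ideal (MvPolynomial (Fin (n + 1)) ℂ)} {k : ℕ} (ω : TwistedOneForm I k)

theorem valueAt_eq {x v : Fin (n + 1) → ℂ} (hx : x ∈ puncturedCone I) (hv : v ∈ coneTangent I x) :
    ω.valueAt x v = ω.toFun x hx ⟨v, hv⟩ :=
  dif_pos ⟨hx, hv⟩

theorem valueAt_add {x u v : Fin (n + 1) → ℂ} (hx : x ∈ puncturedCone I)
    (hu : u ∈ coneTangent I x) (hv : v ∈ coneTangent I x) :
    ω.valueAt x (u + v) = ω.valueAt x u + ω.valueAt x v := by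
  rw [ω.valueAt_eq hx hu, ω.valueAt_eq hx hv, ω.valueAt_eq hx (Submodule.add_mem _ hu hv),
    ← map_add]
  rfl

theorem valueAt_smul {x v : Fin (n + 1) → ℂ} (c : ℂ) (hx : x ∈ puncturedCone I)
    (hv : v ∈ coneTangent I x) : ω.valueAt x (c • v) = c * ω.valueAt x v := by
  rw [ω.valueAt_eq hx hv, ω.valueAt_eq hx (Submodule.smul_mem _ c hv), ← smul_eq_mul, ← map_smul]
  rfl

theorem valueAt_sum {ι : Type*} (s : Finset ι) {x : Fin (n + 1) → ℂ} {v : ι → Fin (n + 1) → ℂ}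
    (hx : x ∈ puncturedCone I) (hv : ∀ i ∈ s, v i ∈ coneTangent I x) :
    ω.valueAt x (∑ i ∈ s, v i) = ∑ i ∈ s, ω.valueAt x (v i) := by
  classical
  induction s using Finset.induction_on with
  | empty => simpa using ω.valueAt_smul 0 hx (Submodule.zero_mem _)
  | insert i s hi ih =>
    rw [Finset.sum_insert hi, Finset.sum_insert hi,
      ω.valueAt_add hx (hv i (Finset.mem_insert_self i s))
        (Submodule.sum_mem _ fun j hj => hv j (Finset.mem_insert_of_mem hj)),
      ih fun j hj => hv j (Finset.mem_insert_of_mem hj)]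

end TwistedOneForm

/-- The tangent vector field `∂ᵢf ∂ⱼ - ∂ⱼf ∂ᵢ` of the hypersurface `f = 0`. -/
noncomputable def koszulField (f : MvPolynomial (Fin (n + 1)) ℂ) (i j : Fin (n + 1))
    (x : Fin (n + 1) → ℂ) : Fin (n + 1) → ℂ :=
  MvPolynomial.eval x (MvPolynomial.pderiv i f) • Pi.single j 1 -
    MvPolynomial.eval x (MvPolynomial.pderiv j f) • Pi.single i 1

theorem sum_mul_koszulField (a : Fin (n + 1) → ℂ) (f : MvPolynomial (Fin (n + 1)) ℂ)
    (i j : Fin (n + 1)) (x : Fin (n + 1) → ℂ) :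
    ∑ l, a l * koszulField f i j x l =
      MvPolynomial.eval x (MvPolynomial.pderiv i f) * a j -
        MvPolynomial.eval x (MvPolynomial.pderiv j f) * a i := by
  simp [koszulField, mul_sub, Finset.sum_sub_distrib, Pi.single_apply, mul_comm]

theorem koszulField_mem {x : Fin (n + 1) → ℂ} (hx : MvPolynomial.eval x f = 0)
    (i j : Fin (n + 1)) : koszulField f i j x ∈ coneTangent (Ideal.span {f}) x := by
  rw [mem_coneTangent_span hx, sum_mul_koszulField]
  ring

/-- Where ∂ᵢf ≠ 0 the fields with first index `i` span the tangent space, so their values determine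
a form there. -/
theorem smul_eq_sum_koszulField {x v : Fin (n + 1) → ℂ} (i : Fin (n + 1))
    (hv : ∑ i, MvPolynomial.eval x (MvPolynomial.pderiv i f) * v i = 0) :
    MvPolynomial.eval x (MvPolynomial.pderiv i f) • v = ∑ j, v j • koszulField f i j x := by
  have h1 : ∑ j, v j • (MvPolynomial.eval x (MvPolynomial.pderiv j f) •
      (Pi.single i 1 : Fin (n + 1) → ℂ)) = 0 := by
    simp only [smul_smul, ← Finset.sum_smul]
    rw [Finset.sum_congr rfl fun j _ => mul_comm (v j) _, hv, zero_smul]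
  have h2 : ∑ j, v j • (Pi.single j 1 : Fin (n + 1) → ℂ) = v := by
    simpa [Pi.single_apply, ← Pi.single_smul] using Finset.univ_sum_single v
  simp only [koszulField, smul_sub, Finset.sum_sub_distrib, h1, sub_zero]
  conv_lhs => rw [← h2]
  rw [Finset.smul_sum]
  exact Finset.sum_congr rfl fun j _ => smul_comm _ _ _

end Cone

/-! ### Lifting twisted forms to polynomial forms -/

section Extension

variable {n m e : ℕ}

theorem koszulField_smul {n m : ℕ} {f : MvPolynomial (Fin (n + 1)) ℂ} (hf : f.IsHomogeneous (m + 1))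
    (i j : Fin (n + 1)) (c : ℂ) (x : Fin (n + 1) → ℂ) :
    koszulField f i j (c • x) = c ^ m • koszulField f i j x := by
  have hw : ∀ i, (MvPolynomial.pderiv i f).IsHomogeneous m := fun i => hf.pderiv
  simp only [koszulField, (hw _).eval_smul_eq, smul_sub, smul_smul]

theorem smul_mem_puncturedCone {n m : ℕ} {f : MvPolynomial (Fin (n + 1)) ℂ}
    (hf : f.IsHomogeneous m) {c : ℂ} (hc : c ≠ 0) {x : Fin (n + 1) → ℂ}
    (hx : x ∈ puncturedCone (Ideal.span {f})) : c • x ∈ puncturedCone (Ideal.span {f}) := by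
  rw [mem_puncturedCone_span] at hx ⊢
  exact ⟨smul_ne_zero hc hx.1, by rw [hf.eval_smul_eq, hx.2, mul_zero]⟩

theorem coneTangent_smul {n m : ℕ} {f : MvPolynomial (Fin (n + 1)) ℂ}
    (hf : f.IsHomogeneous (m + 1)) (c : ℂ) {x : Fin (n + 1) → ℂ}
    (hx : MvPolynomial.eval x f = 0) {v : Fin (n + 1) → ℂ}
    (hv : v ∈ coneTangent (Ideal.span {f}) x) : v ∈ coneTangent (Ideal.span {f}) (c • x) := by
  have hw : ∀ i, (MvPolynomial.pderiv i f).IsHomogeneous m := fun i => hf.pderiv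
  rw [mem_coneTangent_span hx] at hv
  rw [mem_coneTangent_span (by rw [hf.eval_smul_eq, hx, mul_zero])]
  simp only [(hw _).eval_smul_eq, mul_assoc, ← Finset.mul_sum, hv, mul_zero]

theorem TwistedOneForm.valueAt_smul_point {f : MvPolynomial (Fin (n + 1)) ℂ}
    (hf : f.IsHomogeneous (m + 1)) (ω : TwistedOneForm (Ideal.span {f}) (e + 1)) {c : ℂ}
    (hc : c ≠ 0) {x v : Fin (n + 1) → ℂ} (hx : x ∈ puncturedCone (Ideal.span {f}))
    (hv : v ∈ coneTangent (Ideal.span {f}) x) :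
    ω.valueAt (c • x) v = c ^ e * ω.valueAt x v := by
  have hx0 := (mem_puncturedCone_span.1 hx).2
  have hcx := smul_mem_puncturedCone hf hc hx
  have hcv := coneTangent_smul hf c hx0 hv
  have h := ω.homogeneous c hc x hx hcx v hv (Submodule.smul_mem _ c hcv)
  rw [← ω.valueAt_eq, ← ω.valueAt_eq, ω.valueAt_smul c hcx hcv] at h
  apply mul_left_cancel₀ hc
  rw [h]
  ring

/-- On a fixed vector the form has weight `e`, and the Koszul field adds `m`. The total is the
weight `e + m` that the trace argument asks for. -/
theorem exists_mvPolynomial_valueAt_koszulField {f : MvPolynomial (Fin (n + 2 + 1)) ℂ}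
    (hf : f.IsHomogeneous (m + 1)) (hs : IsSmoothEquation f)
    (ω : TwistedOneForm (Ideal.span {f}) (e + 1)) (i j : Fin (n + 2 + 1)) :
    ∃ P : MvPolynomial (Fin (n + 2 + 1)) ℂ, ∀ x ∈ puncturedCone (Ideal.span {f}),
      ω.valueAt x (koszulField f i j x) = MvPolynomial.eval x P := by
  have key : ∃ P : MvPolynomial (Fin (n + 2 + 1)) ℂ, ∀ x, x ≠ 0 → MvPolynomial.eval x f = 0 →
      ω.valueAt x (koszulField f i j x) = MvPolynomial.eval x P := by
    refine exists_mvPolynomial_eq_on_zeros (n := n) (e := e) hf hs ?_ ?_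
    · intro x hx hxf
      obtain ⟨A, hA, hAω⟩ := ω.holomorphic x (mem_puncturedCone_span.2 ⟨hx, hxf⟩)
      have hV : AnalyticAt ℂ (koszulField f i j) x :=
        ((analyticAt_mvPolynomial_eval _ x).smul analyticAt_const).sub
          ((analyticAt_mvPolynomial_eval _ x).smul analyticAt_const)
      refine ⟨fun y => A y (koszulField f i j y), ?_, ?_⟩
      · exact ((ContinuousLinearMap.id ℂ ((Fin (n + 2 + 1) → ℂ) →L[ℂ] ℂ)).analyticAt_bilinear
          _).comp₂ hA hV
      · filter_upwards [hAω, isOpen_ne.mem_nhds hx] with y hy hy0 hyf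
        have hyc := mem_puncturedCone_span.2 ⟨hy0, hyf⟩
        have hyv := koszulField_mem hyf i j
        rw [ω.valueAt_eq hyc hyv]
        exact hy hyc _ hyv
    · intro c hc x hx hxf
      have hxc := mem_puncturedCone_span.2 ⟨hx, hxf⟩
      have hv := koszulField_mem hxf i j
      rw [koszulField_smul hf, ω.valueAt_smul _ (smul_mem_puncturedCone hf hc hxc)
        (coneTangent_smul hf c hxf hv), ω.valueAt_smul_point hf hc hxc hv]
      ring
  obtain ⟨P, hP⟩ := key
  exact ⟨P, fun x hx => hP x (mem_puncturedCone_span.1 hx).1 (mem_puncturedCone_span.1 hx).2⟩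

/-- The values P on Koszul fields satisfy df ∧ P ≡ 0 on the cone, because the fields satisfy the
Koszul relation. So df ∧ P = f Q with df ∧ Q = 0, whence Q = df ∧ M. Then df ∧ (P − f M) = 0 gives P
− f M = df ∧ a, and on the cone a has the prescribed values. Division in degree three needs at least
four variables. -/
theorem exists_mvPolynomial_form {f : MvPolynomial (Fin (n + 3 + 1)) ℂ}
    (hf : f.IsHomogeneous (m + 1)) (hs : IsSmoothEquation f)
    (ω : TwistedOneForm (Ideal.span {f}) (e + 1)) :
    ∃ a : Fin (n + 3 + 1) → MvPolynomial (Fin (n + 3 + 1)) ℂ,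
      ∀ x ∈ puncturedCone (Ideal.span {f}), ∀ v ∈ coneTangent (Ideal.span {f}) x,
        ω.valueAt x v = ∑ i, MvPolynomial.eval x (a i) * v i := by
  have hf0 : f ≠ 0 := by
    rintro rfl
    obtain ⟨i, hi⟩ := hs 1 one_ne_zero (map_zero _)
    exact hi (by simp)
  have hrad := X_mem_radical_span_pderiv (Nat.succ_ne_zero m) hf hs
  choose P hP using exists_mvPolynomial_valueAt_koszulField hf hs ω
  set w := fun i => MvPolynomial.pderiv i f with hw
  have hdvd : ∀ i j k, f ∣ w i * P j k - (w j * P i k - w k * P i j) := fun i j k => by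
    refine dvd_of_eval_eq_zero_on_zeros hf hs fun x hx hxf => ?_
    have hxc := mem_puncturedCone_span.2 ⟨hx, hxf⟩
    have hv := koszulField_mem hxf
    simp only [map_sub, map_mul, ← hP _ _ x hxc]
    rw [← ω.valueAt_smul _ hxc (hv j k), ← ω.valueAt_smul _ hxc (hv i k),
      ← ω.valueAt_smul _ hxc (hv i j)]
    have h1 : MvPolynomial.eval x (w j) • koszulField f i k x =
        MvPolynomial.eval x (w i) • koszulField f j k x +
          MvPolynomial.eval x (w k) • koszulField f i j x := by
      simp only [koszulField, hw, smul_sub, smul_smul]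
      rw [mul_comm (MvPolynomial.eval x (MvPolynomial.pderiv j f))
        (MvPolynomial.eval x (MvPolynomial.pderiv i f)),
        mul_comm (MvPolynomial.eval x (MvPolynomial.pderiv k f))
        (MvPolynomial.eval x (MvPolynomial.pderiv i f)),
        mul_comm (MvPolynomial.eval x (MvPolynomial.pderiv k f))
        (MvPolynomial.eval x (MvPolynomial.pderiv j f))]
      abel
    rw [h1, ω.valueAt_add hxc (Submodule.smul_mem _ _ (hv j k)) (Submodule.smul_mem _ _ (hv i j))]
    ring
  choose Q hQ using hdvd
  have hdQ : ∀ i j k l, w i * Q j k l -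
      (w j * Q i k l - (w k * Q i j l - w l * Q i j k)) = 0 := fun i j k l => by
    apply mul_left_cancel₀ hf0
    linear_combination -w i * hQ j k l + w j * hQ i k l - w k * hQ i j l + w l * hQ i j k
  obtain ⟨M, hM⟩ := MvPolynomial.exists_eq_wedge_of_wedge_eq_zero₃ hrad (by omega) hdQ
  obtain ⟨a, ha⟩ := MvPolynomial.exists_eq_wedge_of_wedge_eq_zero hrad (by omega)
    (P := fun i j => P i j - f * M i j) fun i j k => by
      linear_combination hQ i j k + f * hM i j k
  refine ⟨a, fun x hx v hv => ?_⟩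
  obtain ⟨hx0, hxf⟩ := mem_puncturedCone_span.1 hx
  obtain ⟨i, hi⟩ := hs x hx0 hxf
  have hv' := (mem_coneTangent_span hxf).1 hv
  apply mul_left_cancel₀ hi
  rw [← ω.valueAt_smul _ hx hv, smul_eq_sum_koszulField i hv', ω.valueAt_sum _ hx fun j _ =>
    Submodule.smul_mem _ _ (koszulField_mem hxf i j)]
  have hPa : ∀ j, ω.valueAt x (koszulField f i j x) =
      MvPolynomial.eval x (w i) * MvPolynomial.eval x (a j) -
        MvPolynomial.eval x (w j) * MvPolynomial.eval x (a i) := fun j => by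
    have := congrArg (MvPolynomial.eval x) (ha i j)
    simpa [hxf, hP i j x hx] using this
  have hsum : ∑ j, v j * (MvPolynomial.eval x (w j) * MvPolynomial.eval x (a i)) = 0 := by
    calc _ = (∑ j, MvPolynomial.eval x (w j) * v j) * MvPolynomial.eval x (a i) := by
          rw [Finset.sum_mul]; exact Finset.sum_congr rfl fun j _ => by ring
      _ = 0 := by rw [hv', zero_mul]
  simp only [ω.valueAt_smul _ hx (koszulField_mem hxf _ _), hPa, mul_sub,
    Finset.sum_sub_distrib, hsum, sub_zero, Finset.mul_sum]
  exact Finset.sum_congr rfl fun j _ => by ring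

/-- Twisted one-forms on a smooth hypersurface of dimension at least two lift to homogeneous
polynomial one-forms that annihilate the radial vector field. -/
theorem exists_homogeneous_form {f : MvPolynomial (Fin (n + 3 + 1)) ℂ}
    (hf : f.IsHomogeneous (m + 1)) (hs : IsSmoothEquation f)
    (ω : TwistedOneForm (Ideal.span {f}) (e + 1)) :
    ∃ a : Fin (n + 3 + 1) → MvPolynomial (Fin (n + 3 + 1)) ℂ,
      (∀ i, (a i).IsHomogeneous e) ∧ ∑ i, MvPolynomial.X i * a i = 0 ∧
      ∀ x ∈ puncturedCone (Ideal.span {f}), ∀ v ∈ coneTangent (Ideal.span {f}) x,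
        ω.valueAt x v = ∑ i, MvPolynomial.eval x (a i) * v i := by
  obtain ⟨a, ha⟩ := exists_mvPolynomial_form hf hs ω
  have hx_mem : ∀ x ∈ puncturedCone (Ideal.span {f}), x ∈ coneTangent (Ideal.span {f}) x :=
    fun x hx => by
      have hxf := (mem_puncturedCone_span.1 hx).2
      rw [mem_coneTangent_span hxf, sum_eval_pderiv_mul_self hf, hxf, mul_zero]
  obtain ⟨q, hq⟩ : f ∣ ∑ i, MvPolynomial.X i * a i :=
    dvd_of_eval_eq_zero_on_zeros hf hs fun x hx hxf => by
      have hxc := mem_puncturedCone_span.2 ⟨hx, hxf⟩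
      have h1 := ha x hxc x (hx_mem x hxc)
      rw [ω.valueAt_eq hxc (hx_mem x hxc), ω.radial x hxc (hx_mem x hxc)] at h1
      simp only [map_sum, map_mul, MvPolynomial.eval_X]
      rw [h1]
      exact Finset.sum_congr rfl fun i _ => mul_comm _ _
  -- The contraction of `a` with the Euler field is f q, and that of df is (m + 1) f; the correction
  -- cancels it without changing the restriction to the cone.
  set b := fun i => a i - MvPolynomial.C ((m : ℂ) + 1)⁻¹ * q * MvPolynomial.pderiv i f with hb
  have hm1 : ((m : ℂ) + 1) ≠ 0 := by exact_mod_cast Nat.succ_ne_zero m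
  have hb0 : ∑ i, MvPolynomial.X i * b i = 0 := by
    have h1 : ∑ i, MvPolynomial.X i * b i = ∑ i, MvPolynomial.X i * a i -
        MvPolynomial.C ((m : ℂ) + 1)⁻¹ * q * ∑ i, MvPolynomial.X i * MvPolynomial.pderiv i f := by
      rw [Finset.mul_sum, ← Finset.sum_sub_distrib]
      exact Finset.sum_congr rfl fun i _ => by rw [hb]; ring
    have h2 : ((m + 1 : ℕ) : MvPolynomial (Fin (n + 3 + 1)) ℂ) = MvPolynomial.C ((m : ℂ) + 1) := by
      simp
    have h3 : (MvPolynomial.C ((m : ℂ) + 1)⁻¹ : MvPolynomial (Fin (n + 3 + 1)) ℂ) *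
        MvPolynomial.C ((m : ℂ) + 1) = 1 := by
      rw [← MvPolynomial.C_mul, inv_mul_cancel₀ hm1, MvPolynomial.C_1]
    rw [h1, hf.sum_X_mul_pderiv, hq, nsmul_eq_mul, h2]
    linear_combination -(q * f) * h3
  have hbω : ∀ x ∈ puncturedCone (Ideal.span {f}), ∀ v ∈ coneTangent (Ideal.span {f}) x,
      ω.valueAt x v = ∑ i, MvPolynomial.eval x (b i) * v i := fun x hx v hv => by
    have hv' := (mem_coneTangent_span (mem_puncturedCone_span.1 hx).2).1 hv
    rw [ha x hx v hv]
    simp only [hb, map_sub, map_mul, sub_mul, Finset.sum_sub_distrib]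
    simp only [mul_assoc, ← Finset.mul_sum, hv', mul_zero, sub_zero]
  refine ⟨fun i => MvPolynomial.homogeneousComponent e (b i),
    fun i => MvPolynomial.homogeneousComponent_isHomogeneous e _, ?_, fun x hx v hv => ?_⟩
  · have h1 := congrArg (MvPolynomial.homogeneousComponent (1 + e)) hb0
    rw [map_sum, map_zero] at h1
    rw [← h1]
    exact Finset.sum_congr rfl fun i _ =>
      (MvPolynomial.homogeneousComponent_mul_of_isHomogeneous (MvPolynomial.isHomogeneous_X _ i)
        e (b i)).symm
  · have h1 := MvPolynomial.eval_homogeneousComponent_of_eval_smul (e := e)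
      (∑ i, MvPolynomial.C (v i) * b i) x (ω.valueAt x v) fun c hc => by
        rw [← ω.valueAt_smul_point hf hc hx hv, hbω _ (smul_mem_puncturedCone hf hc hx) v
          (coneTangent_smul hf c (mem_puncturedCone_span.1 hx).2 hv)]
        simp only [map_sum, map_mul, MvPolynomial.eval_C]
        exact Finset.sum_congr rfl fun i _ => mul_comm _ _
    rw [← h1]
    simp only [map_sum, MvPolynomial.homogeneousComponent_C_mul, map_mul, MvPolynomial.eval_C]
    exact Finset.sum_congr rfl fun i _ => mul_comm _ _

end Extension

/-! ### Forms on projective space and uniqueness of the extension -/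

namespace MvPolynomial

theorem homogeneousComponent_mul_eq_zero {σ R : Type*} [CommSemiring R] {m n : ℕ}
    {g : MvPolynomial σ R} (hg : g.IsHomogeneous m) (hn : n < m) (p : MvPolynomial σ R) :
    homogeneousComponent n (g * p) = 0 := by
  rw [← sum_homogeneousComponent p, Finset.mul_sum, map_sum]
  refine Finset.sum_eq_zero fun i _ => ?_
  rw [homogeneousComponent_of_mem (hg.mul (homogeneousComponent_isHomogeneous i p)),
    if_neg (by omega)]

end MvPolynomial

/-- The twisted one-form on projective space with polynomial coefficients `a`. -/
noncomputable def polyTwistedForm {n e : ℕ} (a : Fin (n + 1) → MvPolynomial (Fin (n + 1)) ℂ)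
    (ha : ∀ i, (a i).IsHomogeneous e) (hrad : ∑ i, MvPolynomial.X i * a i = 0) :
    TwistedOneForm (⊥ : Ideal (MvPolynomial (Fin (n + 1)) ℂ)) (e + 1) where
  toFun x _ := (∑ i, MvPolynomial.eval x (a i) • LinearMap.proj i) ∘ₗ
    (coneTangent (⊥ : Ideal (MvPolynomial (Fin (n + 1)) ℂ)) x).subtype
  holomorphic x _ := by
    refine ⟨fun y => ∑ i, MvPolynomial.eval y (a i) •
      ContinuousLinearMap.proj (R := ℂ) (φ := fun _ : Fin (n + 1) => ℂ) i, ?_, ?_⟩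
    · exact Finset.analyticAt_fun_sum _ fun i _ =>
        (analyticAt_mvPolynomial_eval _ x).smul analyticAt_const
    · refine Filter.Eventually.of_forall fun y _ v _ => ?_
      simp
  homogeneous c _ x _ _ v _ _ := by
    simp only [LinearMap.comp_apply, Submodule.subtype_apply, LinearMap.sum_apply,
      LinearMap.smul_apply, LinearMap.proj_apply, (ha _).eval_smul_eq, Finset.mul_sum,
      Pi.smul_apply, smul_eq_mul]
    exact Finset.sum_congr rfl fun i _ => by ring
  radial x _ _ := by
    have := congrArg (MvPolynomial.eval x) hrad
    simp only [map_sum, map_mul, MvPolynomial.eval_X, map_zero] at this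
    simp only [LinearMap.comp_apply, Submodule.subtype_apply, LinearMap.sum_apply,
      LinearMap.smul_apply, LinearMap.proj_apply, smul_eq_mul]
    rw [← this]
    exact Finset.sum_congr rfl fun i _ => mul_comm _ _

theorem polyTwistedForm_toFun {n e : ℕ} (a : Fin (n + 1) → MvPolynomial (Fin (n + 1)) ℂ)
    (ha : ∀ i, (a i).IsHomogeneous e) (hrad : ∑ i, MvPolynomial.X i * a i = 0)
    {x : Fin (n + 1) → ℂ} (hx : x ∈ puncturedCone ⊥) (v : Fin (n + 1) → ℂ)
    (hv : v ∈ coneTangent ⊥ x) :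
    (polyTwistedForm a ha hrad).toFun x hx ⟨v, hv⟩ = ∑ i, MvPolynomial.eval x (a i) * v i := by
  simp [polyTwistedForm]

theorem TwistedOneForm.ext_toFun {n k : ℕ} {I : Ideal (MvPolynomial (Fin (n + 1)) ℂ)}
    {ω ω' : TwistedOneForm I k} (h : ∀ x (hx : x ∈ puncturedCone I) v (hv : v ∈ coneTangent I x),
      ω.toFun x hx ⟨v, hv⟩ = ω'.toFun x hx ⟨v, hv⟩) : ω = ω' := by
  obtain ⟨t, _, _, _⟩ := ω
  obtain ⟨t', _, _, _⟩ := ω'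
  have : t = t' := funext fun x => funext fun hx => LinearMap.ext fun v => h x hx v.1 v.2
  subst this
  rfl

/-- Twisted one-forms on projective space are polynomial. -/
theorem exists_eq_polyTwistedForm {n e : ℕ}
    (ω : TwistedOneForm (⊥ : Ideal (MvPolynomial (Fin (n + 1 + 1)) ℂ)) (e + 1)) :
    ∃ a ha hrad, ω = polyTwistedForm (e := e) a ha hrad := by
  have hcone : ∀ {x : Fin (n + 1 + 1) → ℂ}, x ≠ 0 → x ∈ puncturedCone ⊥ :=
    fun hx => mem_puncturedCone_bot.2 hx
  have hhom : ∀ c : ℂ, c ≠ 0 → ∀ x, x ≠ 0 → ∀ v,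
      ω.valueAt (c • x) v = c ^ e * ω.valueAt x v := fun c hc x hx v => by
    have h := ω.homogeneous c hc x (hcone hx) (hcone (smul_ne_zero hc hx)) v
      (mem_coneTangent_bot _ _) (mem_coneTangent_bot _ _)
    rw [← ω.valueAt_eq, ← ω.valueAt_eq, ω.valueAt_smul c (hcone (smul_ne_zero hc hx))
      (mem_coneTangent_bot _ _)] at h
    apply mul_left_cancel₀ hc
    rw [h]
    ring
  have hpoly : ∀ i, ∃ P : MvPolynomial (Fin (n + 2)) ℂ, ∀ x, x ≠ 0 →
      ω.valueAt x (Pi.single i 1) = MvPolynomial.eval x P := fun i => by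
    refine exists_mvPolynomial_of_homogeneous e (fun x hx => ?_) fun c hc x hx => hhom c hc x hx _
    obtain ⟨A, hA, hAω⟩ := ω.holomorphic x (hcone hx)
    refine (hA.differentiableAt.clm_apply
      (differentiableAt_const (Pi.single i (1 : ℂ)))).congr_of_eventuallyEq ?_
    filter_upwards [hAω, isOpen_ne.mem_nhds hx] with y hy hy0
    rw [ω.valueAt_eq (hcone hy0) (mem_coneTangent_bot _ _)]
    exact (hy (hcone hy0) _ (mem_coneTangent_bot _ _)).symm
  choose P hP using hpoly
  have hcomp : ∀ i, ∀ x, x ≠ 0 → ω.valueAt x (Pi.single i 1) =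
      MvPolynomial.eval x (MvPolynomial.homogeneousComponent e (P i)) := fun i x hx =>
    (MvPolynomial.eval_homogeneousComponent_of_eval_smul (P i) x _ fun c hc => by
      rw [← hP i _ (smul_ne_zero hc hx), hhom c hc x hx]).symm
  have hval : ∀ x, x ≠ 0 → ∀ v, ω.valueAt x v =
      ∑ i, MvPolynomial.eval x (MvPolynomial.homogeneousComponent e (P i)) * v i := by
    intro x hx v
    have h2 : ∑ j, v j • (Pi.single j 1 : Fin (n + 2) → ℂ) = v := by
      simpa [Pi.single_apply, ← Pi.single_smul] using Finset.univ_sum_single v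
    conv_lhs => rw [← h2]
    rw [ω.valueAt_sum _ (hcone hx) fun _ _ => mem_coneTangent_bot _ _]
    refine Finset.sum_congr rfl fun i _ => ?_
    rw [ω.valueAt_smul _ (hcone hx) (mem_coneTangent_bot _ _), hcomp i x hx, mul_comm]
  refine ⟨fun i => MvPolynomial.homogeneousComponent e (P i),
    fun i => MvPolynomial.homogeneousComponent_isHomogeneous e _, ?_, ?_⟩
  · refine MvPolynomial.funext fun x => ?_
    by_cases hx : x = 0
    · simp [hx]
    have h := hval x hx x
    rw [ω.valueAt_eq (hcone hx) (mem_coneTangent_bot _ _), ω.radial] at h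
    simp only [map_sum, map_mul, MvPolynomial.eval_X, map_zero]
    rw [h]
    exact Finset.sum_congr rfl fun i _ => mul_comm _ _
  · refine TwistedOneForm.ext_toFun fun x hx v hv => ?_
    rw [polyTwistedForm_toFun, ← hval x (mem_puncturedCone_bot.1 hx), ω.valueAt_eq]

theorem IsSmoothEquation.ne_zero {n : ℕ} {f : MvPolynomial (Fin (n + 1)) ℂ}
    (hs : IsSmoothEquation f) : f ≠ 0 := by
  rintro rfl
  obtain ⟨i, hi⟩ := hs 1 one_ne_zero (map_zero _)
  exact hi (by simp)

/-- A radial polynomial one-form of the degree of the differential of `f` that vanishes on the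
hypersurface `f = 0` is zero. -/
theorem eq_zero_of_restrict_eq_zero {n m : ℕ} {f : MvPolynomial (Fin (n + 2 + 1)) ℂ}
    (hf : f.IsHomogeneous (m + 1)) (hs : IsSmoothEquation f)
    {g : Fin (n + 2 + 1) → MvPolynomial (Fin (n + 2 + 1)) ℂ}
    (hg : ∀ i, (g i).IsHomogeneous m) (hrad : ∑ i, MvPolynomial.X i * g i = 0)
    (h : ∀ x ∈ puncturedCone (Ideal.span {f}), ∀ v ∈ coneTangent (Ideal.span {f}) x,
      ∑ i, MvPolynomial.eval x (g i) * v i = 0) (i : Fin (n + 2 + 1)) : g i = 0 := by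
  have hf0 := hs.ne_zero
  have hr := X_mem_radical_span_pderiv (Nat.succ_ne_zero m) hf hs
  set w := fun i => MvPolynomial.pderiv i f with hw
  have hwh : ∀ i, (w i).IsHomogeneous m := fun i => hf.pderiv
  have hdvd : ∀ i j, f ∣ w i * g j - w j * g i := fun i j =>
    dvd_of_eval_eq_zero_on_zeros hf hs fun x hx hxf => by
      have := h x (mem_puncturedCone_span.2 ⟨hx, hxf⟩) _ (koszulField_mem hxf i j)
      rw [sum_mul_koszulField (fun i => MvPolynomial.eval x (g i))] at this
      simpa [hw] using this
  choose Q hQ using hdvd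
  obtain ⟨l, hl⟩ := MvPolynomial.exists_eq_wedge_of_wedge_eq_zero hr (by omega) (P := Q)
    fun i j k => by
      apply mul_left_cancel₀ hf0
      linear_combination -w i * hQ j k + w j * hQ i k - w k * hQ i j
  obtain ⟨q, hq⟩ := MvPolynomial.exists_eq_smul_of_wedge_eq_zero hr (by omega)
    (g := fun i => g i - f * l i) fun i j => by
      linear_combination hQ i j + f * hl i j
  -- In g = f l + q df the term f l has no part in degree m < deg f, so only the constant term of q
  -- survives.
  have hgq : ∀ i, g i = w i * MvPolynomial.homogeneousComponent 0 q := fun i => by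
    have h1 : g i = f * l i + w i * q := by linear_combination hq i
    rw [← MvPolynomial.homogeneousComponent_mul_of_isHomogeneous (hwh i) 0 q, add_zero,
      ← zero_add (MvPolynomial.homogeneousComponent m (w i * q)),
      ← MvPolynomial.homogeneousComponent_mul_eq_zero hf (Nat.lt_succ_self m) (l i), ← map_add,
      ← h1, MvPolynomial.homogeneousComponent_eq_self (hg i)]
  -- Contraction with the Euler field gives 0 on g and (m + 1) f on df, so the constant is zero.
  have h2 : (m + 1) • f * MvPolynomial.homogeneousComponent 0 q = 0 := by
    rw [← hf.sum_X_mul_pderiv, ← hrad, Finset.sum_mul]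
    exact Finset.sum_congr rfl fun i _ => by rw [hgq i]; ring
  have h3 : (m + 1) • f ≠ 0 := smul_ne_zero (Nat.succ_ne_zero m) hf0
  rw [hgq i, (mul_eq_zero.1 h2).resolve_left h3, mul_zero]

/-! ### Pfaffians of the exterior derivative -/

section Pfaffian

variable {R : Type*} [CommRing R]

/-- The `4 × 4` Pfaffian of the antisymmetric matrix `(dᵢⱼ - dⱼᵢ)`. -/
def pfaff {ι : Type*} (d : ι → ι → R) (i j k l : ι) : R :=
  (d i j - d j i) * (d k l - d l k) - (d i k - d k i) * (d j l - d l j) +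
    (d i l - d l i) * (d j k - d k j)

/-- This is a row expansion of a 6 × 6 Pfaffian. With only five index values two of the six indices
coincide, so it vanishes: a 2-form in five variables has zero cube. -/
theorem pfaff_expansion_eq_zero (d : Fin 5 → Fin 5 → R) (n i j k l m : Fin 5) :
    (d n i - d i n) * pfaff d j k l m - (d n j - d j n) * pfaff d i k l m +
      (d n k - d k n) * pfaff d i j l m - (d n l - d l n) * pfaff d i j k m +
        (d n m - d m n) * pfaff d i j k l = 0 := by
  have h : ¬ [n, i, j, k, l, m].Nodup := fun h => by
    simpa using h.length_le_card
  simp only [List.nodup_cons, List.mem_cons, List.not_mem_nil, List.nodup_nil, not_or, not_and_or,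
    not_not, or_false, not_false_eq_true, and_true] at h
  simp only [pfaff]
  rcases h with (h | h | h | h | h) | (h | h | h | h) | (h | h | h) | (h | h) | h <;> subst h <;>
    ring

/-- If `θ = d - dᵀ` satisfies `θₙ ∧ β = 0` for all its rows `θₙ` and some `3`-form `β ≠ 0`, then
`θ ∧ θ = 0`. -/
theorem pfaff_eq_zero_of_wedge_eq_zero [IsDomain R] {ι : Type*} {d : ι → ι → R}
    {β : ι → ι → ι → R} (h : ∀ n i j k l, (d n i - d i n) * β j k l -
      ((d n j - d j n) * β i k l - ((d n k - d k n) * β i j l - (d n l - d l n) * β i j k)) = 0)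
    {a b c : ι} (hβ : β a b c ≠ 0) (i j k l : ι) : pfaff d i j k l = 0 := by
  -- Using the relation in both indices writes θ as a 2-form in the three covectors β_{·bc},
  -- β_{·ac}, β_{·ab}, with coefficients θ_{ab}, θ_{ac}, θ_{bc}. A 2-form in three covectors has
  -- square zero.
  have h1 : ∀ i j, β a b c ^ 2 * (d i j - d j i) =
      (d a b - d b a) * (β i b c * -β j a c - -β i a c * β j b c) +
        (d a c - d c a) * (β i b c * β j a b - β i a b * β j b c) +
          (d b c - d c b) * (-β i a c * β j a b - β i a b * -β j a c) := by
    intro i j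
    linear_combination β a b c * h i j a b c - β j b c * h a i a b c + β j a c * h b i a b c -
      β j a b * h c i a b c
  have h2 : β a b c ^ 4 * pfaff d i j k l = 0 := by
    have h3 : β a b c ^ 4 * pfaff d i j k l =
        (β a b c ^ 2 * (d i j - d j i)) * (β a b c ^ 2 * (d k l - d l k)) -
          (β a b c ^ 2 * (d i k - d k i)) * (β a b c ^ 2 * (d j l - d l j)) +
            (β a b c ^ 2 * (d i l - d l i)) * (β a b c ^ 2 * (d j k - d k j)) := by
      rw [pfaff]; ring
    rw [h3]
    simp only [h1]
    ring
  exact (mul_eq_zero.1 h2).resolve_left (pow_ne_zero 4 hβ)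

end Pfaffian

namespace MvPolynomial

theorem pderiv_pderiv_comm {σ : Type*} (i j : σ) (p : MvPolynomial σ ℂ) :
    pderiv i (pderiv j p) = pderiv j (pderiv i p) := by
  have h : ⁅(pderiv i : Derivation ℂ (MvPolynomial σ ℂ) (MvPolynomial σ ℂ)), pderiv (R := ℂ) j⁆ = 0 := by
    refine MvPolynomial.derivation_ext fun k => ?_
    classical
    simp [Derivation.commutator_apply, pderiv_X, Pi.single_apply, apply_ite]
  have := congrArg (fun D : Derivation ℂ (MvPolynomial σ ℂ) (MvPolynomial σ ℂ) => D p) h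
  simpa [Derivation.commutator_apply, sub_eq_zero] using this

end MvPolynomial

/-! ### The Frobenius form and the Euler field -/

section Integrability

open MvPolynomial

variable {n : ℕ}

/-- The coefficients `aᵢ θⱼₖ - aⱼ θᵢₖ + aₖ θᵢⱼ` of `a ∧ da`. -/
noncomputable def frobeniusCoeff (a : Fin (n + 1) → MvPolynomial (Fin (n + 1)) ℂ)
    (i j k : Fin (n + 1)) : MvPolynomial (Fin (n + 1)) ℂ :=
  a i * (pderiv j (a k) - pderiv k (a j)) - a j * (pderiv i (a k) - pderiv k (a i)) +
    a k * (pderiv i (a j) - pderiv j (a i))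

theorem IsHomogeneous.frobeniusCoeff {e : ℕ} {a : Fin (n + 1) → MvPolynomial (Fin (n + 1)) ℂ}
    (ha : ∀ i, (a i).IsHomogeneous (e + 1)) (i j k : Fin (n + 1)) :
    (frobeniusCoeff a i j k).IsHomogeneous (e + 1 + e) := by
  have h : ∀ i j, (pderiv i (a j)).IsHomogeneous e := fun i j => (ha j).pderiv
  exact (((ha i).mul ((h j k).sub (h k j))).sub ((ha j).mul ((h i k).sub (h k i)))).add
    ((ha k).mul ((h i j).sub (h j i)))

/-- Cartan's formula for the Euler field R: the Lie derivative of `a` is (e + 1) a, and the term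
d(i_R a) vanishes because `a` is radial. -/
theorem sum_X_mul_dForm {e : ℕ} {a : Fin (n + 1) → MvPolynomial (Fin (n + 1)) ℂ}
    (ha : ∀ i, (a i).IsHomogeneous e) (hrad : ∑ i, X i * a i = 0) (j : Fin (n + 1)) :
    ∑ i, X i * (pderiv i (a j) - pderiv j (a i)) = (e + 1 : ℕ) • a j := by
  have h1 := congrArg (pderiv j) hrad
  simp only [map_sum, Derivation.leibniz, pderiv_X, smul_eq_mul, map_zero] at h1
  rw [Finset.sum_add_distrib] at h1
  simp only [Pi.single_apply, mul_ite, mul_one, mul_zero, Finset.sum_ite_eq', Finset.mem_univ,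
    if_true] at h1
  simp only [mul_sub, Finset.sum_sub_distrib, (ha j).sum_X_mul_pderiv]
  rw [add_smul, one_smul]
  linear_combination -h1

/-- As i_R a = 0 and i_R da = (e + 1) a, the contraction of a ∧ da is a multiple of a ∧ a. -/
theorem sum_X_mul_frobeniusCoeff {e : ℕ} {a : Fin (n + 1) → MvPolynomial (Fin (n + 1)) ℂ}
    (ha : ∀ i, (a i).IsHomogeneous e) (hrad : ∑ i, X i * a i = 0) (j k : Fin (n + 1)) :
    ∑ i, X i * frobeniusCoeff a i j k = 0 := by
  have h : ∑ i, X i * frobeniusCoeff a i j k =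
      (∑ i, X i * a i) * (pderiv j (a k) - pderiv k (a j)) -
        a j * (∑ i, X i * (pderiv i (a k) - pderiv k (a i))) +
          a k * ∑ i, X i * (pderiv i (a j) - pderiv j (a i)) := by
    rw [Finset.sum_mul, Finset.mul_sum, Finset.mul_sum, ← Finset.sum_sub_distrib,
      ← Finset.sum_add_distrib]
    exact Finset.sum_congr rfl fun i _ => by rw [frobeniusCoeff]; ring
  rw [h, hrad, sum_X_mul_dForm ha hrad, sum_X_mul_dForm ha hrad]
  simp only [nsmul_eq_mul]
  ring

/-- Half of i_R(da ∧ da) is i_R da ∧ da = (e + 1) a ∧ da. Hence da ∧ da = 0 already implies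
integrability. -/
theorem sum_X_mul_pfaff {e : ℕ} {a : Fin (n + 1) → MvPolynomial (Fin (n + 1)) ℂ}
    (ha : ∀ i, (a i).IsHomogeneous e) (hrad : ∑ i, X i * a i = 0) (j k l : Fin (n + 1)) :
    ∑ i, X i * pfaff (fun i j => pderiv i (a j)) i j k l =
      (e + 1 : ℕ) • frobeniusCoeff a j k l := by
  have h : ∑ i, X i * pfaff (fun i j => pderiv i (a j)) i j k l =
      (∑ i, X i * (pderiv i (a j) - pderiv j (a i))) * (pderiv k (a l) - pderiv l (a k)) -
        (∑ i, X i * (pderiv i (a k) - pderiv k (a i))) * (pderiv j (a l) - pderiv l (a j)) +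
          (∑ i, X i * (pderiv i (a l) - pderiv l (a i))) * (pderiv j (a k) - pderiv k (a j)) := by
    rw [Finset.sum_mul, Finset.sum_mul, Finset.sum_mul, ← Finset.sum_sub_distrib,
      ← Finset.sum_add_distrib]
    exact Finset.sum_congr rfl fun i _ => by rw [pfaff]; ring
  rw [h]
  simp only [sum_X_mul_dForm ha hrad, frobeniusCoeff, nsmul_eq_mul]
  ring

/-- The exterior derivative of `a ∧ da` is `da ∧ da`. -/
theorem dForm_frobeniusCoeff (a : Fin (n + 1) → MvPolynomial (Fin (n + 1)) ℂ)
    (i j k l : Fin (n + 1)) :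
    pderiv i (frobeniusCoeff a j k l) - pderiv j (frobeniusCoeff a i k l) +
      pderiv k (frobeniusCoeff a i j l) - pderiv l (frobeniusCoeff a i j k) =
        2 * pfaff (fun i j => pderiv i (a j)) i j k l := by
  simp only [frobeniusCoeff, pfaff, map_add, map_sub, Derivation.leibniz, smul_eq_mul]
  simp only [pderiv_pderiv_comm j i, pderiv_pderiv_comm k i, pderiv_pderiv_comm l i,
    pderiv_pderiv_comm k j, pderiv_pderiv_comm l j, pderiv_pderiv_comm l k]
  ring

end Integrability

/-! ### Polynomial forms as holomorphic lifts -/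

section Lift

open MvPolynomial

variable {n : ℕ}

theorem hasFDerivAt_mvPolynomial_eval (p : MvPolynomial (Fin n) ℂ) (x : Fin n → ℂ) :
    HasFDerivAt (fun y => eval y p) (∑ j, eval x (pderiv j p) •
      ContinuousLinearMap.proj (R := ℂ) (φ := fun _ : Fin n => ℂ) j) x := by
  induction p using MvPolynomial.induction_on with
  | C c =>
    refine ((hasFDerivAt_const (𝕜 := ℂ) c x).congr_fderiv ?_).congr_of_eventuallyEq
      (Filter.Eventually.of_forall fun y => by simp)
    ext v
    simp
  | add p q hp hq =>
    refine ((hp.fun_add hq).congr_fderiv ?_).congr_of_eventuallyEq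
      (Filter.Eventually.of_forall fun y => by simp)
    ext v
    simp [add_mul, Finset.sum_add_distrib]
  | mul_X p i hp =>
    have h := hp.mul (ContinuousLinearMap.proj (R := ℂ) (φ := fun _ : Fin n => ℂ) i).hasFDerivAt
    refine (h.congr_fderiv ?_).congr_of_eventuallyEq (Filter.Eventually.of_forall fun y => by simp)
    ext v
    simp [pderiv_X, Pi.single_apply, apply_ite (eval x), mul_add, Finset.sum_add_distrib,
      Finset.mul_sum, mul_comm, mul_left_comm]

/-- The polynomial one-form on `ℂⁿ⁺¹` with coefficients `a`. -/
noncomputable def polyLift (a : Fin (n + 1) → MvPolynomial (Fin (n + 1)) ℂ)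
    (y : Fin (n + 1) → ℂ) : (Fin (n + 1) → ℂ) →L[ℂ] ℂ :=
  ∑ i, eval y (a i) • ContinuousLinearMap.proj (R := ℂ) (φ := fun _ : Fin (n + 1) => ℂ) i

theorem polyLift_apply (a : Fin (n + 1) → MvPolynomial (Fin (n + 1)) ℂ) (y v : Fin (n + 1) → ℂ) :
    polyLift a y v = ∑ i, eval y (a i) * v i := by
  simp [polyLift]

theorem analyticAt_polyLift (a : Fin (n + 1) → MvPolynomial (Fin (n + 1)) ℂ)
    (x : Fin (n + 1) → ℂ) : AnalyticAt ℂ (polyLift a) x :=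
  Finset.analyticAt_fun_sum _ fun _ _ => (analyticAt_mvPolynomial_eval _ x).smul analyticAt_const

theorem fderiv_polyLift_apply (a : Fin (n + 1) → MvPolynomial (Fin (n + 1)) ℂ)
    (x u v : Fin (n + 1) → ℂ) :
    fderiv ℂ (polyLift a) x u v = ∑ i, (∑ j, eval x (pderiv j (a i)) * u j) * v i := by
  have h : HasFDerivAt (polyLift a) _ x := HasFDerivAt.fun_sum (u := Finset.univ)
    fun i (_ : i ∈ Finset.univ) => (hasFDerivAt_mvPolynomial_eval (a i) x).smul_const
      (ContinuousLinearMap.proj (R := ℂ) (φ := fun _ : Fin (n + 1) => ℂ) i)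
  rw [h.fderiv]
  simp

theorem wedgeDeriv_congr {A B : (Fin (n + 1) → ℂ) → ((Fin (n + 1) → ℂ) →L[ℂ] ℂ)}
    {x : Fin (n + 1) → ℂ} (h : A =ᶠ[𝓝 x] B) (u v w : Fin (n + 1) → ℂ) :
    wedgeDeriv A x u v w = wedgeDeriv B x u v w := by
  simp only [wedgeDeriv, oneFormDeriv, h.fderiv_eq, h.eq_of_nhds]

theorem oneFormDeriv_polyLift (a : Fin (n + 1) → MvPolynomial (Fin (n + 1)) ℂ)
    (x u v : Fin (n + 1) → ℂ) : oneFormDeriv (polyLift a) x u v =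
      ∑ j, ∑ k, eval x (pderiv j (a k) - pderiv k (a j)) * u j * v k := by
  simp only [oneFormDeriv, fderiv_polyLift_apply, map_sub, sub_mul, Finset.sum_sub_distrib,
    Finset.sum_mul]
  rw [Finset.sum_comm]
  congr 1
  exact Finset.sum_congr rfl fun j _ => Finset.sum_congr rfl fun k _ => by ring

theorem wedgeDeriv_polyLift (a : Fin (n + 1) → MvPolynomial (Fin (n + 1)) ℂ)
    (x u v w : Fin (n + 1) → ℂ) : wedgeDeriv (polyLift a) x u v w =
      ∑ i, ∑ j, ∑ k, eval x (frobeniusCoeff a i j k) * u i * v j * w k := by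
  have h1 : polyLift a x v * oneFormDeriv (polyLift a) x u w =
      ∑ i, ∑ j, ∑ k, eval x (a j * (pderiv i (a k) - pderiv k (a i))) * u i * v j * w k := by
    rw [polyLift_apply, oneFormDeriv_polyLift, Finset.sum_mul]
    simp only [Finset.mul_sum, map_mul]
    rw [Finset.sum_comm]
    exact Finset.sum_congr rfl fun i _ => Finset.sum_congr rfl fun j _ =>
      Finset.sum_congr rfl fun k _ => by ring
  have h2 : polyLift a x u * oneFormDeriv (polyLift a) x v w =
      ∑ i, ∑ j, ∑ k, eval x (a i * (pderiv j (a k) - pderiv k (a j))) * u i * v j * w k := by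
    rw [polyLift_apply, oneFormDeriv_polyLift, Finset.sum_mul]
    simp only [Finset.mul_sum, map_mul]
    exact Finset.sum_congr rfl fun i _ => Finset.sum_congr rfl fun j _ =>
      Finset.sum_congr rfl fun k _ => by ring
  have h3 : polyLift a x w * oneFormDeriv (polyLift a) x u v =
      ∑ i, ∑ j, ∑ k, eval x (a k * (pderiv i (a j) - pderiv j (a i))) * u i * v j * w k := by
    rw [mul_comm, polyLift_apply, oneFormDeriv_polyLift]
    simp only [Finset.sum_mul]
    simp only [Finset.mul_sum, map_mul]
    exact Finset.sum_congr rfl fun i _ => Finset.sum_congr rfl fun j _ =>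
      Finset.sum_congr rfl fun k _ => by ring
  rw [wedgeDeriv, h1, h2, h3]
  simp only [← Finset.sum_sub_distrib, ← Finset.sum_add_distrib, frobeniusCoeff, map_add, map_sub]
  exact Finset.sum_congr rfl fun i _ => Finset.sum_congr rfl fun j _ =>
    Finset.sum_congr rfl fun k _ => by ring

/-- On the tangent fields `∂ₘf ∂ᵢ - ∂ᵢf ∂ₘ`, the form `a ∧ da` is a multiple of a component of
`df ∧ a ∧ da`. -/
theorem wedgeDeriv_polyLift_koszulField (f : MvPolynomial (Fin (n + 1)) ℂ)
    (a : Fin (n + 1) → MvPolynomial (Fin (n + 1)) ℂ) (x : Fin (n + 1) → ℂ)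
    (m i j k : Fin (n + 1)) :
    wedgeDeriv (polyLift a) x (koszulField f m i x) (koszulField f m j x) (koszulField f m k x) =
      eval x (pderiv m f ^ 2 * (pderiv m f * frobeniusCoeff a i j k -
        (pderiv i f * frobeniusCoeff a m j k - (pderiv j f * frobeniusCoeff a m i k -
          pderiv k f * frobeniusCoeff a m i j)))) := by
  simp only [wedgeDeriv, oneFormDeriv, fderiv_polyLift_apply, polyLift_apply,
    sum_mul_koszulField, frobeniusCoeff, map_mul, map_sub, map_add, map_pow]
  ring

end Lift

/-! ### Integrability of the extension -/

section Integrable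

open MvPolynomial

theorem isIntegrable_polyTwistedForm {n e : ℕ} {a : Fin (n + 1) → MvPolynomial (Fin (n + 1)) ℂ}
    (ha : ∀ i, (a i).IsHomogeneous e) (hrad : ∑ i, X i * a i = 0)
    (h : ∀ i j k, frobeniusCoeff a i j k = 0) : (polyTwistedForm a ha hrad).IsIntegrable := by
  intro x hx A hA u _ v _ w _
  have hA' : A =ᶠ[𝓝 x] polyLift a := by
    filter_upwards [hA.2, isOpen_ne.mem_nhds (mem_puncturedCone_bot.1 hx)] with y hy hy0
    ext1 v
    rw [hy (mem_puncturedCone_bot.2 hy0) v (mem_coneTangent_bot y v), polyTwistedForm_toFun,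
      polyLift_apply]
  rw [wedgeDeriv_congr hA', wedgeDeriv_polyLift]
  simp [h]

/-- If the restriction of the polynomial form `a` to the cone `f = 0` is integrable, then `f`
divides `df ∧ a ∧ da`. -/
theorem dvd_wedge_frobeniusCoeff {n m e : ℕ} {f : MvPolynomial (Fin (n + 2)) ℂ}
    (hf : f.IsHomogeneous (m + 1)) (hs : IsSmoothEquation f)
    {a : Fin (n + 2) → MvPolynomial (Fin (n + 2)) ℂ}
    {ω : TwistedOneForm (Ideal.span {f}) (e + 1)} (hω : ω.IsIntegrable)
    (haω : ∀ x ∈ puncturedCone (Ideal.span {f}), ∀ v ∈ coneTangent (Ideal.span {f}) x,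
      ω.valueAt x v = ∑ i, eval x (a i) * v i) (i j k l : Fin (n + 2)) :
    f ∣ pderiv i f * frobeniusCoeff a j k l - (pderiv j f * frobeniusCoeff a i k l -
      (pderiv k f * frobeniusCoeff a i j l - pderiv l f * frobeniusCoeff a i j k)) := by
  refine dvd_of_eval_eq_zero_on_zeros hf hs fun x hx hxf => ?_
  have hxc := mem_puncturedCone_span.2 ⟨hx, hxf⟩
  have hlift : ω.IsLocalLift x (polyLift a) :=
    ⟨analyticAt_polyLift a x, Filter.Eventually.of_forall fun y hy v hv => by
      rw [polyLift_apply, ← haω y hy v hv, ω.valueAt_eq hy hv]⟩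
  have hz := hω x hxc _ hlift
  obtain ⟨p, hp⟩ := hs x hx hxf
  have h1 : ∀ i j k, eval x (pderiv p f * frobeniusCoeff a i j k - (pderiv i f *
      frobeniusCoeff a p j k - (pderiv j f * frobeniusCoeff a p i k -
        pderiv k f * frobeniusCoeff a p i j))) = 0 := fun i j k => by
    have := hz _ (koszulField_mem hxf p i) _ (koszulField_mem hxf p j) _ (koszulField_mem hxf p k)
    rw [wedgeDeriv_polyLift_koszulField, map_mul, map_pow] at this
    exact (mul_eq_zero.1 this).resolve_left (pow_ne_zero 2 hp)
  simp only [map_mul, map_sub] at h1 ⊢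
  -- By df ∧ (df ∧ Ψ) = 0, every component of df ∧ Ψ times ∂ₚf is a combination of the components
  -- with first index p, and these vanish by `h1`.
  apply mul_left_cancel₀ hp
  linear_combination eval x (pderiv i f) * h1 j k l - eval x (pderiv j f) * h1 i k l +
    eval x (pderiv k f) * h1 i j l - eval x (pderiv l f) * h1 i j k

/-- The extension to `ℙ⁴` of an integrable form on a cubic threefold is integrable. -/
theorem frobeniusCoeff_eq_zero {f : MvPolynomial (Fin 5) ℂ}
    (hf : f.IsHomogeneous 3) (hs : IsSmoothEquation f)
    {a : Fin 5 → MvPolynomial (Fin 5) ℂ} (ha : ∀ i, (a i).IsHomogeneous 2)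
    (hrad : ∑ i, X i * a i = 0)
    (hdvd : ∀ i j k l, f ∣ pderiv i f * frobeniusCoeff a j k l - (pderiv j f *
      frobeniusCoeff a i k l - (pderiv k f * frobeniusCoeff a i j l -
        pderiv l f * frobeniusCoeff a i j k))) (i j k : Fin 5) :
    frobeniusCoeff a i j k = 0 := by
  have hf0 := hs.ne_zero
  have hr := X_mem_radical_span_pderiv (Nat.succ_ne_zero 2) hf hs
  have hwh : ∀ i, (pderiv i f).IsHomogeneous 2 := fun i => hf.pderiv
  have hwsymm : ∀ i j, pderiv i (pderiv j f) = pderiv j (pderiv i f) := fun i j =>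
    pderiv_pderiv_comm i j f
  have hw3 : ∑ i, X i * pderiv i f = 3 • f := hf.sum_X_mul_pderiv
  have hΨh : ∀ i j k, (frobeniusCoeff a i j k).IsHomogeneous 3 := fun i j k =>
    IsHomogeneous.frobeniusCoeff (e := 1) ha i j k
  have hθh : ∀ i j, (pderiv i (a j) - pderiv j (a i)).IsHomogeneous 1 := fun i j =>
    (ha j).pderiv.sub (ha i).pderiv
  have hΨX := sum_X_mul_frobeniusCoeff ha hrad
  have hdΨ := dForm_frobeniusCoeff a
  have hXP := sum_X_mul_pfaff ha hrad
  have hPexp := pfaff_expansion_eq_zero fun i j => pderiv i (a j)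
  have hPzero := fun (β : Fin 5 → Fin 5 → Fin 5 → MvPolynomial (Fin 5) ℂ) h (x y z : Fin 5) =>
    pfaff_eq_zero_of_wedge_eq_zero (d := fun i j => pderiv i (a j)) (β := β) h
      (a := x) (b := y) (c := z)
  set P := pfaff fun i j => pderiv i (a j) with hP
  set Ψ := frobeniusCoeff a with hΨ
  set w := fun i => pderiv i f with hw
  change ∀ i j k l, f ∣ w i * Ψ j k l - (w j * Ψ i k l - (w k * Ψ i j l - w l * Ψ i j k)) at hdvd
  choose Q hQ using hdvd
  obtain ⟨β, hβ⟩ := exists_eq_wedge_of_wedge_eq_zero₄ hr (by omega) (P := Q) fun i j k l m => by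
    apply mul_left_cancel₀ hf0
    linear_combination -w i * hQ j k l m + w j * hQ i k l m - w k * hQ i j l m + w l * hQ i j k m -
      w m * hQ i j k l
  -- the components of `β` may be taken constant
  set b : Fin 5 → Fin 5 → Fin 5 → ℂ := fun i j k => coeff 0 (β i j k) with hb
  have hS : ∀ i j k l, w i * Ψ j k l - (w j * Ψ i k l - (w k * Ψ i j l - w l * Ψ i j k)) =
      f * (w i * C (b j k l) - (w j * C (b i k l) - (w k * C (b i j l) - w l * C (b i j k)))) := by
    intro i j k l
    have h1 : (w i * Ψ j k l - (w j * Ψ i k l - (w k * Ψ i j l - w l * Ψ i j k))).IsHomogeneous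
        (3 + 2) :=
      ((hwh i).mul (hΨh j k l)).sub (((hwh j).mul (hΨh i k l)).sub
        (((hwh k).mul (hΨh i j l)).sub ((hwh l).mul (hΨh i j k))))
    rw [← homogeneousComponent_eq_self h1, hQ, homogeneousComponent_mul_of_isHomogeneous hf, hβ]
    have h2 : ∀ i j k l, homogeneousComponent 2 (w i * β j k l) = w i * C (b j k l) :=
      fun i j k l => by
        rw [homogeneousComponent_mul_of_isHomogeneous (hwh i) 0, homogeneousComponent_zero]
    simp only [map_sub, h2]
  set γ : Fin 5 → Fin 5 → MvPolynomial (Fin 5) ℂ := fun k l => ∑ i, X i * C (b i k l) with hγ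
  -- The equation df ∧ Ψ = f df ∧ b contracted with the Euler field, using i_R df = 3f and i_R Ψ =
  -- 0, after cancelling f.
  have h3Ψ : ∀ j k l, 3 * Ψ j k l =
      3 * f * C (b j k l) - (w j * γ k l - w k * γ j l + w l * γ j k) := by
    intro j k l
    apply mul_left_cancel₀ hf0
    have h1 : ∑ i, X i * (w i * Ψ j k l - (w j * Ψ i k l - (w k * Ψ i j l - w l * Ψ i j k))) =
        (∑ i, X i * w i) * Ψ j k l - w j * ∑ i, X i * Ψ i k l + w k * ∑ i, X i * Ψ i j l -
          w l * ∑ i, X i * Ψ i j k := by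
      simp only [Finset.sum_mul, Finset.mul_sum, ← Finset.sum_sub_distrib,
        ← Finset.sum_add_distrib]
      exact Finset.sum_congr rfl fun i _ => by ring
    have h2 : ∑ i, X i * (f * (w i * C (b j k l) - (w j * C (b i k l) -
        (w k * C (b i j l) - w l * C (b i j k))))) =
        f * ((∑ i, X i * w i) * C (b j k l) - (w j * γ k l - w k * γ j l + w l * γ j k)) := by
      simp only [hγ, Finset.sum_mul, Finset.mul_sum, ← Finset.sum_sub_distrib,
        ← Finset.sum_add_distrib]
      exact Finset.sum_congr rfl fun i _ => by ring
    simp only [hS] at h1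
    rw [h2, hΨX, hΨX, hΨX, hw3, nsmul_eq_mul] at h1
    push_cast at h1
    linear_combination -h1
  have hγd : ∀ i k l, pderiv i (γ k l) = C (b i k l) := fun i k l => by
    simp [hγ, pderiv_X, Pi.single_apply]
  -- Nothing makes `b` alternate, so the derivative of γ = i_R b contributes this signed sum; for
  -- alternating `b` the result would be 6b.
  set β' : Fin 5 → Fin 5 → Fin 5 → MvPolynomial (Fin 5) ℂ := fun j k l =>
    C (3 * b j k l + b j k l - b k j l + b l j k) with hβ'
  -- The exterior derivative of `h3Ψ`; the second derivatives of f cancel by symmetry.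
  have h6P : ∀ i j k l, 6 * P i j k l =
      w i * β' j k l - w j * β' i k l + w k * β' i j l - w l * β' i j k := by
    intro i j k l
    have h1 : ∀ i j k l, 3 * pderiv i (Ψ j k l) = 3 * w i * C (b j k l) -
        (pderiv i (w j) * γ k l + w j * C (b i k l) - (pderiv i (w k) * γ j l + w k * C (b i j l)) +
          (pderiv i (w l) * γ j k + w l * C (b i j k))) := by
      intro i j k l
      have h := congrArg (pderiv i) (h3Ψ j k l)
      have h3 : (3 : MvPolynomial (Fin 5) ℂ) = C 3 := rfl
      simp only [h3, Derivation.leibniz, smul_eq_mul, map_sub, map_add, hγd, pderiv_C] at h ⊢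
      rw [show pderiv i f = w i from rfl] at h
      linear_combination h
    have hc : C (σ := Fin 5) (3 : ℂ) = 3 := rfl
    have h2 := hdΨ i j k l
    simp only [hβ', map_add, map_sub, map_mul, hc]
    linear_combination -3 * h2 + h1 i j k l - h1 j i k l + h1 k i j l - h1 l i j k +
      γ k l * hwsymm j i - γ j l * hwsymm k i + γ j k * hwsymm l i + γ i l * hwsymm k j -
        γ i k * hwsymm l j + γ i j * hwsymm l k
  -- The Pfaffian expansion and `h6P` give df ∧ (θₙ ∧ β′) = 0, so θₙ ∧ β′ = df ∧ c. The left side is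
  -- linear and the entries of df are quadratic, so both sides vanish.
  have hT : ∀ n i j k l, (pderiv n (a i) - pderiv i (a n)) * β' j k l -
      ((pderiv n (a j) - pderiv j (a n)) * β' i k l - ((pderiv n (a k) - pderiv k (a n)) *
        β' i j l - (pderiv n (a l) - pderiv l (a n)) * β' i j k)) = 0 := by
    intro n
    obtain ⟨c, hc⟩ := exists_eq_wedge_of_wedge_eq_zero₄ hr (by omega)
      (P := fun i j k l => (pderiv n (a i) - pderiv i (a n)) * β' j k l -
      ((pderiv n (a j) - pderiv j (a n)) * β' i k l - ((pderiv n (a k) - pderiv k (a n)) *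
        β' i j l - (pderiv n (a l) - pderiv l (a n)) * β' i j k))) fun i j k l m => by
      change w i * _ - (w j * _ - (w k * _ - (w l * _ - w m * _))) = 0
      have h := hPexp n i j k l m
      linear_combination -6 * h + (pderiv n (a i) - pderiv i (a n)) * h6P j k l m -
        (pderiv n (a j) - pderiv j (a n)) * h6P i k l m +
        (pderiv n (a k) - pderiv k (a n)) * h6P i j l m -
        (pderiv n (a l) - pderiv l (a n)) * h6P i j k m +
        (pderiv n (a m) - pderiv m (a n)) * h6P i j k l
    intro i j k l
    have hβh : ∀ i j k, (β' i j k).IsHomogeneous 0 := fun i j k => isHomogeneous_C _ _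
    have h1 := (((hθh n i).mul (hβh j k l)).sub (((hθh n j).mul (hβh i k l)).sub
      (((hθh n k).mul (hβh i j l)).sub ((hθh n l).mul (hβh i j k)))))
    have h2 := hc i j k l
    rw [← homogeneousComponent_eq_self h1, h2]
    have h3 : ∀ i g, homogeneousComponent (1 + 0) (w i * g) = 0 := fun i g =>
      homogeneousComponent_mul_eq_zero (hwh i) (by omega) g
    simp only [map_sub, h3, sub_zero]
  have hP0 : ∀ i j k l, P i j k l = 0 := by
    by_cases h : ∃ x y z, β' x y z ≠ 0
    · obtain ⟨x, y, z, h⟩ := h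
      exact hPzero β' hT x y z h
    · push Not at h
      intro i j k l
      have := h6P i j k l
      simpa [h] using this
  have := hXP i j k
  simp only [hP0, mul_zero, Finset.sum_const_zero] at this
  exact (smul_eq_zero.1 this.symm).resolve_left (by norm_num)

end Integrable

/-! ### Krull dimension of quotients -/

section KrullDimension

/-- An ideal of coheight at least `dim R - 1` in a factorial domain is zero or is contained in a
principal prime ideal. -/
theorem Ideal.eq_bot_or_exists_le_span_prime {R : Type*} [CommRing R] [IsDomain R]
    [UniqueFactorizationMonoid R] {n : ℕ} (hR : ringKrullDim R ≤ (n + 1 : ℕ)) {J : Ideal R}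
    (hJ : (n : ℕ) ≤ ringKrullDim (R ⧸ J)) : J = ⊥ ∨ ∃ p, Prime p ∧ J ≤ Ideal.span {p} := by
  rw [ringKrullDim_quotient, Order.le_krullDim_iff] at hJ
  obtain ⟨l, hl⟩ := hJ
  have hJq : J ≤ l.head.1.asIdeal := l.head.2
  by_cases h0 : l.head.1.asIdeal = ⊥
  · exact Or.inl (le_bot_iff.1 (h0 ▸ hJq))
  refine Or.inr ?_
  obtain ⟨p, hp, hpp⟩ := l.head.1.isPrime.exists_mem_prime_of_ne_bot h0
  refine ⟨p, hpp, ?_⟩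
  have hle : Ideal.span {p} ≤ l.head.1.asIdeal := (Ideal.span_singleton_le_iff_mem _).2 hp
  rcases hle.eq_or_lt with h | h
  · rwa [h]
  exfalso
  -- If (p) were strictly smaller than the head of the chain, prepending 0 < (p) would give a chain
  -- of length n + 2, beyond the dimension.
  have hpprime : (Ideal.span {p}).IsPrime := (Ideal.span_singleton_prime hpp.ne_zero).2 hpp
  let q1 : PrimeSpectrum R := ⟨Ideal.span {p}, hpprime⟩
  let q0 : PrimeSpectrum R := ⟨⊥, Ideal.isPrime_bot⟩
  have hq1 : q1 < (l.map Subtype.val fun _ _ => id).head := h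
  have hq0 : q0 < ((l.map Subtype.val fun _ _ => id).cons q1 hq1).head := by
    refine bot_lt_iff_ne_bot.2 fun h => hpp.ne_zero ?_
    exact Ideal.span_singleton_eq_bot.1 (congrArg PrimeSpectrum.asIdeal h)
  have h1 := (Order.LTSeries.length_le_krullDim
    (((l.map Subtype.val fun _ _ => id).cons q1 hq1).cons q0 hq0)).trans hR
  simp only [RelSeries.cons_length, Nat.cast_le] at h1
  change l.length + 1 + 1 ≤ n + 1 at h1
  omega

/-- If the maximal ideal `m` satisfies `m J ⊆ √K`, the zero locus of `K` is contained in that of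
`J` up to a point, and dimensions compare. -/
theorem le_ringKrullDim_quotient_of_mul_mem_radical {R : Type*} [CommRing R] {m J K : Ideal R}
    (hm : m.IsMaximal) (h : ∀ g ∈ m, ∀ r ∈ J, g * r ∈ K.radical) {n : ℕ}
    (hn : (n + 1 : ℕ) ≤ ringKrullDim (R ⧸ K)) : (n + 1 : ℕ) ≤ ringKrullDim (R ⧸ J) := by
  rw [ringKrullDim_quotient, Order.le_krullDim_iff] at hn ⊢
  obtain ⟨l, hl⟩ := hn
  have hJ : J ≤ l.head.1.asIdeal := by
    have hrad : K.radical ≤ l.head.1.asIdeal := l.head.1.isPrime.radical_le_iff.2 l.head.2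
    by_cases hml : m ≤ l.head.1.asIdeal
    · exfalso
      -- The chain has positive length, so its head is not maximal; hence some element of `m` lies
      -- outside it and can be cancelled.
      have hlt : l.head < l.last := l.strictMono (Fin.lt_def.2 (by simp [hl]))
      have heq := hm.eq_of_le l.head.1.isPrime.ne_top hml
      have hlt' : l.head.1.asIdeal < l.last.1.asIdeal := hlt
      exact l.last.1.isPrime.ne_top (hm.out.2 _ (heq ▸ hlt'))
    · obtain ⟨g, hg, hgl⟩ := Set.not_subset.1 hml
      exact fun r hr => (l.head.1.isPrime.mem_or_mem (hrad (h g hg r hr))).resolve_left hgl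
  exact ⟨LTSeries.mk l.length (fun i => ⟨(l i).1, hJ.trans (l.head_le i)⟩)
    fun i j hij => l.strictMono hij, hl⟩

end KrullDimension

namespace MvPolynomial

/-- The chain consists of the kernels of setting the first `i` variables to zero. -/
theorem le_height_ker_eval_zero (n : ℕ) :
    (n : ℕ∞) ≤ (RingHom.ker (eval (0 : Fin n → ℂ))).height := by
  let φ : ℕ → MvPolynomial (Fin n) ℂ →ₐ[ℂ] MvPolynomial (Fin n) ℂ := fun i =>
    aeval fun j => if j.1 < i then 0 else X j
  have hφ : ∀ i g, φ (i + 1) (φ i g) = φ (i + 1) g := fun i g => by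
    rw [← AlgHom.comp_apply]
    congr 1
    refine algHom_ext fun j => ?_
    by_cases h : j.1 < i
    · simp [φ, h, h.le]
    · simp [φ, h]
  have hprime : ∀ i, (RingHom.ker (φ i)).IsPrime := fun i => RingHom.ker_isPrime _
  have hh : ∀ i ≤ n, (i : ℕ∞) ≤ (RingHom.ker (φ i)).height := by
    intro i
    induction i with
    | zero => simp
    | succ i ih =>
      intro hi
      have hlt : RingHom.ker (φ i) < RingHom.ker (φ (i + 1)) := by
        refine lt_of_le_of_ne (fun g hg => ?_) fun h => ?_
        · rw [RingHom.mem_ker] at hg ⊢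
          rw [← hφ, hg, map_zero]
        · have h1 : (X ⟨i, hi⟩ : MvPolynomial (Fin n) ℂ) ∈ RingHom.ker (φ (i + 1)) := by
            simp [RingHom.mem_ker, φ]
          rw [← h, RingHom.mem_ker] at h1
          simp [φ] at h1
      push_cast
      exact (add_le_add_left (ih (by omega)) 1).trans (Ideal.height_add_one_le_of_lt_of_isPrime hlt)
  refine (hh n le_rfl).trans (Ideal.height_mono fun g hg => ?_)
  rw [RingHom.mem_ker] at hg ⊢
  have h : eval 0 (φ n g) = eval 0 g := by
    change (eval 0).comp (φ n : MvPolynomial (Fin n) ℂ →+* MvPolynomial (Fin n) ℂ) g = _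
    congr 1
    exact ringHom_ext (fun c => by simp [φ]) fun i => by simp [φ]
  rw [← h, hg, map_zero]

/-- A nonunit divisor of a nonzero homogeneous polynomial vanishes at the origin. -/
theorem eval_zero_eq_zero_of_dvd {n e : ℕ} {a p : MvPolynomial (Fin n) ℂ}
    (ha : a.IsHomogeneous e) (ha0 : a ≠ 0) (hp : ¬ IsUnit p) (h : p ∣ a) : eval 0 p = 0 := by
  by_contra hp0
  obtain ⟨q, rfl⟩ := h
  -- On the line through `x` the product restricts to a nonzero multiple of the e-th power of the
  -- parameter, so p restricts to a monomial; p(0) ≠ 0 makes the exponent zero.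
  have hconst : ∀ x, eval x (p * q) ≠ 0 → eval x p = eval 0 p := by
    intro x hx
    let φ : MvPolynomial (Fin n) ℂ →ₐ[ℂ] Polynomial ℂ :=
      aeval fun j => Polynomial.C (x j) * Polynomial.X
    have hφ : ∀ g c, (φ g).eval c = eval (c • x) g := fun g c => by
      change Polynomial.evalRingHom c (φ g) = _
      induction g using MvPolynomial.induction_on with
      | C r => simp [φ]
      | add g h hg hh => rw [map_add, map_add, hg, hh, map_add]
      | mul_X g i hg =>
        rw [map_mul, map_mul, hg, map_mul]
        congr 1
        simp [φ, mul_comm (x i)]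
    have h1 : φ p * φ q = Polynomial.C (eval x (p * q)) * Polynomial.X ^ e :=
      Polynomial.funext fun c => by
        rw [← map_mul, hφ, ha.eval_smul_eq]
        simp [mul_comm]
    have h2 : φ p ∣ Polynomial.X ^ e := by
      refine ⟨φ q * Polynomial.C (eval x (p * q))⁻¹, ?_⟩
      rw [← mul_assoc, h1, mul_right_comm, ← Polynomial.C_mul, mul_inv_cancel₀ hx,
        Polynomial.C_1, one_mul]
    obtain ⟨j, _, hj⟩ := (dvd_prime_pow Polynomial.prime_X e).1 h2
    obtain ⟨u, hu⟩ := hj.symm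
    obtain ⟨c, _, hc⟩ := Polynomial.isUnit_iff.1 u.isUnit
    rw [← hc] at hu
    have h3 : ∀ t, eval (t • x) p = t ^ j * c := fun t => by rw [← hφ, ← hu]; simp [mul_comm c]
    have hj0 : j = 0 := by
      by_contra hj0
      have := h3 0
      rw [zero_smul, zero_pow hj0, zero_mul] at this
      exact hp0 this
    have h4 := h3 0
    have h5 := h3 1
    rw [zero_smul] at h4
    rw [one_smul] at h5
    rw [h4, h5, hj0]
    simp
  have h1 : (p * q) * (p - C (eval 0 p)) = 0 := MvPolynomial.funext fun x => by
    by_cases hx : eval x (p * q) = 0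
    · rw [map_mul, hx, zero_mul, map_zero]
    · rw [map_mul, map_sub, eval_C, hconst x hx, sub_self, mul_zero, map_zero]
  have h2 := sub_eq_zero.1 ((mul_eq_zero.1 h1).resolve_left ha0)
  exact hp (h2 ▸ (isUnit_iff_ne_zero.2 hp0).map C)

end MvPolynomial

/-! ### Codimension of the singular set -/

section SingularSet

open MvPolynomial

/-- If the restriction of a polynomial form to a hypersurface has singular set of codimension at
least two, then so has the form. -/
theorem singCodimGeTwo_polyTwistedForm {k d e : ℕ} {f : MvPolynomial (Fin (k + 2 + 1)) ℂ}
    (hf : f.IsHomogeneous (d + 1)) (hf0 : f ≠ 0)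
    {a : Fin (k + 2 + 1) → MvPolynomial (Fin (k + 2 + 1)) ℂ} (ha : ∀ i, (a i).IsHomogeneous e)
    (hrad : ∑ i, X i * a i = 0) {ω : TwistedOneForm (Ideal.span {f}) (e + 1)}
    (hω : ω.SingCodimGeTwo)
    (haω : ∀ x ∈ puncturedCone (Ideal.span {f}), ∀ v ∈ coneTangent (Ideal.span {f}) x,
      ω.valueAt x v = ∑ i, eval x (a i) * v i) : (polyTwistedForm a ha hrad).SingCodimGeTwo := by
  have hdim : ringKrullDim (MvPolynomial (Fin (k + 2 + 1)) ℂ) = (k + 2 + 1 : ℕ) := by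
    rw [MvPolynomial.ringKrullDim_of_isNoetherianRing, ringKrullDim_eq_zero_of_field]
    simp
  have hbot : ringKrullDim (MvPolynomial (Fin (k + 2 + 1)) ℂ ⧸
      (⊥ : Ideal (MvPolynomial (Fin (k + 2 + 1)) ℂ))) = (k + 2 + 1 : ℕ) := by
    rw [← hdim]
    exact ringKrullDim_eq_of_ringEquiv (RingEquiv.quotientBot _)
  set J := vanishingIdeal ℂ (polyTwistedForm a ha hrad).singularCone with hJ
  set J0 := vanishingIdeal ℂ ω.singularCone with hJ0
  have hJ0dim : ¬ (k + 1 : ℕ) ≤ ringKrullDim (_ ⧸ J0) := by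
    intro h
    have h1 : ringKrullDim (_ ⧸ J0) + 2 ≤ ringKrullDim (_ ⧸ Ideal.span {f}) := hω
    have h2 := ringKrullDim_quotient_succ_le_of_nonZeroDivisor (mem_nonZeroDivisors_of_ne_zero hf0)
    rw [hdim] at h2
    have h3 := (add_le_add_left ((add_le_add_left h 2).trans h1) 1).trans h2
    norm_cast at h3
    omega
  have haJ : ∀ i, a i ∈ J := by
    intro i
    rw [hJ, mem_vanishingIdeal_iff]
    rintro x ⟨hx, hx0⟩
    have := polyTwistedForm_toFun a ha hrad hx (Pi.single i 1) (mem_coneTangent_bot _ _)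
    rw [hx0] at this
    simpa [Pi.single_apply] using this.symm
  have hmain : ¬ (k + 2 : ℕ) ≤ ringKrullDim (_ ⧸ J) := by
    intro h
    -- The choice p = 0 handles the zero form. Otherwise p need not be known homogeneous: vanishing
    -- at the origin is all that is used.
    obtain ⟨p, hp0, hpa⟩ : ∃ p : MvPolynomial (Fin (k + 2 + 1)) ℂ, eval 0 p = 0 ∧ ∀ i, p ∣ a i := by
      by_cases ha0 : ∀ i, a i = 0
      · exact ⟨0, map_zero _, fun i => by rw [ha0 i]⟩
      push Not at ha0
      obtain ⟨i, hi⟩ := ha0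
      rcases Ideal.eq_bot_or_exists_le_span_prime hdim.le h with h | ⟨p, hp, hJp⟩
      · exact absurd (Ideal.mem_bot.1 (h ▸ haJ i)) hi
      · have hpa : ∀ i, p ∣ a i := fun i => Ideal.mem_span_singleton.1 (hJp (haJ i))
        exact ⟨p, eval_zero_eq_zero_of_dvd (ha i) hi hp.not_isUnit (hpa i), hpa⟩
    have hm : (RingHom.ker (eval (0 : Fin (k + 2 + 1) → ℂ))).IsMaximal :=
      RingHom.ker_isMaximal_of_surjective _ fun c => ⟨C c, eval_C _⟩
    have hf00 : eval 0 f = 0 := by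
      have := hf.eval_smul_eq (0 : ℂ) 0
      rwa [zero_smul, zero_pow (Nat.succ_ne_zero d), zero_mul] at this
    -- The locus f = p = 0 lies in the singular cone except for the origin, which the punctured cone
    -- omits; multiplying by the maximal ideal at 0 removes it.
    refine hJ0dim (le_ringKrullDim_quotient_of_mul_mem_radical hm (K := Ideal.span {f, p}) ?_ ?_)
    · intro g hg r hr
      rw [← vanishingIdeal_zeroLocus_eq_radical (K := ℂ), mem_vanishingIdeal_iff]
      intro x hx
      rw [map_mul]
      by_cases hx0 : x = 0
      · rw [hx0]
        exact mul_eq_zero_of_left hg _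
      rw [mem_vanishingIdeal_iff] at hr
      refine mul_eq_zero_of_right _ (hr x ?_)
      have hxf : eval x f = 0 := hx f (Ideal.subset_span (by simp))
      have hxp : eval x p = 0 := hx p (Ideal.subset_span (by simp))
      have hxc := mem_puncturedCone_span.2 ⟨hx0, hxf⟩
      refine ⟨hxc, LinearMap.ext fun v => ?_⟩
      have := haω x hxc v v.2
      rw [ω.valueAt_eq hxc v.2] at this
      rw [LinearMap.zero_apply]
      refine this.trans (Finset.sum_eq_zero fun i _ => ?_)
      obtain ⟨q, hq⟩ := hpa i
      rw [hq, map_mul, hxp, zero_mul, zero_mul]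
    · have h1 := Ideal.height_le_ringKrullDim_quotient_add_encard
        (p := RingHom.ker (eval (0 : Fin (k + 2 + 1) → ℂ))) {f, p} (by
          rintro g (rfl | rfl)
          · exact hf00
          · exact hp0)
      -- The origin has height at least k + 3 and lies on both hypersurfaces, and two equations
      -- lower the dimension by at most two.
      have h2 : ((k + 2 + 1 : ℕ) : WithBot ℕ∞) ≤ ringKrullDim (_ ⧸ Ideal.span {f, p}) + 2 := by
        refine ((WithBot.coe_le_coe.2 (le_height_ker_eval_zero (k + 2 + 1))).trans h1).trans ?_
        gcongr
        have h3 : ({f, p} : Set (MvPolynomial (Fin (k + 2 + 1)) ℂ)).encard ≤ 2 :=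
          (Set.encard_insert_le {p} f).trans (by rw [Set.encard_singleton, one_add_one_eq_two])
        exact WithBot.coe_le_coe.2 h3
      by_contra h3
      push_cast at h3
      rw [not_le, ENat.WithBot.lt_add_one_iff] at h3
      have h4 := h2.trans (add_le_add_left h3 2)
      norm_cast at h4
      omega
  change ringKrullDim (_ ⧸ J) + 2 ≤ ringKrullDim (MvPolynomial (Fin (k + 2 + 1)) ℂ ⧸
      (⊥ : Ideal (MvPolynomial (Fin (k + 2 + 1)) ℂ)))
  rw [hbot]
  have h : ringKrullDim (_ ⧸ J) ≤ (k + 1 : ℕ) := by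
    rw [← ENat.WithBot.lt_add_one_iff]
    exact_mod_cast not_le.1 hmain
  refine (add_le_add_left h 2).trans ?_
  norm_cast

end SingularSet

/-! ### Restriction of polynomial forms and the extension theorem -/

theorem valueAt_restrict_polyTwistedForm {n e : ℕ} {I : Ideal (MvPolynomial (Fin (n + 1)) ℂ)}
    (a : Fin (n + 1) → MvPolynomial (Fin (n + 1)) ℂ) (ha : ∀ i, (a i).IsHomogeneous e)
    (hrad : ∑ i, MvPolynomial.X i * a i = 0) {x v : Fin (n + 1) → ℂ} (hx : x ∈ puncturedCone I)
    (hv : v ∈ coneTangent I x) :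
    ((polyTwistedForm a ha hrad).restrict (bot_le : ⊥ ≤ I)).valueAt x v =
      ∑ i, MvPolynomial.eval x (a i) * v i := by
  rw [TwistedOneForm.valueAt_eq _ hx hv]
  exact polyTwistedForm_toFun a ha hrad (puncturedCone_anti bot_le hx) v
    (coneTangent_anti bot_le x hv)

theorem restrict_polyTwistedForm_eq {n e : ℕ} {I : Ideal (MvPolynomial (Fin (n + 1)) ℂ)}
    {a : Fin (n + 1) → MvPolynomial (Fin (n + 1)) ℂ} (ha : ∀ i, (a i).IsHomogeneous e)
    (hrad : ∑ i, MvPolynomial.X i * a i = 0) {ω : TwistedOneForm I (e + 1)}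
    (h : ∀ x ∈ puncturedCone I, ∀ v ∈ coneTangent I x,
      ω.valueAt x v = ∑ i, MvPolynomial.eval x (a i) * v i) :
    (polyTwistedForm a ha hrad).restrict bot_le = ω :=
  TwistedOneForm.ext_toFun fun x hx v hv => by
    rw [← TwistedOneForm.valueAt_eq _ hx hv, ← TwistedOneForm.valueAt_eq _ hx hv, h x hx v hv,
      valueAt_restrict_polyTwistedForm a ha hrad hx hv]

theorem mainTheorem4 (f : MvPolynomial (Fin (4 + 1)) ℂ) (hf : f.IsHomogeneous 3)
    (hsmooth : IsSmoothEquation f) (F : CodimOneFoliation (Ideal.span {f}) 1) :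
    ∃ G : CodimOneFoliation (⊥ : Ideal (MvPolynomial (Fin (4 + 1)) ℂ)) 1,
      G.form.restrict bot_le = F.form ∧
      ∀ ω : TwistedOneForm (⊥ : Ideal (MvPolynomial (Fin (4 + 1)) ℂ)) (1 + 2),
        ω.restrict bot_le = F.form → ω = G.form := by
  obtain ⟨a, ha, hrad, haF⟩ := exists_homogeneous_form (n := 1) (m := 2) (e := 2) hf hsmooth F.form
  have hint : (polyTwistedForm a ha hrad).IsIntegrable :=
    isIntegrable_polyTwistedForm ha hrad (frobeniusCoeff_eq_zero hf hsmooth ha hrad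
      (dvd_wedge_frobeniusCoeff (n := 3) hf hsmooth F.integrable haF))
  have hcodim : (polyTwistedForm a ha hrad).SingCodimGeTwo :=
    singCodimGeTwo_polyTwistedForm (k := 2) hf hsmooth.ne_zero ha hrad F.sing_codim haF
  refine ⟨⟨polyTwistedForm a ha hrad, hint, hcodim⟩, ?_, fun ω hω => ?_⟩
  · exact restrict_polyTwistedForm_eq ha hrad haF
  · obtain ⟨b, hb, hbrad, rfl⟩ := exists_eq_polyTwistedForm (n := 3) (e := 2) ω
    -- The coefficients of both lifts have degree 2, the degree of the coefficients of df for a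
    -- cubic, as the uniqueness argument requires.
    have hab : ∀ i, b i - a i = 0 := eq_zero_of_restrict_eq_zero (n := 2) (m := 2) hf hsmooth
      (fun i => (hb i).sub (ha i))
      (by simp only [mul_sub, Finset.sum_sub_distrib]; rw [hbrad, hrad, sub_zero])
      fun x hx v hv => by
        have h1 := haF x hx v hv
        have h2 := valueAt_restrict_polyTwistedForm b hb hbrad hx hv
        have h3 := h2.symm.trans ((congrArg (fun η => η.valueAt x v) hω).trans h1)
        simp only [map_sub, sub_mul, Finset.sum_sub_distrib]
        exact sub_eq_zero.2 h3
    obtain rfl : b = a := funext fun i => sub_eq_zero.1 (hab i)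
    rfl
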